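/- Call a finite simple graph a forest if it has no cycle, and a pseudoforest if each of its connected components contains at most one cycle. A partition of a simple graph $G=(V,E)$ into (pseudo)forests is a tuple of pairwise disjoint edge sets, possibly empty, whose union is $E$ and each of which is the edge set of a (pseudo)forest on $V$. There is a linear-time algorithm that converts every partition $(P_A,P_B,P_C)$ of a finite simple graph $G$ into three pseudoforests into a partition $(F_1,F_2,F_3,F_4)$ of $G$ into four forests such that $F_4$ has maximum degree at most three. Precisely: there are a fixed program for the word RAM (words of $\log_2(n+m+1)+O(1)$ bits, unit-cost addition, subtraction, comparison and memory access) and a constant $K$ such that, for all $n,m\ge 0$, for every simple graph $G$ with vertex set $\{0,\dots,n-1\}$ and $m$ edges, and for every partition $(P_A,P_B,P_C)$ of $G$ into pseudoforests, given as $n$, $m$ and a list of the $m$ edges (in any order, each in any orientation) with the index of the part containing each edge, the program halts after at most $K\,(n+m+1)$ steps and outputs, for each edge of the list, the index of the part containing it in such a partition $(F_1,F_2,F_3,F_4)$. -/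

import Mathlib

/-! ### Partitions of the edge set of a simple graph -/

/-- `E(G)` is the disjoint union of the edge sets of `H 0, …, H (k-1)`; parts may be empty. -/
structure IsEdgePartition {V : Type*} {k : ℕ} (G : SimpleGraph V) (H : Fin k → SimpleGraph V) :
    Prop where
  disjoint : ∀ i j, i ≠ j → Disjoint (H i).edgeSet (H j).edgeSet
  union : (⋃ i, (H i).edgeSet) = G.edgeSet

/-- A pseudoforest has at most one cycle per connected component: any two cycles in the same
component are the same cycle, that is, have the same edges. -/
def IsPseudoforest {V : Type*} (H : SimpleGraph V) : Prop :=
  ∀ ⦃u v : V⦄ (p : H.Walk u u) (q : H.Walk v v), p.IsCycle → q.IsCycle → H.Reachable u v →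
    ∀ e, e ∈ p.edges ↔ e ∈ q.edges

def IsPseudoforestPartition {V : Type*} {k : ℕ} (G : SimpleGraph V)
    (P : Fin k → SimpleGraph V) : Prop :=
  IsEdgePartition G P ∧ ∀ i, IsPseudoforest (P i)

def IsForestPartition {V : Type*} {k : ℕ} (G : SimpleGraph V)
    (F : Fin k → SimpleGraph V) : Prop :=
  IsEdgePartition G F ∧ ∀ i, (F i).IsAcyclic

/-- A list of `m` edges on the vertices `0, …, n-1`, each with the number of its part. -/
structure EdgeList (n m k : ℕ) where
  src : Fin m → Fin n
  dst : Fin m → Fin n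
  part : Fin m → Fin k

/-- The list contains every edge of every `H j` exactly once, in one of its two orientations and
with the part number `j`, and contains nothing else. The order of the list is arbitrary. -/
structure EdgeList.Represents {n m k : ℕ} (L : EdgeList n m k)
    (H : Fin k → SimpleGraph (Fin n)) : Prop where
  nodup : Function.Injective fun i => s(L.src i, L.dst i)
  edges : ∀ j, (H j).edgeSet = {e | ∃ i, L.part i = j ∧ e = s(L.src i, L.dst i)}

/-! ### A word RAM with step count

Programs are structured (`while`) programs over registers and arrays, whose names are fixed in the
program text, so that each program has finitely many of them. Every operation on words, every
memory access, every test and every assignment costs one step. The only arithmetic is addition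
and truncated subtraction. -/

namespace RAM

structure State where
  reg : ℕ → ℕ
  arr : ℕ → ℕ → ℕ

inductive Expr where
  | const (k : ℕ)
  | reg (x : ℕ)
  | get (a : ℕ) (i : Expr)
  | add (e f : Expr)
  | sub (e f : Expr)

def Expr.eval (s : State) : Expr → ℕ
  | const k => k
  | reg x => s.reg x
  | get a i => s.arr a (i.eval s)
  | add e f => e.eval s + f.eval s
  | sub e f => e.eval s - f.eval s

def Expr.cost : Expr → ℕ
  | const _ => 1
  | reg _ => 1
  | get _ i => i.cost + 1
  | add e f => e.cost + f.cost + 1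
  | sub e f => e.cost + f.cost + 1

inductive Test where
  | lt (e f : Expr)
  | eq (e f : Expr)
  | not (b : Test)
  | and (b c : Test)

def Test.eval (s : State) : Test → Prop
  | lt e f => e.eval s < f.eval s
  | eq e f => e.eval s = f.eval s
  | not b => ¬ b.eval s
  | and b c => b.eval s ∧ c.eval s

def Test.cost : Test → ℕ
  | lt e f => e.cost + f.cost + 1
  | eq e f => e.cost + f.cost + 1
  | not b => b.cost + 1
  | and b c => b.cost + c.cost + 1

inductive Program where
  | skip
  | set (x : ℕ) (e : Expr)
  | put (a : ℕ) (i e : Expr)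
  | seq (p q : Program)
  | ite (b : Test) (p q : Program)
  | while (b : Test) (p : Program)

def State.setReg (s : State) (x v : ℕ) : State :=
  { s with reg := Function.update s.reg x v }

def State.setArr (s : State) (a i v : ℕ) : State :=
  { s with arr := Function.update s.arr a (Function.update (s.arr a) i v) }

/-- `Exec W p s t s'`: on a machine whose memory words hold the numbers `0, …, W`, the program `p`
started in `s` halts after exactly `t` steps in `s'`. A program that tries to store a number above
`W`, or to access an array at an index above `W` by `put`, is stuck. Inside an expression
intermediate values exceed `W` at most by a factor that depends on the program alone. -/
inductive Exec (W : ℕ) : Program → State → ℕ → State → Prop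
  | skip (s : State) : Exec W .skip s 1 s
  | set {s : State} {x : ℕ} {e : Expr} (h : e.eval s ≤ W) :
      Exec W (.set x e) s (e.cost + 1) (s.setReg x (e.eval s))
  | put {s : State} {a : ℕ} {i e : Expr} (hi : i.eval s ≤ W) (h : e.eval s ≤ W) :
      Exec W (.put a i e) s (i.cost + e.cost + 1) (s.setArr a (i.eval s) (e.eval s))
  | seq {p q : Program} {s s₁ s₂ : State} {t₁ t₂ : ℕ} (h₁ : Exec W p s t₁ s₁)
      (h₂ : Exec W q s₁ t₂ s₂) : Exec W (.seq p q) s (t₁ + t₂) s₂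
  | ite_true {b : Test} {p q : Program} {s s₁ : State} {t : ℕ} (hb : b.eval s)
      (h : Exec W p s t s₁) : Exec W (.ite b p q) s (b.cost + 1 + t) s₁
  | ite_false {b : Test} {p q : Program} {s s₁ : State} {t : ℕ} (hb : ¬ b.eval s)
      (h : Exec W q s t s₁) : Exec W (.ite b p q) s (b.cost + 1 + t) s₁
  | while_false {b : Test} {p : Program} {s : State} (hb : ¬ b.eval s) :
      Exec W (.while b p) s (b.cost + 1) s
  | while_true {b : Test} {p : Program} {s s₁ s₂ : State} {t₁ t₂ : ℕ} (hb : b.eval s)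
      (h₁ : Exec W p s t₁ s₁) (h₂ : Exec W (.while b p) s₁ t₂ s₂) :
      Exec W (.while b p) s (b.cost + 1 + t₁ + t₂) s₂

/-- The machine is deterministic, so final state and running time are functions of the input. -/
theorem Exec.deterministic {W : ℕ} {p : Program} {s s₁ s₂ : State} {t₁ t₂ : ℕ}
    (h₁ : Exec W p s t₁ s₁) (h₂ : Exec W p s t₂ s₂) : t₁ = t₂ ∧ s₁ = s₂ := by
  induction h₁ generalizing t₂ s₂ with
  | skip s => cases h₂; exact ⟨rfl, rfl⟩
  | set h => cases h₂; exact ⟨rfl, rfl⟩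
  | put hi h => cases h₂; exact ⟨rfl, rfl⟩
  | seq _ _ ih₁ ih₂ =>
    cases h₂ with
    | seq k₁ k₂ =>
      obtain ⟨rfl, rfl⟩ := ih₁ k₁
      obtain ⟨rfl, rfl⟩ := ih₂ k₂
      exact ⟨rfl, rfl⟩
  | ite_true hb _ ih =>
    cases h₂ with
    | ite_true _ k => obtain ⟨rfl, rfl⟩ := ih k; exact ⟨rfl, rfl⟩
    | ite_false hb' _ => exact absurd hb hb'
  | ite_false hb _ ih =>
    cases h₂ with
    | ite_true hb' _ => exact absurd hb' hb
    | ite_false _ k => obtain ⟨rfl, rfl⟩ := ih k; exact ⟨rfl, rfl⟩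
  | while_false hb =>
    cases h₂ with
    | while_false _ => exact ⟨rfl, rfl⟩
    | while_true hb' _ _ => exact absurd hb' hb
  | while_true hb _ _ ih₁ ih₂ =>
    cases h₂ with
    | while_false hb' => exact absurd hb hb'
    | while_true _ k₁ k₂ =>
      obtain ⟨rfl, rfl⟩ := ih₁ k₁
      obtain ⟨rfl, rfl⟩ := ih₂ k₂
      exact ⟨rfl, rfl⟩

/-- An array holding the given numbers, followed by zeros. -/
def arrayOf {m k : ℕ} (f : Fin m → Fin k) (i : ℕ) : ℕ :=
  if h : i < m then (f ⟨i, h⟩ : ℕ) else 0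

/-- The input: registers `0` and `1` hold `n` and `m`, arrays `0`, `1` and `2` hold the edge list,
and all other memory is zero. -/
def inputState {n m k : ℕ} (L : EdgeList n m k) : State where
  reg := fun x => if x = 0 then n else if x = 1 then m else 0
  arr := fun a => if a = 0 then arrayOf L.src else if a = 1 then arrayOf L.dst
    else if a = 2 then arrayOf L.part else fun _ => 0

end RAM

/-! ### Forests, pseudoforests and path ends -/

namespace SimpleGraph

variable {V : Type*} {G : SimpleGraph V}

/-! Stripping leaves from each part until none remain leaves its core. A component of a pseudoforest
has at most one cycle, so the core of a part is a union of vertex-disjoint cycles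
(`IsPseudoforest.degree_le_two`, `ContainsLeafless.isCore`). Removing one edge of every cycle turns
the part into a forest (`IsCore.isAcyclic_of_transversal`). The removed edges of one part form a
matching, so all of them together have maximum degree at most three. It remains to choose them, and
to divert a few of them away from forest `3`, so that all four forests stay acyclic.

On a cycle of part `0` any edge will do. The chosen edges of parts `0` and `1` form paths, and a new
edge closes a cycle only if it joins the two ends of one path. Two consecutive edges of a cycle
share a vertex `y` and lead to different vertices, so at least one of them is harmless. Storing at
each path end the opposite end makes this test take constant time (`PathEnds.sup_edge`,
`swing_pre`).

Consider next a cycle of part `2` with a vertex `y` that no chosen edge of part `0` covers. If part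
`1` misses `y` too, a cycle edge at `y` is pendant in forest `3`. Otherwise let `g = yy'` be the
chosen edge of part `1` at `y`. If part `1` misses the other end of the cycle edge at `y`, the path
argument applies again. If it covers both ends, there are two cases. When `y'` has no edge diverted
to forest `1`, the cycle edge is diverted there (`Split.step_linkB`). When it has one, `g` itself
moves to forest `2`, which makes `y` a leaf in forest `3` (`Split.step_fix`). On the cycles of part
`2` that remain, part `0` covers every vertex, and an edge is diverted to forest `0` by the path
argument (`Split.step_linkA`).

A diverted edge has both ends covered by chosen edges of the receiving part. Two covered vertices in
one component of that part lie on the same chosen edge. Hence acyclicity needs checking only among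
chosen and diverted edges, and it carries over to the part without its chosen edges
(`IsAcyclic.sup_transfer`, `IsTransversal.isAcyclic_union`).

For linear time, each vertex of each part stores its degree and the sum modulo `m` of the indices of
its edges. The sum names the only edge at a leaf and, on a cycle, the edge after a given one, so no
adjacency lists are needed. Removing an edge and marking an edge are each charged once to that edge,
through the fuel in `Halts`. -/

theorem not_reachable_of_isolated {x y : V} (hx : ∀ u, ¬ G.Adj x u) (hxy : x ≠ y) :
    ¬ G.Reachable x y := by
  rintro ⟨p⟩
  exact hx _ (p.adj_snd (p.not_nil_of_ne hxy))

theorem reachable_sup_edge {x y p q : V} (h : (G ⊔ edge x y).Reachable p q) :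
    G.Reachable p q ∨ (G.Reachable p x ∧ G.Reachable y q) ∨
      (G.Reachable p y ∧ G.Reachable x q) := by
  obtain ⟨w⟩ := h
  induction w with
  | nil => exact Or.inl (Reachable.refl _)
  | cons hadj _ ih =>
    rw [sup_adj, edge_adj] at hadj
    rcases hadj with hadj | ⟨⟨rfl, rfl⟩ | ⟨rfl, rfl⟩, -⟩
    · have := hadj.reachable
      rcases ih with h | ⟨h₁, h₂⟩ | ⟨h₁, h₂⟩
      · exact Or.inl (this.trans h)
      · exact Or.inr (Or.inl ⟨this.trans h₁, h₂⟩)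
      · exact Or.inr (Or.inr ⟨this.trans h₁, h₂⟩)
    · rcases ih with h | ⟨h₁, h₂⟩ | ⟨h₁, h₂⟩
      · exact Or.inr (Or.inl ⟨Reachable.refl _, h⟩)
      · exact Or.inr (Or.inl ⟨Reachable.refl _, h₂⟩)
      · exact Or.inl h₂
    · rcases ih with h | ⟨h₁, h₂⟩ | ⟨h₁, h₂⟩
      · exact Or.inr (Or.inr ⟨Reachable.refl _, h⟩)
      · exact Or.inl h₂
      · exact Or.inr (Or.inr ⟨Reachable.refl _, h₂⟩)

/-- A forest with pairwise unreachable vertices `R` has at most `|V| - |R|` edges. -/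
theorem IsAcyclic.ncard_edgeSet_add_card_le [Finite V] (hG : G.IsAcyclic) (R : Set V)
    (hR : ∀ r ∈ R, ∀ r' ∈ R, G.Reachable r r' → r = r') :
    G.edgeSet.ncard + R.ncard ≤ Nat.card V := by
  induction hk : G.edgeSet.ncard generalizing G R with
  | zero => simpa using Set.ncard_le_card R
  | succ k ih =>
    obtain ⟨e, he⟩ : G.edgeSet.Nonempty := by
      rw [← Set.ncard_pos (Set.toFinite _)]; omega
    induction e with | h u v =>
    set G' := G.deleteEdges {s(u, v)} with hG'
    have hle : G' ≤ G := deleteEdges_le _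
    have hb : ¬ G'.Reachable u v := (isAcyclic_iff_forall_isBridge.1 hG) he
    have hcard : G'.edgeSet.ncard = k := by
      rw [hG', edgeSet_deleteEdges, Set.ncard_sdiff_singleton_of_mem he, hk]; rfl
    have huv : G.Reachable u v := Adj.reachable he
    -- Deleting the edge separates `u` from `v`, and they cannot both reach a vertex of `R`. An end
    -- that reaches none is added to `R`, which makes up for the lost edge.
    have key : ∀ z, (∀ r ∈ R, ¬ G'.Reachable z r) → k + 1 + R.ncard ≤ Nat.card V := by
      intro z hz
      have hzR : z ∉ R := fun h => hz z h (Reachable.refl _)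
      have := ih (hG.anti hle) (insert z R) (by
        rintro r (rfl | hr) r' (rfl | hr') h
        · rfl
        · exact absurd h (hz _ hr')
        · exact absurd h.symm (hz _ hr)
        · exact hR _ hr _ hr' (h.mono hle)) hcard
      rw [Set.ncard_insert_of_notMem hzR (Set.toFinite _)] at this
      omega
    by_cases hu : ∀ r ∈ R, ¬ G'.Reachable u r
    · exact key u hu
    · push Not at hu
      obtain ⟨r, hr, hur⟩ := hu
      refine key v fun r' hr' hvr' => hb ?_
      have : r = r' := hR _ hr _ hr'
        ((hur.symm.mono hle).trans (huv.trans (hvr'.mono hle)))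
      exact hur.trans (this ▸ hvr'.symm)

/-- The vertices without a neighbour. -/
def isolatedVerts (G : SimpleGraph V) : Set V := {v | ∀ u, ¬ G.Adj v u}

/-- Handshake count: a vertex without degree one contributes at least two to its degree plus twice
the indicator of being isolated, and these contributions add up to `2 (|E| + |I|)`, where `I` is the
set of isolated vertices. In the equality case no vertex can contribute more than two. -/
theorem card_le_ncard_edgeSet_add_isolated [Fintype V] [DecidableRel G.Adj]
    (h : ∀ v, G.degree v ≠ 1) :
    Nat.card V ≤ G.edgeSet.ncard + G.isolatedVerts.ncard ∧
      (G.edgeSet.ncard + G.isolatedVerts.ncard ≤ Nat.card V → ∀ v, G.degree v ≤ 2) := by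
  classical
  have hsum := G.sum_degrees_eq_twice_card_edges
  have hE : G.edgeSet.ncard = G.edgeFinset.card := by
    rw [← coe_edgeFinset, Set.ncard_coe_finset]
  have hI : G.isolatedVerts.ncard = ∑ v : V, if G.degree v = 0 then 1 else 0 := by
    rw [Finset.sum_boole, Nat.cast_id, ← Set.ncard_coe_finset]
    congr 1
    ext v
    simp only [isolatedVerts, Set.mem_ofPred_eq, Finset.coe_filter, Finset.mem_univ, true_and]
    constructor
    · intro hv
      by_contra h0
      obtain ⟨u, hu⟩ := (G.degree_pos_iff_exists_adj v).1 (Nat.pos_of_ne_zero h0)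
      exact hv u hu
    · intro h0 u hu
      have := (G.degree_pos_iff_exists_adj v).2 ⟨u, hu⟩
      omega
  have hV : 2 * Nat.card V = ∑ v : V, 2 := by simp [mul_comm]
  have hpt : ∀ v ∈ Finset.univ, 2 ≤ G.degree v + 2 * if G.degree v = 0 then 1 else 0 := by
    intro v _
    have := h v
    split_ifs <;> omega
  have htot : ∑ v : V, (G.degree v + 2 * if G.degree v = 0 then 1 else 0) =
      2 * G.edgeSet.ncard + 2 * G.isolatedVerts.ncard := by
    rw [Finset.sum_add_distrib, hsum, ← Finset.mul_sum, hI, hE]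
  constructor
  · have := Finset.sum_le_sum hpt
    omega
  · intro hle v
    by_contra hv
    have := Finset.sum_lt_sum hpt ⟨v, Finset.mem_univ v, by split_ifs <;> omega⟩
    omega

/-- The isolated vertices together with `u` are pairwise unreachable. Without a leaf, the forest
bound for this set contradicts the handshake count. -/
theorem IsAcyclic.exists_degree_eq_one [Fintype V] [DecidableRel G.Adj] (hG : G.IsAcyclic)
    {u v : V} (huv : G.Adj u v) : ∃ w, G.degree w = 1 := by
  by_contra! h
  have h1 := (card_le_ncard_edgeSet_add_isolated h).1
  have hu : u ∉ G.isolatedVerts := fun h => h v huv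
  have h2 := hG.ncard_edgeSet_add_card_le (insert u G.isolatedVerts) (by
    rintro r (rfl | hr) r' (rfl | hr') hrr
    · rfl
    · by_contra hne
      exact not_reachable_of_isolated hr' (Ne.symm hne) hrr.symm
    · by_contra hne
      exact not_reachable_of_isolated hr hne hrr
    · by_contra hne
      exact not_reachable_of_isolated hr hne hrr)
  rw [Set.ncard_insert_of_notMem hu (Set.toFinite _)] at h2
  omega

/-- Adding finitely many edges, each of which has an end of degree one in the result. -/
theorem IsAcyclic.sup_pendant {ι : Type*} (hG : G.IsAcyclic) (S : Finset ι) (x y : ι → V)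
    (hne : ∀ i ∈ S, x i ≠ y i) (hiso : ∀ i ∈ S, ∀ u, ¬ G.Adj (x i) u)
    (hx : ∀ i ∈ S, ∀ j ∈ S, i ≠ j → x i ≠ x j ∧ x i ≠ y j) :
    (G ⊔ S.sup fun i => edge (x i) (y i)).IsAcyclic := by
  classical
  induction S using Finset.induction_on with
  | empty => simpa using hG
  | insert a S ha ih =>
    rw [Finset.sup_insert, sup_comm (edge _ _), ← sup_assoc]
    have ih' := ih (fun i hi => hne i (Finset.mem_insert_of_mem hi))
      (fun i hi => hiso i (Finset.mem_insert_of_mem hi))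
      (fun i hi j hj => hx i (Finset.mem_insert_of_mem hi) j (Finset.mem_insert_of_mem hj))
    refine ih'.sup_edge_of_not_reachable
      (not_reachable_of_isolated (fun u hu => ?_) (hne a (Finset.mem_insert_self _ _)))
    rw [sup_adj] at hu
    rcases hu with hu | hu
    · exact hiso a (Finset.mem_insert_self _ _) u hu
    · rw [Finset.sup_eq_iSup] at hu
      simp only [iSup_adj] at hu
      obtain ⟨i, hi, hu⟩ := hu
      have hia : a ≠ i := fun h => ha (h ▸ hi)
      have := hx a (Finset.mem_insert_self _ _) i (Finset.mem_insert_of_mem hi) hia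
      rw [edge_adj] at hu
      tauto

/-- If each component of `R` meets the ends of the edges `x i, y i` only in vertices that `M`
connects, and `M` together with these edges is a forest, then so is `R` together with them. -/
theorem IsAcyclic.sup_transfer {ι : Type*} {R M : SimpleGraph V} (hR : R.IsAcyclic)
    (T : Set V) (hT : ∀ u ∈ T, ∀ v ∈ T, R.Reachable u v → M.Reachable u v)
    (S : Finset ι) (x y : ι → V) (hne : ∀ i ∈ S, x i ≠ y i)
    (hx : ∀ i ∈ S, x i ∈ T) (hy : ∀ i ∈ S, y i ∈ T)
    (hM : ∀ i ∈ S, ¬ M.Adj (x i) (y i))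
    (hinj : ∀ i ∈ S, ∀ j ∈ S, s(x i, y i) = s(x j, y j) → i = j)
    (hacyc : (M ⊔ S.sup fun i => edge (x i) (y i)).IsAcyclic) :
    (R ⊔ S.sup fun i => edge (x i) (y i)).IsAcyclic := by
  classical
  induction S using Finset.induction_on with
  | empty => simpa using hR
  | insert a S ha ih =>
    have hS : ∀ i ∈ S, i ∈ insert a S := fun i hi => Finset.mem_insert_of_mem hi
    have haS : a ∈ insert a S := Finset.mem_insert_self _ _
    rw [Finset.sup_insert, sup_comm (edge _ _), ← sup_assoc] at hacyc ⊢
    obtain ⟨hac, hbr⟩ := isAcyclic_sup_fromEdgeSet_iff.1 hacyc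
    have adjS : ∀ u v, (S.sup fun i => edge (x i) (y i)).Adj u v →
        ∃ i ∈ S, s(u, v) = s(x i, y i) := by
      intro u v h
      rw [Finset.sup_eq_iSup] at h
      simp only [iSup_adj] at h
      obtain ⟨i, hi, h⟩ := h
      exact ⟨i, hi, ((adj_edge _ _).1 h).1.symm⟩
    have ih' := ih (fun i hi => hne i (hS i hi)) (fun i hi => hx i (hS i hi))
      (fun i hi => hy i (hS i hi)) (fun i hi => hM i (hS i hi))
      (fun i hi j hj => hinj i (hS i hi) j (hS j hj)) hac
    refine ih'.sup_edge_of_not_reachable fun hreach => ?_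
    -- A walk to a terminal is projected to `M` with the added edges: its `R`-segments between
    -- terminals become `M`-connections, and only an initial `R`-segment is left over.
    have step : ∀ u v, (R ⊔ S.sup fun i => edge (x i) (y i)).Reachable u v → v ∈ T →
        ∃ t ∈ T, R.Reachable u t ∧ (M ⊔ S.sup fun i => edge (x i) (y i)).Reachable t v := by
      rintro u v ⟨w⟩
      induction w with
      | nil => exact fun hv => ⟨_, hv, Reachable.refl _, Reachable.refl _⟩
      | @cons u u' v hadj p ihp =>
        intro hv
        obtain ⟨t, ht, h1, h2⟩ := ihp hv
        rw [sup_adj] at hadj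
        rcases hadj with hadj | hadj
        · exact ⟨t, ht, hadj.reachable.trans h1, h2⟩
        · obtain ⟨i, hi, he⟩ := adjS _ _ hadj
          have hu : u ∈ T ∧ u' ∈ T := by
            rw [Sym2.eq_iff] at he
            rcases he with ⟨rfl, rfl⟩ | ⟨rfl, rfl⟩
            · exact ⟨hx i (hS i hi), hy i (hS i hi)⟩
            · exact ⟨hy i (hS i hi), hx i (hS i hi)⟩
          refine ⟨u, hu.1, Reachable.refl _, Reachable.trans ?_
            (((hT _ hu.2 _ ht h1).mono le_sup_left).trans h2)⟩
          exact (Adj.reachable (G := M ⊔ S.sup fun i => edge (x i) (y i)) (Or.inr hadj))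
    obtain ⟨t, ht, h1, h2⟩ := step _ _ hreach (hy a haS)
    have h3 := (((hT _ (hx a haS) _ ht h1).mono
      (le_sup_left : M ≤ M ⊔ S.sup fun i => edge (x i) (y i))).trans h2)
    -- In the forest formed by `M` and all the edges, the ends of edge `a` can be connected without
    -- it only if they are equal or already adjacent, and each possibility is excluded.
    rcases hbr h3 with h | h
    · exact hne a haS h
    · rw [sup_adj] at h
      rcases h with h | h
      · exact hM a haS h
      · obtain ⟨i, hi, he⟩ := adjS _ _ h
        have := hinj a haS i (hS i hi) he
        exact ha (this ▸ hi)

/-- At most one neighbour. -/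
def IsEnd (G : SimpleGraph V) (v : V) : Prop := ∀ u w, G.Adj v u → G.Adj v w → u = w

/-- `G` is a forest in which `o` maps each vertex of degree at most one to the other such vertex
of its component. -/
structure PathEnds (G : SimpleGraph V) (o : V → V) : Prop where
  acyclic : G.IsAcyclic
  isolated : ∀ v, (∀ u, ¬ G.Adj v u) → o v = v
  ends : ∀ p q, G.IsEnd p → G.IsEnd q → p ≠ q → G.Reachable p q → o p = q
  reachable : ∀ p, G.IsEnd p → G.Reachable p (o p)

theorem PathEnds.bot : PathEnds (⊥ : SimpleGraph V) id where
  acyclic := isAcyclic_bot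
  isolated _ _ := rfl
  ends p q _ _ hne h := absurd h (not_reachable_of_isolated (by simp) hne)
  reachable p _ := Reachable.refl p

/-- The test `ho` suffices for acyclicity, because two distinct ends in one component are matched by
`o`. The joined path ends in `o x` and `o y`, and only these two entries change. Entries at vertices
that are no longer ends become stale, which is harmless since the fields that matter speak of ends
only. -/
theorem PathEnds.sup_edge [DecidableEq V] {o : V → V} (h : PathEnds G o) {x y : V}
    (hx : G.IsEnd x) (hy : G.IsEnd y) (hxy : x ≠ y) (ho : o y ≠ x) :
    PathEnds (G ⊔ edge x y)
      (Function.update (Function.update o (o x) (o y)) (o y) (o x)) := by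
  have hn : ¬ G.Reachable x y := fun hr => ho (h.ends y x hy hx hxy.symm hr.symm)
  have hle : G ≤ G ⊔ edge x y := le_sup_left
  have hxa := h.reachable x hx
  have hyb := h.reachable y hy
  have hedge : (G ⊔ edge x y).Reachable x y :=
    Adj.reachable (Or.inr (by rw [edge_adj]; exact ⟨Or.inl ⟨rfl, rfl⟩, hxy⟩))
  have hmono : ∀ p, (G ⊔ edge x y).IsEnd p → G.IsEnd p :=
    fun p hp u w hu hw => hp u w (hle hu) (hle hw)
  have hab : o x ≠ o y := fun e => hn (hxa.trans (e ▸ hyb.symm))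
  -- An end of the new graph on the side of `x` is `o x`. If it is `x` itself, then the new edge is
  -- its only edge, so `x` was isolated and `o x = x`.
  have claim : ∀ x y, G.IsEnd x → x ≠ y → ¬ G.Reachable x y → ∀ p, (G ⊔ edge x y).IsEnd p →
      G.Reachable p x → p = o x := by
    intro x y hx hxy hn p hp hpx
    have hp' : G.IsEnd p := fun u w hu hw => hp u w (Or.inl hu) (Or.inl hw)
    by_cases e : p = x
    · subst e
      refine (h.isolated p fun u hu => hn ?_).symm
      have : u = y := hp u y (Or.inl hu)
        (Or.inr (by rw [edge_adj]; exact ⟨Or.inl ⟨rfl, rfl⟩, hxy⟩))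
      exact this ▸ hu.reachable
    · exact (h.ends x p hx hp' (Ne.symm e) hpx.symm).symm
  have cx := claim x y hx hxy hn
  have cy := claim y x hy hxy.symm (fun hr => hn hr.symm)
  rw [edge_comm] at cy
  refine ⟨h.acyclic.sup_edge_of_not_reachable hn, ?_, ?_, ?_⟩
  · intro v hv
    have hv' : ∀ u, ¬ G.Adj v u := fun u hu => hv u (hle hu)
    have h1 : v ≠ x := by
      rintro rfl
      exact hv y (Or.inr (by rw [edge_adj]; exact ⟨Or.inl ⟨rfl, rfl⟩, hxy⟩))
    have h2 : v ≠ y := by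
      rintro rfl
      exact hv x (Or.inr (by rw [edge_adj]; exact ⟨Or.inr ⟨rfl, rfl⟩, hxy.symm⟩))
    have h3 : v ≠ o x := by
      intro e
      exact not_reachable_of_isolated hv' h1 (e ▸ hxa.symm)
    have h4 : v ≠ o y := by
      intro e
      exact not_reachable_of_isolated hv' h2 (e ▸ hyb.symm)
    rw [Function.update_of_ne h4, Function.update_of_ne h3, h.isolated v hv']
  · intro p q hp hq hpq hr
    rcases reachable_sup_edge hr with hr | ⟨h1, h2⟩ | ⟨h1, h2⟩
    · have h3 : p ≠ o x := by
        intro e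
        have hpx : G.Reachable p x := e ▸ hxa.symm
        exact hpq (e.trans (cx q hq (hr.symm.trans hpx)).symm)
      have h4 : p ≠ o y := by
        intro e
        have hpy : G.Reachable p y := e ▸ hyb.symm
        exact hpq (e.trans (cy q hq (hr.symm.trans hpy)).symm)
      rw [Function.update_of_ne h4, Function.update_of_ne h3]
      exact h.ends p q (hmono p hp) (hmono q hq) hpq hr
    · rw [cx p hp h1, cy q hq h2.symm, Function.update_of_ne hab, Function.update_self]
    · rw [cy p hp h1, cx q hq h2.symm, Function.update_self]
  · intro p hp
    by_cases h4 : p = o y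
    · subst h4
      rw [Function.update_self]
      exact ((hyb.symm.mono hle).trans hedge.symm).trans (hxa.mono hle)
    · rw [Function.update_of_ne h4]
      by_cases h3 : p = o x
      · subst h3
        rw [Function.update_self]
        exact ((hxa.symm.mono hle).trans hedge).trans (hyb.mono hle)
      · rw [Function.update_of_ne h3]
        exact (h.reachable p (hmono p hp)).mono hle

end SimpleGraph

open SimpleGraph

theorem IsPseudoforest.anti {V : Type*} {H G : SimpleGraph V} (hle : H ≤ G)
    (hG : IsPseudoforest G) : IsPseudoforest H := by
  intro u v p q hp hq hr e
  have := hG (p.mapLe hle) (q.mapLe hle) (hp.mapLe hle) (hq.mapLe hle) (hr.mono hle) e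
  simpa using this

/-- A pseudoforest without leaves is a disjoint union of cycles and isolated vertices. -/
theorem IsPseudoforest.degree_le_two {V : Type*} [Fintype V] {H : SimpleGraph V}
    [DecidableRel H.Adj] (hH : IsPseudoforest H) (h : ∀ v, H.degree v ≠ 1) (v : V) :
    H.degree v ≤ 2 := by
  -- It suffices that edges plus isolated vertices number at most `|V|`. This compares `H` with a
  -- spanning forest `F`, where `D` is the set of edges outside `F`.
  refine (card_le_ncard_edgeSet_add_isolated h).2 ?_ v
  obtain ⟨F, hFH, hF, hreach⟩ := H.exists_isAcyclic_reachable_eq_le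
  set D := H.edgeSet \ F.edgeSet with hD
  have hout : ∀ e : Sym2 V, s(e.out.1, e.out.2) = e := fun e => Quot.out_eq e
  -- The fundamental cycle of `e` with respect to `F`; it contains no other edge of `D`.
  have hcyc : ∀ e ∈ D, ∃ (u : V) (p : H.Walk u u), p.IsCycle ∧ e ∈ p.edges ∧
      e.out.1 ∈ p.support ∧ ∀ e' ∈ p.edges, e' ∈ D → e' = e := by
    intro e he
    have hout := hout e
    have hadj : H.Adj e.out.1 e.out.2 := by rw [← mem_edgeSet, hout]; exact he.1
    have hFr : F.Reachable e.out.1 e.out.2 := by rw [hreach]; exact hadj.reachable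
    have hFn : ¬ F.Adj e.out.1 e.out.2 := by rw [← mem_edgeSet, hout]; exact he.2
    have hle : F ⊔ edge e.out.1 e.out.2 ≤ H := by
      refine sup_le hFH ?_
      intro a b hab
      rw [adj_edge] at hab
      rw [← mem_edgeSet, ← hab.1, hout]; exact he.1
    have := (adj_and_reachable_delete_edges_iff_exists_cycle
      (G := F ⊔ edge e.out.1 e.out.2) (v := e.out.1) (w := e.out.2)).1
      ⟨Or.inr (by rw [edge_adj]; exact ⟨Or.inl ⟨rfl, rfl⟩, hadj.ne⟩), hFr.mono (by
        intro a b hab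
        rw [deleteEdges_adj]
        refine ⟨Or.inl hab, fun h => hFn ?_⟩
        rw [Set.mem_singleton_iff] at h
        rw [← mem_edgeSet, ← h]; exact hab)⟩
    obtain ⟨u, p, hp, hep⟩ := this
    refine ⟨u, p.mapLe hle, hp.mapLe hle, by simpa [hout] using hep, ?_, ?_⟩
    · simpa using p.fst_mem_support_of_mem_edges hep
    · intro e' he' heD
      have h1 : e' ∈ (F ⊔ edge e.out.1 e.out.2).edgeSet :=
        p.edges_subset_edgeSet (by simpa using he')
      rw [edgeSet_sup] at h1
      rcases h1 with h1 | h1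
      · exact absurd h1 heD.2
      · induction e' with | h a b =>
        rw [mem_edgeSet, adj_edge] at h1
        rw [← h1.1, hout]
  -- In one component the two fundamental cycles coincide, so `e` lies on the cycle of `e'`, whose
  -- only edge in `D` is `e'`.
  have huniq : ∀ e ∈ D, ∀ e' ∈ D, H.Reachable e.out.1 e'.out.1 → e = e' := by
    intro e he e' he' hr
    obtain ⟨u, p, hp, hep, hsp, -⟩ := hcyc e he
    obtain ⟨u', p', hp', hep', hsp', hu'⟩ := hcyc e' he'
    have hur : H.Reachable u u' := by
      classical
      exact ((p.takeUntil _ hsp).reachable.trans hr).trans (p'.takeUntil _ hsp').reachable.symm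
    exact hu' e ((hH p p' hp hp' hur e).1 hep) he
  have hinj : Set.InjOn (fun e : Sym2 V => e.out.1) D := by
    intro e he e' he' hee
    exact huniq e he e' he' (by simp only at hee; rw [hee])
  have hnotiso : ∀ e ∈ D, e.out.1 ∉ H.isolatedVerts := by
    intro e he hi
    refine hi e.out.2 ?_
    rw [← mem_edgeSet, hout]
    exact he.1
  have hdisj : Disjoint ((fun e : Sym2 V => e.out.1) '' D) H.isolatedVerts := by
    rw [Set.disjoint_left]
    rintro _ ⟨e, he, rfl⟩
    exact hnotiso e he
  -- One end of each edge of `D` and all isolated vertices lie in different components, which bounds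
  -- the size of `F`.
  have hmain := hF.ncard_edgeSet_add_card_le
    (((fun e : Sym2 V => e.out.1) '' D) ∪ H.isolatedVerts) (by
      rintro r hr r' hr' hrr
      rw [hreach] at hrr
      by_contra hne
      rcases hr with ⟨e, he, rfl⟩ | hr
      · rcases hr' with ⟨e', he', rfl⟩ | hr'
        · exact hne (by rw [huniq e he e' he' hrr])
        · exact not_reachable_of_isolated hr' (Ne.symm hne) hrr.symm
      · exact not_reachable_of_isolated hr hne hrr)
  rw [Set.ncard_union_eq hdisj (Set.toFinite _) (Set.toFinite _),
    hinj.ncard_image] at hmain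
  have hcard : H.edgeSet.ncard = F.edgeSet.ncard + D.ncard := by
    rw [hD, ← Set.ncard_sdiff_add_ncard_of_subset (edgeSet_mono hFH) (Set.toFinite _), add_comm]
  omega

/-! ### Edge lists and the cycles of their parts -/

namespace EdgeList

variable {n m : ℕ} (L : EdgeList n m 3)

def ed (e : Fin m) : Sym2 (Fin n) := s(L.src e, L.dst e)

/-- The list has neither loops nor repeated edges. -/
structure IsSimple : Prop where
  inj : Function.Injective L.ed
  ne : ∀ e, L.src e ≠ L.dst e

def Inc (e : Fin m) (v : Fin n) : Prop := v ∈ L.ed e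

/-- The graph formed by the listed edges with index in `S`. -/
def gr (S : Set (Fin m)) : SimpleGraph (Fin n) := fromEdgeSet (L.ed '' S)

def col (c : Fin 3) : Set (Fin m) := {e | L.part e = c}

/-- Two edges of `al` in the same part with a common vertex. -/
def Touch (al : Set (Fin m)) (e f : Fin m) : Prop :=
  e ∈ al ∧ f ∈ al ∧ L.part e = L.part f ∧ ∃ v, L.Inc e v ∧ L.Inc f v

/-- When `al` is a core, the class of one of its edges is the cycle through that edge. -/
def Conn (al : Set (Fin m)) : Fin m → Fin m → Prop := Relation.ReflTransGen (L.Touch al)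

variable {L}

theorem inc_iff {e : Fin m} {v : Fin n} : L.Inc e v ↔ v = L.src e ∨ v = L.dst e := by
  simp [Inc, ed]

theorem inc_src (e : Fin m) : L.Inc e (L.src e) := inc_iff.2 (Or.inl rfl)

theorem inc_dst (e : Fin m) : L.Inc e (L.dst e) := inc_iff.2 (Or.inr rfl)

theorem gr_mono {S T : Set (Fin m)} (h : S ⊆ T) : L.gr S ≤ L.gr T :=
  fromEdgeSet_mono (Set.image_mono h)

theorem gr_insert (S : Set (Fin m)) (e : Fin m) :
    L.gr (insert e S) = L.gr S ⊔ edge (L.src e) (L.dst e) := by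
  rw [gr, Set.image_insert_eq, Set.insert_eq, fromEdgeSet_union, sup_comm]; rfl

theorem gr_empty : L.gr ∅ = ⊥ := by simp [gr]

/-- Puts a graph of listed edges into the form that `IsAcyclic.sup_transfer` and
`IsAcyclic.sup_pendant` use. -/
theorem gr_union_toFinset [DecidableEq (Fin m)] (S T : Set (Fin m)) [Fintype T] :
    L.gr (S ∪ T) = L.gr S ⊔ T.toFinset.sup fun e => edge (L.src e) (L.dst e) := by
  have : ∀ F : Finset (Fin m),
      L.gr (S ∪ F) = L.gr S ⊔ F.sup fun e => edge (L.src e) (L.dst e) := by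
    intro F
    induction F using Finset.induction_on with
    | empty => simp
    | insert a F _ ih =>
      rw [Finset.coe_insert, Set.union_insert, gr_insert, ih, Finset.sup_insert, sup_assoc,
        sup_comm (edge _ _)]
  simpa using this T.toFinset

theorem Inc.eq_or {e : Fin m} {u v : Fin n} (he : L.ed e = s(u, v)) {w : Fin n}
    (hw : L.Inc e w) : w = u ∨ w = v := by
  rw [Inc, he] at hw; simpa using hw

theorem Touch.symm {al : Set (Fin m)} {e f : Fin m} (h : L.Touch al e f) : L.Touch al f e := by
  obtain ⟨h1, h2, h3, v, h4, h5⟩ := h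
  exact ⟨h2, h1, h3.symm, v, h5, h4⟩

theorem Conn.symm {al : Set (Fin m)} {e f : Fin m} (h : L.Conn al e f) : L.Conn al f e := by
  have : Std.Symm (L.Touch al) := ⟨fun _ _ h => h.symm⟩
  exact Relation.ReflTransGen.stdSymm.symm _ _ h

theorem Conn.trans {al : Set (Fin m)} {e f g : Fin m} (h : L.Conn al e f)
    (h' : L.Conn al f g) : L.Conn al e g := Relation.ReflTransGen.trans h h'

theorem Conn.refl {al : Set (Fin m)} (e : Fin m) : L.Conn al e e := Relation.ReflTransGen.refl

theorem Touch.conn {al : Set (Fin m)} {e f : Fin m} (h : L.Touch al e f) : L.Conn al e f :=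
  Relation.ReflTransGen.single h

theorem Conn.part_eq {al : Set (Fin m)} {e f : Fin m} (h : L.Conn al e f) :
    L.part f = L.part e := by
  induction h with
  | refl => rfl
  | tail _ h ih => rw [← ih, h.2.2.1]

theorem Conn.mem {al : Set (Fin m)} {e f : Fin m} (h : L.Conn al e f) (he : e ∈ al) :
    f ∈ al := by
  cases h with
  | refl => exact he
  | tail _ h => exact h.2.1

section Simple

variable (hL : L.IsSimple)
include hL

theorem gr_adj {S : Set (Fin m)} {u v : Fin n} :
    (L.gr S).Adj u v ↔ ∃ e ∈ S, L.ed e = s(u, v) := by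
  rw [gr, fromEdgeSet_adj]
  constructor
  · rintro ⟨⟨e, he, h⟩, -⟩
    exact ⟨e, he, h⟩
  · rintro ⟨e, he, h⟩
    refine ⟨⟨e, he, h⟩, ?_⟩
    rintro rfl
    rw [ed, Sym2.eq_iff] at h
    have := hL.ne e
    rcases h with ⟨h1, h2⟩ | ⟨h1, h2⟩ <;> exact this (h1.trans h2.symm)

theorem mem_edgeSet_gr {S : Set (Fin m)} {x : Sym2 (Fin n)} :
    x ∈ (L.gr S).edgeSet ↔ ∃ e ∈ S, L.ed e = x := by
  induction x with | h u v => exact gr_adj hL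

theorem ed_mem_edgeSet_gr {S : Set (Fin m)} {e : Fin m} :
    L.ed e ∈ (L.gr S).edgeSet ↔ e ∈ S := by
  rw [mem_edgeSet_gr hL]
  constructor
  · rintro ⟨f, hf, h⟩
    exact hL.inj h ▸ hf
  · exact fun h => ⟨e, h, rfl⟩

theorem gr_adj_src_dst {S : Set (Fin m)} {e : Fin m} :
    (L.gr S).Adj (L.src e) (L.dst e) ↔ e ∈ S := ed_mem_edgeSet_gr hL

theorem not_adj_iff {S : Set (Fin m)} {v : Fin n} :
    (∀ u, ¬ (L.gr S).Adj v u) ↔ ∀ e ∈ S, ¬ L.Inc e v := by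
  constructor
  · intro h e he hv
    obtain ⟨u, hu⟩ := Sym2.mem_iff_exists.1 hv
    exact h u ((gr_adj hL).2 ⟨e, he, hu⟩)
  · intro h u hu
    obtain ⟨e, he, hu⟩ := (gr_adj hL).1 hu
    exact h e he (by rw [Inc, hu]; simp)

theorem isEnd_of {S : Set (Fin m)} {v : Fin n}
    (h : ∀ e ∈ S, ∀ f ∈ S, L.Inc e v → L.Inc f v → e = f) : (L.gr S).IsEnd v := by
  intro u w hu hw
  obtain ⟨e, he, hu⟩ := (gr_adj hL).1 hu
  obtain ⟨f, hf, hw⟩ := (gr_adj hL).1 hw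
  have := h e he f hf (by rw [Inc, hu]; simp) (by rw [Inc, hw]; simp)
  subst this
  rw [hu, Sym2.eq_iff] at hw
  rcases hw with ⟨-, h⟩ | ⟨h1, h2⟩
  · exact h
  · exact h2.trans h1

end Simple

/-- What remains of the parts after all leaves have been stripped: a set of edges that contains
all cycles and in which every vertex has no or two edges of each part. -/
structure IsCore (L : EdgeList n m 3) (al : Set (Fin m)) : Prop where
  simple : L.IsSimple
  pseudoforest : ∀ c, IsPseudoforest (L.gr (L.col c))
  two : ∀ e ∈ al, ∀ v, L.Inc e v → ∃ f ∈ al, f ≠ e ∧ L.part f = L.part e ∧ L.Inc f v ∧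
    ∀ g ∈ al, L.part g = L.part e → L.Inc g v → g = e ∨ g = f
  cycle : ∀ c u (p : (L.gr (L.col c)).Walk u u), p.IsCycle → ∀ e, L.ed e ∈ p.edges → e ∈ al

namespace IsCore

variable {al : Set (Fin m)} (h : IsCore L al)
include h

theorem part_of_mem_edges {c : Fin 3} {u v : Fin n} {p : (L.gr (L.col c)).Walk u v} {e : Fin m}
    (he : L.ed e ∈ p.edges) : L.part e = c :=
  (ed_mem_edgeSet_gr h.simple).1 (p.edges_subset_edgeSet he)

end IsCore

/-- A vertex of a cycle is on two of its edges. -/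
theorem exists_ne_mem_edges (hL : L.IsSimple) {c : Fin 3} {u : Fin n}
    {p : (L.gr (L.col c)).Walk u u} (hp : p.IsCycle) {e : Fin m} (he : L.ed e ∈ p.edges)
    {v : Fin n} (hv : L.Inc e v) : ∃ f, f ≠ e ∧ L.ed f ∈ p.edges ∧ L.Inc f v := by
  obtain ⟨w, hw⟩ := Sym2.mem_iff_exists.1 hv
  have hvs : v ∈ p.support := p.fst_mem_support_of_mem_edges (hw ▸ he)
  have h2 := hp.ncard_neighborSet_toSubgraph_eq_two hvs
  have hwn : w ∈ p.toSubgraph.neighborSet v := by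
    rw [Subgraph.mem_neighborSet, ← Subgraph.mem_edgeSet, Walk.mem_edges_toSubgraph, ← hw]
    exact he
  obtain ⟨w', hw', hne⟩ := Set.exists_ne_of_one_lt_ncard
    (by omega : 1 < (p.toSubgraph.neighborSet v).ncard) w
  rw [Subgraph.mem_neighborSet, ← Subgraph.mem_edgeSet, Walk.mem_edges_toSubgraph] at hw'
  obtain ⟨f, -, hf⟩ := (mem_edgeSet_gr hL).1 (p.edges_subset_edgeSet hw')
  refine ⟨f, ?_, hf ▸ hw', by rw [Inc, hf]; simp⟩
  rintro rfl
  rw [hw, Sym2.eq_iff] at hf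
  rcases hf with ⟨-, h⟩ | ⟨h1, h2⟩
  · exact hne h.symm
  · exact hne (h1 ▸ h2).symm

namespace IsCore

variable {al : Set (Fin m)} (h : IsCore L al)
include h

/-- The cycle has two edges at the common vertex, and both lie in the core. The core has only two
edges of this part there, so the cycle uses each of them. -/
theorem touch_mem_edges {c : Fin 3} {u : Fin n} {p : (L.gr (L.col c)).Walk u u} (hp : p.IsCycle)
    {e f : Fin m} (he : L.ed e ∈ p.edges) (hef : L.Touch al e f) : L.ed f ∈ p.edges := by
  obtain ⟨h1, h2, h3, v, h4, h5⟩ := hef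
  obtain ⟨g, hg, hgp, hgv⟩ := exists_ne_mem_edges h.simple hp he h4
  obtain ⟨k, -, -, -, -, hk⟩ := h.two e h1 v h4
  have hgal := h.cycle c u p hp g hgp
  have hpe := h.part_of_mem_edges he
  have hpg := h.part_of_mem_edges hgp
  rcases hk g hgal (hpg.trans hpe.symm) hgv with h6 | h6
  · exact absurd h6 hg
  · rcases hk f h2 h3.symm h5 with h7 | h7
    · exact h7 ▸ he
    · rw [h7, ← h6]; exact hgp

theorem conn_mem_edges {c : Fin 3} {u : Fin n} {p : (L.gr (L.col c)).Walk u u} (hp : p.IsCycle)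
    {e f : Fin m} (he : L.ed e ∈ p.edges) (hef : L.Conn al e f) : L.ed f ∈ p.edges := by
  induction hef with
  | refl => exact he
  | tail _ h' ih => exact h.touch_mem_edges hp ih h'

theorem conn_reachable {e f : Fin m} (hef : L.Conn al e f) :
    (L.gr (L.col (L.part e))).Reachable (L.src e) (L.src f) := by
  have key : ∀ f, L.part f = L.part e → ∀ v, L.Inc f v →
      (L.gr (L.col (L.part e))).Reachable v (L.src f) := by
    intro f hf v hv
    rcases inc_iff.1 hv with rfl | rfl
    · exact Reachable.refl _
    · exact ((gr_adj_src_dst h.simple).2 (show f ∈ L.col (L.part e) from hf)).reachable.symm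
  induction hef with
  | refl => exact Reachable.refl _
  | tail h1 h2 ih =>
    obtain ⟨-, -, h3, v, h4, h5⟩ := h2
    have hp := Conn.part_eq h1
    exact ih.trans ((key _ hp v h4).symm.trans (key _ (h3 ▸ hp) v h5))

/-- Every class of connected core edges contains a cycle. -/
theorem exists_cycle {e : Fin m} (he : e ∈ al) : ∃ (u : Fin n)
    (p : (L.gr (L.col (L.part e))).Walk u u), p.IsCycle ∧
      (∀ x ∈ p.edges, ∃ f, L.Conn al e f ∧ L.ed f = x) ∧
      (L.gr (L.col (L.part e))).Reachable (L.src e) u := by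
  classical
  set O : Set (Fin m) := {f | L.Conn al e f} with hO
  have hle : L.gr O ≤ L.gr (L.col (L.part e)) := gr_mono fun f hf => Conn.part_eq hf
  -- At each of its vertices an edge of the class meets a second one by `two`, so the class has no
  -- leaf and cannot be a forest.
  have hdeg : ∀ v, (L.gr O).degree v ≠ 1 := by
    intro v hv
    rw [degree_eq_one_iff_existsUnique_adj] at hv
    obtain ⟨w, hw, huniq⟩ := hv
    obtain ⟨f, hf, hfe⟩ := (gr_adj h.simple).1 hw
    have hfv : L.Inc f v := by rw [Inc, hfe]; simp
    have hfal : f ∈ al := Conn.mem hf he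
    obtain ⟨g, hg, hgf, hgp, hgv, -⟩ := h.two f hfal v hfv
    obtain ⟨w', hw'⟩ := Sym2.mem_iff_exists.1 hgv
    have : L.Conn al e g := Relation.ReflTransGen.tail hf ⟨hfal, hg, hgp.symm, v, hfv, hgv⟩
    have hww : w' = w := huniq w' ((gr_adj h.simple).2 ⟨g, this, hw'⟩)
    exact hgf (h.simple.inj (by rw [hw', hfe, hww]))
  have hnot : ¬ (L.gr O).IsAcyclic := by
    intro hac
    obtain ⟨v, hv⟩ := hac.exists_degree_eq_one
      ((gr_adj_src_dst h.simple).2 (show e ∈ O from Conn.refl e))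
    exact hdeg v hv
  rw [IsAcyclic] at hnot
  push Not at hnot
  obtain ⟨u, p, hp⟩ := hnot
  have hedges : ∀ x ∈ (p.mapLe hle).edges, ∃ f, L.Conn al e f ∧ L.ed f = x := by
    intro x hx
    exact (mem_edgeSet_gr h.simple).1 (p.edges_subset_edgeSet (by simpa using hx))
  refine ⟨u, p.mapLe hle, hp.mapLe hle, hedges, ?_⟩
  have hsnd := (p.mapLe hle).adj_snd (hp.mapLe hle).not_nil
  obtain ⟨f, hf, hfe⟩ := (gr_adj h.simple).1 (p.adj_snd hp.not_nil)
  have hr := h.conn_reachable hf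
  have hfu : L.Inc f u := by rw [Inc, hfe]; simp
  rcases inc_iff.1 hfu with h1 | h1
  · rw [h1]; exact hr
  · rw [h1]
    exact hr.trans
      ((gr_adj_src_dst h.simple).2 (show f ∈ L.col (L.part e) from Conn.part_eq hf)).reachable

/-- Core edges in the same component of a part are connected within the core. -/
theorem conn_of_reachable {e f : Fin m} (he : e ∈ al) (hf : f ∈ al)
    (hpart : L.part f = L.part e) {u v : Fin n} (hu : L.Inc e u) (hv : L.Inc f v)
    (hr : (L.gr (L.col (L.part e))).Reachable u v) : L.Conn al e f := by
  have key : ∀ g, L.part g = L.part e → ∀ v, L.Inc g v →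
      (L.gr (L.col (L.part e))).Reachable v (L.src g) := by
    intro f hf v hv
    rcases inc_iff.1 hv with rfl | rfl
    · exact Reachable.refl _
    · exact ((gr_adj_src_dst h.simple).2 (show f ∈ L.col (L.part e) from hf)).reachable.symm
  obtain ⟨a, p, hp, hpe, hpr⟩ := h.exists_cycle he
  have hf' := h.exists_cycle hf
  rw [hpart] at hf'
  obtain ⟨b, q, hq, hqe, hqr⟩ := hf'
  have hab := hpr.symm.trans
    ((key e rfl u hu).symm.trans (hr.trans ((key f hpart v hv).trans hqr)))
  -- The cycles found in the two classes lie in one component of a pseudoforest, so they have the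
  -- same edges. A common edge connects the classes.
  obtain ⟨x, hx⟩ := List.exists_mem_of_ne_nil p.edges (by
    intro h0
    exact hp.not_nil (Walk.edges_eq_nil.1 h0))
  obtain ⟨g, hg, hgx⟩ := hpe x hx
  obtain ⟨g', hg', hgx'⟩ := hqe x ((h.pseudoforest _ p q hp hq hab x).1 hx)
  have : g = g' := h.simple.inj (hgx.trans hgx'.symm)
  subst this
  exact hg.trans hg'.symm

/-- A surviving cycle would lie in the core and contain the whole class of each of its edges, hence
also a member of `M`. -/
theorem isAcyclic_of_transversal {c : Fin 3} {M : Set (Fin m)}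
    (hM : ∀ e ∈ al, L.part e = c → ∃ f ∈ M, L.Conn al e f) :
    (L.gr (L.col c \ M)).IsAcyclic := by
  intro u p hp
  have hle : L.gr (L.col c \ M) ≤ L.gr (L.col c) := gr_mono Set.sdiff_subset
  obtain ⟨x, hx⟩ := List.exists_mem_of_ne_nil p.edges (by
    intro h0
    exact hp.not_nil (Walk.edges_eq_nil.1 h0))
  obtain ⟨e, he, rfl⟩ := (mem_edgeSet_gr h.simple).1 (p.edges_subset_edgeSet hx)
  have hx' : L.ed e ∈ (p.mapLe hle).edges := by simpa using hx
  obtain ⟨f, hf, hef⟩ := hM e (h.cycle c u _ (hp.mapLe hle) e hx') he.1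
  have := h.conn_mem_edges (hp.mapLe hle) hx' hef
  have := p.edges_subset_edgeSet (e := L.ed f) (by simpa using this)
  exact ((ed_mem_edgeSet_gr h.simple).1 this).2 hf

end IsCore

end EdgeList

/-! ### Choosing one edge of each cycle and distributing the chosen edges -/

namespace EdgeList

variable {n m : ℕ} {L : EdgeList n m 3} {al done M LA LB FX T : Set (Fin m)}
  {oA o4 : Fin n → Fin n}

/-- `M` contains exactly one edge of each class of core edges in `done`, a union of classes. -/
structure IsTransversal (L : EdgeList n m 3) (al done M : Set (Fin m)) : Prop where
  sub : done ⊆ al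
  closed : ∀ e ∈ done, ∀ f, L.Touch al e f → f ∈ done
  mem : M ⊆ done
  exists_conn : ∀ e ∈ done, ∃ f ∈ M, L.Conn al e f
  uniq : ∀ f ∈ M, ∀ g ∈ M, L.Conn al f g → f = g

namespace IsTransversal

theorem empty : IsTransversal L al ∅ ∅ where
  sub := Set.empty_subset _
  closed := by simp
  mem := subset_rfl
  exists_conn := by simp
  uniq := by simp

variable (h : IsTransversal L al done M)
include h

theorem closed' {e f : Fin m} (he : e ∈ done) (hef : L.Conn al e f) : f ∈ done := by
  induction hef with
  | refl => exact he
  | tail _ h' ih => exact h.closed _ ih _ h'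

theorem insert {e f : Fin m} (he : e ∈ al) (hed : e ∉ done) (hef : L.Conn al e f) :
    IsTransversal L al (done ∪ {g | L.Conn al e g}) (insert f M) where
  sub := by
    rintro g (hg | hg)
    · exact h.sub hg
    · exact Conn.mem hg he
  closed := by
    rintro g (hg | hg) k hk
    · exact Or.inl (h.closed g hg k hk)
    · exact Or.inr (Conn.trans hg hk.conn)
  mem := by
    rintro g (rfl | hg)
    · exact Or.inr hef
    · exact Or.inl (h.mem hg)
  exists_conn := by
    rintro g (hg | hg)
    · obtain ⟨k, hk, hgk⟩ := h.exists_conn g hg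
      exact ⟨k, Set.mem_insert_of_mem _ hk, hgk⟩
    · exact ⟨f, Set.mem_insert _ _, (Conn.symm hg).trans hef⟩
  uniq := by
    have key : ∀ g ∈ M, ¬ L.Conn al f g := fun g hg hfg =>
      hed (h.closed' (h.mem hg) (hef.trans hfg).symm)
    rintro g (rfl | hg) k (rfl | hk) hgk
    · rfl
    · exact absurd hgk (key k hk)
    · exact absurd hgk.symm (key g hg)
    · exact h.uniq g hg k hk hgk

theorem notMem {e f : Fin m} (hed : e ∉ done) (hef : L.Conn al e f) : f ∉ M := fun hf =>
  hed (h.closed' (h.mem hf) hef.symm)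

/-- No edge has been chosen at the vertices of a cycle that is not yet done. -/
theorem fresh {e f g : Fin m} (he : e ∈ al) (hed : e ∉ done) (hef : L.Conn al e f) {v : Fin n}
    (hv : L.Inc f v) (hg : g ∈ M) (hp : L.part g = L.part e) : ¬ L.Inc g v := by
  intro hgv
  have ht : L.Touch al g f := ⟨h.sub (h.mem hg), Conn.mem hef he, by rw [hp, hef.part_eq],
    v, hgv, hv⟩
  exact hed (h.closed' (h.mem hg) (ht.conn.trans hef.symm))

/-- The chosen edges of one part form a matching. -/
theorem eq_of_inc {f g : Fin m} (hf : f ∈ M) (hg : g ∈ M) (hp : L.part f = L.part g)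
    {v : Fin n} (hfv : L.Inc f v) (hgv : L.Inc g v) : f = g :=
  h.uniq f hf g hg (Touch.conn ⟨h.sub (h.mem hf), h.sub (h.mem hg), hp, v, hfv, hgv⟩)

end IsTransversal

/-- The effect on the map to the other path end of joining the paths that end in `x` and `y`. -/
def mergeEnds {V : Type*} [DecidableEq V] (o : V → V) (x y : V) : V → V :=
  Function.update (Function.update o (o x) (o y)) (o y) (o x)

theorem pathEnds_insert (hL : L.IsSimple) {S : Set (Fin m)} {o : Fin n → Fin n}
    (h : PathEnds (L.gr S) o) {f : Fin m} {x y : Fin n} (hf : L.ed f = s(x, y))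
    (hx : (L.gr S).IsEnd x) (hy : (L.gr S).IsEnd y) (ho : o y ≠ x) :
    PathEnds (L.gr (insert f S)) (mergeEnds o x y) := by
  have hne : x ≠ y := by
    rintro rfl
    have := hL.ne f
    rw [ed, Sym2.eq_iff] at hf
    rcases hf with ⟨h1, h2⟩ | ⟨h1, h2⟩ <;> exact this (h1.trans h2.symm)
  have he : edge (L.src f) (L.dst f) = edge x y := by
    rw [edge, edge]; congr 2
  rw [gr_insert, he]
  exact h.sup_edge hx hy hne ho

theorem isAcyclic_insert (hL : L.IsSimple) {S : Set (Fin m)} (h : (L.gr S).IsAcyclic)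
    {f : Fin m} {x : Fin n} (hx : L.Inc f x) (hS : ∀ g ∈ S, ¬ L.Inc g x) :
    (L.gr (insert f S)).IsAcyclic := by
  rw [gr_insert]
  have hiso := (not_adj_iff hL).2 hS
  refine h.sup_edge_of_not_reachable ?_
  rcases inc_iff.1 hx with rfl | rfl
  · exact not_reachable_of_isolated hiso (hL.ne f)
  · exact fun hr => not_reachable_of_isolated hiso (hL.ne f).symm hr.symm

theorem insert_inter_col_self {f : Fin m} {c : Fin 3} (hf : L.part f = c) :
    insert f M ∩ L.col c = insert f (M ∩ L.col c) := Set.insert_inter_of_mem hf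

theorem insert_inter_col_of_ne {f : Fin m} {c : Fin 3} (hf : L.part f ≠ c) :
    insert f M ∩ L.col c = M ∩ L.col c := Set.insert_inter_of_notMem hf

/-- The state of the distribution. `M` are the edges chosen so far, one of each finished cycle;
edges of part `2` in `LA`, `LB` go to the forests `0` and `1`, the edges of part `1` in `FX` go to
forest `2`, and all others go to forest `3`; those in `T` are recorded in `o4`, and the remaining
ones are pendant. -/
structure Split (L : EdgeList n m 3) (al done M LA LB FX T : Set (Fin m))
    (oA o4 : Fin n → Fin n) : Prop where
  trans : IsTransversal L al done M
  LA_sub : LA ⊆ M ∩ L.col 2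
  LB_sub : LB ⊆ M ∩ L.col 2
  T_sub : T ⊆ M ∩ L.col 2
  FX_sub : FX ⊆ M ∩ L.col 1
  disj : ∀ e, (e ∈ LA → e ∉ LB ∧ e ∉ T) ∧ (e ∈ LB → e ∉ T)
  endsA : PathEnds (L.gr (M ∩ L.col 0 ∪ LA)) oA
  covA : ∀ e ∈ LA, ∀ v, L.Inc e v → ∃ f ∈ M ∩ L.col 0, L.Inc f v
  ends4 : PathEnds (L.gr (M ∩ L.col 0 ∪ M ∩ L.col 1 ∪ T)) o4
  acycB : (L.gr (M ∩ L.col 1 ∪ LB)).IsAcyclic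
  covB : ∀ e ∈ LB, ∀ v, L.Inc e v → ∃ f ∈ M ∩ L.col 1, L.Inc f v
  acycC : (L.gr (M ∩ L.col 2 ∪ FX)).IsAcyclic
  covC : ∀ e ∈ FX, ∀ v, L.Inc e v → ∃ f ∈ M ∩ L.col 2, L.Inc f v
  leaf : ∀ f ∈ M ∩ L.col 2, f ∉ LA → f ∉ LB → f ∉ T → ∃ y, L.Inc f y ∧
    (∀ g ∈ M ∩ L.col 0, ¬ L.Inc g y) ∧ ∀ g ∈ M ∩ L.col 1, L.Inc g y → g ∈ FX

/-! ### Each choice of an edge preserves the distribution -/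

namespace Split

theorem empty : Split L al ∅ ∅ ∅ ∅ ∅ ∅ id id where
  trans := .empty
  LA_sub := Set.empty_subset _
  LB_sub := Set.empty_subset _
  T_sub := Set.empty_subset _
  FX_sub := Set.empty_subset _
  disj := by simp
  endsA := by simpa [gr_empty] using PathEnds.bot
  covA := by simp
  ends4 := by simpa [gr_empty] using PathEnds.bot
  acycB := by simp [gr_empty]
  covB := by simp
  acycC := by simp [gr_empty]
  covC := by simp
  leaf := by simp

variable (hc : IsCore L al) (h : Split L al done M LA LB FX T oA o4)
include hc h

/-- As long as only part `0` has been treated, both recorded graphs are the matching chosen from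
part `0`, and `e` is disjoint from it. -/
theorem step_zero {e : Fin m} (he : e ∈ al) (hed : e ∉ done) (hp : L.part e = 0)
    (h1 : M ∩ L.col 1 = ∅) (h2 : M ∩ L.col 2 = ∅) :
    Split L al (done ∪ {g | L.Conn al e g}) (insert e M) LA LB FX T
      (mergeEnds oA (L.src e) (L.dst e)) (mergeEnds o4 (L.src e) (L.dst e)) := by
  have hLA : LA = ∅ := Set.subset_empty_iff.1 (h2 ▸ h.LA_sub)
  have hLB : LB = ∅ := Set.subset_empty_iff.1 (h2 ▸ h.LB_sub)
  have hT : T = ∅ := Set.subset_empty_iff.1 (h2 ▸ h.T_sub)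
  have hFX : FX = ∅ := Set.subset_empty_iff.1 (h1 ▸ h.FX_sub)
  have e0 : insert e M ∩ L.col 0 = insert e (M ∩ L.col 0) := insert_inter_col_self hp
  have e1 : insert e M ∩ L.col 1 = M ∩ L.col 1 := insert_inter_col_of_ne (by simp [hp])
  have e2 : insert e M ∩ L.col 2 = M ∩ L.col 2 := insert_inter_col_of_ne (by simp [hp])
  have fr : ∀ v, L.Inc e v → ∀ g ∈ M ∩ L.col 0, ¬ L.Inc g v := fun v hv g hg =>
    h.trans.fresh he hed (Conn.refl e) hv hg.1 (hp ▸ hg.2)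
  have hA := h.endsA
  have h4 := h.ends4
  rw [hLA, Set.union_empty] at hA
  rw [hT, h1, Set.union_empty, Set.union_empty] at h4
  have iso : ∀ v, L.Inc e v → ∀ u, ¬ (L.gr (M ∩ L.col 0)).Adj v u := fun v hv =>
    (not_adj_iff hc.simple).2 (fr v hv)
  have hend : ∀ v, L.Inc e v → (L.gr (M ∩ L.col 0)).IsEnd v := fun v hv u _ hu _ =>
    absurd hu (iso v hv u)
  subst hLA hLB hT hFX
  constructor
  · exact h.trans.insert he hed (Conn.refl e)
  · exact Set.empty_subset _
  · exact Set.empty_subset _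
  · exact Set.empty_subset _
  · exact Set.empty_subset _
  · exact h.disj
  · rw [e0, Set.union_empty]
    exact pathEnds_insert hc.simple hA rfl (hend _ (inc_src e)) (hend _ (inc_dst e))
      (by rw [hA.isolated _ (iso _ (inc_dst e))]; exact (hc.simple.ne e).symm)
  · simp
  · rw [e0, e1, h1, Set.union_empty, Set.union_empty]
    exact pathEnds_insert hc.simple h4 rfl (hend _ (inc_src e)) (hend _ (inc_dst e))
      (by rw [h4.isolated _ (iso _ (inc_dst e))]; exact (hc.simple.ne e).symm)
  · rw [e1]; exact h.acycB
  · simp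
  · rw [e2]; exact h.acycC
  · simp
  · rw [e2, h2]; simp

/-- The graph is a union of three matchings; two of them miss `v`. -/
theorem isEnd_four {v : Fin n} (hT : ∀ g ∈ T, ¬ L.Inc g v)
    (hv : (∀ g ∈ M ∩ L.col 0, ¬ L.Inc g v) ∨ ∀ g ∈ M ∩ L.col 1, ¬ L.Inc g v) :
    (L.gr (M ∩ L.col 0 ∪ M ∩ L.col 1 ∪ T)).IsEnd v := by
  refine isEnd_of hc.simple ?_
  rintro f ((hf | hf) | hf) g ((hg | hg) | hg) hfv hgv
  · exact h.trans.eq_of_inc hf.1 hg.1 (hf.2.trans hg.2.symm) hfv hgv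
  · rcases hv with hv | hv
    · exact absurd hfv (hv f hf)
    · exact absurd hgv (hv g hg)
  · exact absurd hgv (hT g hg)
  · rcases hv with hv | hv
    · exact absurd hgv (hv g hg)
    · exact absurd hfv (hv f hf)
  · exact h.trans.eq_of_inc hf.1 hg.1 (hf.2.trans hg.2.symm) hfv hgv
  all_goals first | exact absurd hgv (hT g hg) | exact absurd hfv (hT f hf)

/-- The ends of `f` meet no chosen edge of part `1`. So each of them has at most an edge of part `0`
and is a path end, and in the graph for forest `1` the edge `f` is pendant. -/
theorem step_one {e f : Fin m} (he : e ∈ al) (hed : e ∉ done) (hp : L.part e = 1)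
    (h2 : M ∩ L.col 2 = ∅) (hef : L.Conn al e f) {x y : Fin n}
    (hf : L.ed f = s(x, y)) (ho : o4 y ≠ x) :
    Split L al (done ∪ {g | L.Conn al e g}) (insert f M) LA LB FX T
      oA (mergeEnds o4 x y) := by
  have hpf : L.part f = 1 := hef.part_eq.trans hp
  have hLA : LA = ∅ := Set.subset_empty_iff.1 (h2 ▸ h.LA_sub)
  have hLB : LB = ∅ := Set.subset_empty_iff.1 (h2 ▸ h.LB_sub)
  have hT : T = ∅ := Set.subset_empty_iff.1 (h2 ▸ h.T_sub)
  have hFX : FX = ∅ := by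
    rw [Set.eq_empty_iff_forall_notMem]
    intro g hg
    obtain ⟨k, hk, -⟩ := h.covC g hg _ (inc_src g)
    rw [h2] at hk
    exact hk
  have e0 : insert f M ∩ L.col 0 = M ∩ L.col 0 := insert_inter_col_of_ne (by simp [hpf])
  have e1 : insert f M ∩ L.col 1 = insert f (M ∩ L.col 1) := insert_inter_col_self hpf
  have e2 : insert f M ∩ L.col 2 = M ∩ L.col 2 := insert_inter_col_of_ne (by simp [hpf])
  have fr : ∀ v, L.Inc f v → ∀ g ∈ M ∩ L.col 1, ¬ L.Inc g v := fun v hv g hg =>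
    h.trans.fresh he hed hef hv hg.1 (hp ▸ hg.2)
  have hend := fun v hv => h.isEnd_four hc (v := v) (by simp [hT]) (Or.inr (fr v hv))
  subst hLA hLB hT hFX
  constructor
  · exact h.trans.insert he hed hef
  · exact Set.empty_subset _
  · exact Set.empty_subset _
  · exact Set.empty_subset _
  · exact Set.empty_subset _
  · exact h.disj
  · rw [e0]; exact h.endsA
  · simp
  · rw [e0, e1, Set.union_insert, Set.insert_union]
    exact pathEnds_insert hc.simple h.ends4 hf (hend _ (by rw [Inc, hf]; simp))
      (hend _ (by rw [Inc, hf]; simp)) ho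
  · rw [e1, Set.insert_union]
    refine isAcyclic_insert hc.simple h.acycB (inc_src f) ?_
    rw [Set.union_empty]
    exact fr _ (inc_src f)
  · simp
  · rw [e2]; exact h.acycC
  · simp
  · rw [e2, h2]; simp

/-- The edge `f` meets no chosen edge of part `2`. It does not meet `FX` either, since the ends of
those edges are covered by chosen edges of part `2`. -/
theorem acycC_insert {e f : Fin m} (he : e ∈ al) (hed : e ∉ done) (hp : L.part e = 2)
    (hef : L.Conn al e f) : (L.gr (insert f M ∩ L.col 2 ∪ FX)).IsAcyclic := by
  rw [insert_inter_col_self (hef.part_eq.trans hp), Set.insert_union]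
  refine isAcyclic_insert hc.simple h.acycC (inc_src f) ?_
  have fr : ∀ g ∈ M ∩ L.col 2, ¬ L.Inc g (L.src f) := fun g hg =>
    h.trans.fresh he hed hef (inc_src f) hg.1 (hp ▸ hg.2)
  rintro g (hg | hg) hgv
  · exact fr g hg hgv
  · obtain ⟨k, hk, hkv⟩ := h.covC g hg _ hgv
    exact fr k hk hkv

/-- The vertex `y` has degree one in forest `3` and will keep it: parts `0` and `1` are finished
before part `2`, and later choices from part `2` avoid the vertices of this cycle. Hence `f` need
not enter the path ends. -/
theorem step_leaf {e f : Fin m} (he : e ∈ al) (hed : e ∉ done) (hp : L.part e = 2)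
    (hef : L.Conn al e f) {y : Fin n} (hy : L.Inc f y)
    (hy0 : ∀ g ∈ M ∩ L.col 0, ¬ L.Inc g y) (hy1 : ∀ g ∈ M ∩ L.col 1, ¬ L.Inc g y) :
    Split L al (done ∪ {g | L.Conn al e g}) (insert f M) LA LB FX T oA o4 := by
  have hpf : L.part f = 2 := hef.part_eq.trans hp
  have e0 : insert f M ∩ L.col 0 = M ∩ L.col 0 := insert_inter_col_of_ne (by simp [hpf])
  have e1 : insert f M ∩ L.col 1 = M ∩ L.col 1 := insert_inter_col_of_ne (by simp [hpf])
  have hsub : M ∩ L.col 2 ⊆ insert f M ∩ L.col 2 :=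
    Set.inter_subset_inter_left _ (Set.subset_insert _ _)
  constructor
  · exact h.trans.insert he hed hef
  · exact h.LA_sub.trans hsub
  · exact h.LB_sub.trans hsub
  · exact h.T_sub.trans hsub
  · rw [e1]; exact h.FX_sub
  · exact h.disj
  · rw [e0]; exact h.endsA
  · rw [e0]; exact h.covA
  · rw [e0, e1]; exact h.ends4
  · rw [e1]; exact h.acycB
  · rw [e1]; exact h.covB
  · exact h.acycC_insert hc he hed hp hef
  · intro g hg v hv
    obtain ⟨k, hk, hkv⟩ := h.covC g hg v hv
    exact ⟨k, hsub hk, hkv⟩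
  · rw [e0, e1]
    rintro g ⟨rfl | hg, hg2⟩
    · exact fun _ _ _ => ⟨y, hy, hy0, fun k hk hky => absurd hky (hy1 k hk)⟩
    · exact h.leaf g ⟨hg, hg2⟩

/-- Moving `g` to forest `2` leaves `f` as the only edge at `y` in forest `3`. Both ends of `g` are
now covered by chosen edges of part `2`, namely `f` at `y` and `k` at `y'`, as the transfer to
forest `2` requires. -/
theorem step_fix {e f g k : Fin m} (he : e ∈ al) (hed : e ∉ done) (hp : L.part e = 2)
    (hef : L.Conn al e f) {y y' : Fin n} (hy : L.Inc f y)
    (hy0 : ∀ g ∈ M ∩ L.col 0, ¬ L.Inc g y) (hg : g ∈ M ∩ L.col 1) (hgy : L.ed g = s(y, y'))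
    (hk : k ∈ M ∩ L.col 2) (hky : L.Inc k y') :
    Split L al (done ∪ {g | L.Conn al e g}) (insert f M) LA LB (insert g FX) T oA o4 := by
  have hpf : L.part f = 2 := hef.part_eq.trans hp
  have e0 : insert f M ∩ L.col 0 = M ∩ L.col 0 := insert_inter_col_of_ne (by simp [hpf])
  have e1 : insert f M ∩ L.col 1 = M ∩ L.col 1 := insert_inter_col_of_ne (by simp [hpf])
  have e2 : insert f M ∩ L.col 2 = insert f (M ∩ L.col 2) := insert_inter_col_self hpf
  have hsub : M ∩ L.col 2 ⊆ insert f M ∩ L.col 2 :=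
    Set.inter_subset_inter_left _ (Set.subset_insert _ _)
  have fr : ∀ v, L.Inc f v → ∀ g ∈ M ∩ L.col 2 ∪ FX, ¬ L.Inc g v := by
    have fr : ∀ v, L.Inc f v → ∀ g ∈ M ∩ L.col 2, ¬ L.Inc g v := fun v hv g hg =>
      h.trans.fresh he hed hef hv hg.1 (hp ▸ hg.2)
    rintro v hv g (hg | hg) hgv
    · exact fr v hv g hg hgv
    · obtain ⟨k, hk, hkv⟩ := h.covC g hg _ hgv
      exact fr v hv k hk hkv
  have hgf : g ≠ f := by
    rintro rfl
    have h1 : L.part g = 1 := hg.2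
    rw [h1] at hpf
    exact absurd hpf (by decide)
  have hgi : L.Inc g y := by rw [Inc, hgy]; simp
  -- The edge `k` of an earlier cycle of part `2` already occupies `y'`.
  have hfy' : ¬ L.Inc f y' := fun hf => fr y' hf k (Or.inl hk) hky
  have hyy : y ≠ y' := by rintro rfl; exact hfy' hy
  obtain ⟨w, hw⟩ := Sym2.mem_iff_exists.1 hy
  have hwy' : w ≠ y' := by rintro rfl; exact hfy' (by rw [Inc, hw]; simp)
  have hwi : L.Inc f w := by rw [Inc, hw]; simp
  constructor
  · exact h.trans.insert he hed hef
  · exact h.LA_sub.trans hsub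
  · exact h.LB_sub.trans hsub
  · exact h.T_sub.trans hsub
  · rw [e1]
    rintro x (rfl | hx)
    · exact hg
    · exact h.FX_sub hx
  · exact h.disj
  · rw [e0]; exact h.endsA
  · rw [e0]; exact h.covA
  · rw [e0, e1]; exact h.ends4
  · rw [e1]; exact h.acycB
  · rw [e1]; exact h.covB
  · rw [Set.union_insert, gr_insert]
    have he : edge (L.src g) (L.dst g) = edge y y' := by rw [edge, edge]; congr 2
    rw [he]
    refine (h.acycC_insert hc ‹_› hed hp hef).sup_edge_of_not_reachable fun hr => ?_
    have he' : edge (L.src f) (L.dst f) = edge y w := by rw [edge, edge]; congr 2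
    rw [e2, Set.insert_union, gr_insert, he'] at hr
    -- Before `f` is added both of its ends `y` and `w` are isolated, so afterwards the component of
    -- `y` is `{y, w}`, which does not contain `y'`.
    have hisoy : ∀ z, y ≠ z → ¬ (L.gr (M ∩ L.col 2 ∪ FX)).Reachable y z := fun z =>
      not_reachable_of_isolated ((not_adj_iff hc.simple).2 (fr y hy))
    have hisow : ∀ z, w ≠ z → ¬ (L.gr (M ∩ L.col 2 ∪ FX)).Reachable w z := fun z =>
      not_reachable_of_isolated ((not_adj_iff hc.simple).2 (fr w hwi))
    rcases reachable_sup_edge hr with hr | ⟨-, hr⟩ | ⟨-, hr⟩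
    · exact hisoy _ hyy hr
    · exact hisow _ hwy' hr
    · exact hisoy _ hyy hr
  · rintro x (rfl | hx) v hv
    · rcases Inc.eq_or hgy hv with rfl | rfl
      · exact ⟨f, e2 ▸ Set.mem_insert _ _, hy⟩
      · exact ⟨k, hsub hk, hky⟩
    · obtain ⟨k, hk, hkv⟩ := h.covC x hx v hv
      exact ⟨k, hsub hk, hkv⟩
  · rw [e0, e1]
    rintro x ⟨rfl | hx, hx2⟩
    · refine fun _ _ _ => ⟨y, hy, hy0, fun k hk hky => Or.inl ?_⟩
      exact h.trans.eq_of_inc hk.1 hg.1 (hk.2.trans hg.2.symm) hky hgi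
    · intro h1 h2 h3
      obtain ⟨z, hz, hz0, hz1⟩ := h.leaf x ⟨hx, hx2⟩ h1 h2 h3
      exact ⟨z, hz, hz0, fun k hk hkz => Or.inr (hz1 k hk hkz)⟩

/-- Each end of `f` is missed by part `0` or by part `1`, and by `T` because the cycle is new. So
both are ends in the recorded graph, and `ho` rules out a cycle. -/
theorem step_four {e f : Fin m} (he : e ∈ al) (hed : e ∉ done) (hp : L.part e = 2)
    (hef : L.Conn al e f) {x y : Fin n} (hf : L.ed f = s(x, y))
    (hx : (∀ g ∈ M ∩ L.col 0, ¬ L.Inc g x) ∨ ∀ g ∈ M ∩ L.col 1, ¬ L.Inc g x)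
    (hy : (∀ g ∈ M ∩ L.col 0, ¬ L.Inc g y) ∨ ∀ g ∈ M ∩ L.col 1, ¬ L.Inc g y)
    (ho : o4 y ≠ x) :
    Split L al (done ∪ {g | L.Conn al e g}) (insert f M) LA LB FX (insert f T)
      oA (mergeEnds o4 x y) := by
  have hpf : L.part f = 2 := hef.part_eq.trans hp
  have e0 : insert f M ∩ L.col 0 = M ∩ L.col 0 := insert_inter_col_of_ne (by simp [hpf])
  have e1 : insert f M ∩ L.col 1 = M ∩ L.col 1 := insert_inter_col_of_ne (by simp [hpf])
  have e2 : insert f M ∩ L.col 2 = insert f (M ∩ L.col 2) := insert_inter_col_self hpf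
  have hsub : M ∩ L.col 2 ⊆ insert f M ∩ L.col 2 :=
    Set.inter_subset_inter_left _ (Set.subset_insert _ _)
  have hfM : f ∉ M := h.trans.notMem hed hef
  have fr : ∀ v, L.Inc f v → ∀ g ∈ T, ¬ L.Inc g v := fun v hv g hg =>
    h.trans.fresh he hed hef hv (h.T_sub hg).1 (hp ▸ (h.T_sub hg).2)
  have hxi : L.Inc f x := by rw [Inc, hf]; simp
  have hyi : L.Inc f y := by rw [Inc, hf]; simp
  constructor
  · exact h.trans.insert he hed hef
  · exact h.LA_sub.trans hsub
  · exact h.LB_sub.trans hsub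
  · rw [e2]; exact Set.insert_subset_insert h.T_sub
  · rw [e1]; exact h.FX_sub
  · intro g
    refine ⟨fun hg => ⟨((h.disj g).1 hg).1, ?_⟩, fun hg => ?_⟩
    · rintro (rfl | hgT)
      · exact hfM (h.LA_sub hg).1
      · exact ((h.disj g).1 hg).2 hgT
    · rintro (rfl | hgT)
      · exact hfM (h.LB_sub hg).1
      · exact (h.disj g).2 hg hgT
  · rw [e0]; exact h.endsA
  · rw [e0]; exact h.covA
  · rw [e0, e1, Set.union_insert]
    exact pathEnds_insert hc.simple h.ends4 hf (h.isEnd_four hc (fr x hxi) hx)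
      (h.isEnd_four hc (fr y hyi) hy) ho
  · rw [e1]; exact h.acycB
  · rw [e1]; exact h.covB
  · exact h.acycC_insert hc he hed hp hef
  · intro g hg v hv
    obtain ⟨k, hk, hkv⟩ := h.covC g hg v hv
    exact ⟨k, hsub hk, hkv⟩
  · rw [e0, e1]
    rintro g ⟨rfl | hg, hg2⟩
    · exact fun _ _ h => absurd (Set.mem_insert _ _) h
    · exact fun h1 h2 h3 => h.leaf g ⟨hg, hg2⟩ h1 h2 fun h4 => h3 (Or.inr h4)

/-- Neither `y` nor `y'` has a diverted edge before `f` is added, so in the graph of chosen and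
diverted edges of forest `1` the component of `y` consists of `g` alone. The new edge leads out of
it. -/
theorem step_linkB {e f g : Fin m} (he : e ∈ al) (hed : e ∉ done) (hp : L.part e = 2)
    (hef : L.Conn al e f) {y y' w : Fin n} (hf : L.ed f = s(y, w))
    (hg : g ∈ M ∩ L.col 1) (hgy : L.ed g = s(y, y'))
    (hy' : ∀ k ∈ LB, ¬ L.Inc k y') (hw : ∃ k ∈ M ∩ L.col 1, L.Inc k w) :
    Split L al (done ∪ {g | L.Conn al e g}) (insert f M) LA (insert f LB) FX T oA o4 := by
  have hpf : L.part f = 2 := hef.part_eq.trans hp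
  have e0 : insert f M ∩ L.col 0 = M ∩ L.col 0 := insert_inter_col_of_ne (by simp [hpf])
  have e1 : insert f M ∩ L.col 1 = M ∩ L.col 1 := insert_inter_col_of_ne (by simp [hpf])
  have e2 : insert f M ∩ L.col 2 = insert f (M ∩ L.col 2) := insert_inter_col_self hpf
  have hsub : M ∩ L.col 2 ⊆ insert f M ∩ L.col 2 :=
    Set.inter_subset_inter_left _ (Set.subset_insert _ _)
  have hfM : f ∉ M := h.trans.notMem hed hef
  have hyi : L.Inc f y := by rw [Inc, hf]; simp
  have hgi : L.Inc g y := by rw [Inc, hgy]; simp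
  have hgi' : L.Inc g y' := by rw [Inc, hgy]; simp
  have fr : ∀ k ∈ LB, ¬ L.Inc k y := fun k hk =>
    h.trans.fresh he hed hef hyi (h.LB_sub hk).1 (hp ▸ (h.LB_sub hk).2)
  have hgf : g ≠ f := by
    rintro rfl
    have h1 : L.part g = 1 := hg.2
    rw [h1] at hpf
    exact absurd hpf (by decide)
  -- Otherwise `f` and `g` would be one edge of a simple graph, although they lie in different
  -- parts.
  have hwy' : w ≠ y' := by
    rintro rfl
    exact hgf (hc.simple.inj (hgy.trans hf.symm))
  have hyw : y ≠ w := by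
    rintro rfl
    have := hc.simple.ne f
    rw [ed, Sym2.eq_iff] at hf
    rcases hf with ⟨h1, h2⟩ | ⟨h1, h2⟩ <;> exact this (h1.trans h2.symm)
  -- the component of `y` is the edge `g`
  have hcomp : ∀ u v, (L.gr (M ∩ L.col 1 ∪ LB)).Reachable u v → (u = y ∨ u = y') →
      (v = y ∨ v = y') := by
    rintro u v ⟨p⟩
    induction p with
    | nil => exact id
    | @cons u u' v hadj _ ih =>
      intro hu
      refine ih ?_
      obtain ⟨k, hk, hke⟩ := (gr_adj hc.simple).1 hadj
      have hku : L.Inc k u := by rw [Inc, hke]; simp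
      have hku' : L.Inc k u' := by rw [Inc, hke]; simp
      rcases hk with hk | hk
      · have hgu : L.Inc g u := by rcases hu with rfl | rfl <;> assumption
        have := h.trans.eq_of_inc hk.1 hg.1 (hk.2.trans hg.2.symm) hku hgu
        subst this
        exact Inc.eq_or hgy hku'
      · rcases hu with rfl | rfl
        · exact absurd hku (fr k hk)
        · exact absurd hku (hy' k hk)
  constructor
  · exact h.trans.insert he hed hef
  · exact h.LA_sub.trans hsub
  · rw [e2]; exact Set.insert_subset_insert h.LB_sub
  · exact h.T_sub.trans hsub
  · rw [e1]; exact h.FX_sub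
  · intro g
    refine ⟨fun hg => ⟨?_, ((h.disj g).1 hg).2⟩, ?_⟩
    · rintro (rfl | hgB)
      · exact hfM (h.LA_sub hg).1
      · exact ((h.disj g).1 hg).1 hgB
    · rintro (rfl | hgB) hgT
      · exact hfM (h.T_sub hgT).1
      · exact (h.disj g).2 hgB hgT
  · rw [e0]; exact h.endsA
  · rw [e0]; exact h.covA
  · rw [e0, e1]; exact h.ends4
  · rw [e1, Set.union_insert, gr_insert]
    have he : edge (L.src f) (L.dst f) = edge y w := by rw [edge, edge]; congr 2
    rw [he]
    refine h.acycB.sup_edge_of_not_reachable fun hr => ?_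
    rcases hcomp _ _ hr (Or.inl rfl) with h1 | h1
    · exact hyw h1.symm
    · exact hwy' h1
  · rw [e1]
    rintro k (rfl | hk) v hv
    · rcases Inc.eq_or hf hv with rfl | rfl
      · exact ⟨g, hg, hgi⟩
      · exact hw
    · exact h.covB k hk v hv
  · exact h.acycC_insert hc he hed hp hef
  · intro g hg v hv
    obtain ⟨k, hk, hkv⟩ := h.covC g hg v hv
    exact ⟨k, hsub hk, hkv⟩
  · rw [e0, e1]
    rintro g ⟨rfl | hg, hg2⟩
    · exact fun _ h => absurd (Set.mem_insert _ _) h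
    · exact fun h1 h2 h3 => h.leaf g ⟨hg, hg2⟩ h1 (fun h4 => h2 (Or.inr h4)) h3

/-- The chosen edges of part `0` and those diverted to forest `0` are two matchings, and `f` meets
none of the diverted ones. Its ends are therefore path ends. -/
theorem step_linkA {e f : Fin m} (he : e ∈ al) (hed : e ∉ done) (hp : L.part e = 2)
    (hef : L.Conn al e f)
    (hcov : ∀ v, L.Inc f v → ∃ g ∈ M ∩ L.col 0, L.Inc g v)
    {x y : Fin n} (hf : L.ed f = s(x, y)) (ho : oA y ≠ x) :
    Split L al (done ∪ {g | L.Conn al e g}) (insert f M) (insert f LA) LB FX T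
      (mergeEnds oA x y) o4 := by
  have hpf : L.part f = 2 := hef.part_eq.trans hp
  have e0 : insert f M ∩ L.col 0 = M ∩ L.col 0 := insert_inter_col_of_ne (by simp [hpf])
  have e1 : insert f M ∩ L.col 1 = M ∩ L.col 1 := insert_inter_col_of_ne (by simp [hpf])
  have e2 : insert f M ∩ L.col 2 = insert f (M ∩ L.col 2) := insert_inter_col_self hpf
  have hsub : M ∩ L.col 2 ⊆ insert f M ∩ L.col 2 :=
    Set.inter_subset_inter_left _ (Set.subset_insert _ _)
  have hfM : f ∉ M := h.trans.notMem hed hef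
  have hend : ∀ v, L.Inc f v → (L.gr (M ∩ L.col 0 ∪ LA)).IsEnd v := by
    intro v hv
    have fr : ∀ g ∈ LA, ¬ L.Inc g v := fun g hg =>
      h.trans.fresh he hed hef hv (h.LA_sub hg).1 (hp ▸ (h.LA_sub hg).2)
    refine isEnd_of hc.simple ?_
    rintro x (hx | hx) y (hy | hy) hxv hyv
    · exact h.trans.eq_of_inc hx.1 hy.1 (hx.2.trans hy.2.symm) hxv hyv
    all_goals first | exact absurd hyv (fr y hy) | exact absurd hxv (fr x hx)
  constructor
  · exact h.trans.insert he hed hef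
  · rw [e2]; exact Set.insert_subset_insert h.LA_sub
  · exact h.LB_sub.trans hsub
  · exact h.T_sub.trans hsub
  · rw [e1]; exact h.FX_sub
  · intro g
    refine ⟨?_, (h.disj g).2⟩
    rintro (rfl | hg)
    · exact ⟨fun hB => hfM (h.LB_sub hB).1, fun hT => hfM (h.T_sub hT).1⟩
    · exact (h.disj g).1 hg
  · rw [e0, Set.union_insert]
    exact pathEnds_insert hc.simple h.endsA hf (hend _ (by rw [Inc, hf]; simp))
      (hend _ (by rw [Inc, hf]; simp)) ho
  · rw [e0]
    rintro k (rfl | hk) v hv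
    · exact hcov v hv
    · exact h.covA k hk v hv
  · rw [e0, e1]; exact h.ends4
  · rw [e1]; exact h.acycB
  · rw [e1]; exact h.covB
  · exact h.acycC_insert hc he hed hp hef
  · intro g hg v hv
    obtain ⟨k, hk, hkv⟩ := h.covC g hg v hv
    exact ⟨k, hsub hk, hkv⟩
  · rw [e0, e1]
    rintro g ⟨rfl | hg, hg2⟩
    · exact fun h => absurd (Set.mem_insert _ _) h
    · exact fun h1 h2 h3 => h.leaf g ⟨hg, hg2⟩ (fun h4 => h1 (Or.inr h4)) h2 h3

end Split

open Classical in
/-- The forest part of each edge, read off from a distribution. -/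
structure IsOutput (L : EdgeList n m 3) (M LA LB FX : Set (Fin m)) (out : Fin m → ℕ) : Prop where
  keep : ∀ e ∉ M, out e = L.part e
  zero : ∀ e ∈ M ∩ L.col 0, out e = 3
  one : ∀ e ∈ M ∩ L.col 1, out e = if e ∈ FX then 2 else 3
  two : ∀ e ∈ M ∩ L.col 2, out e = if e ∈ LA then 0 else if e ∈ LB then 1 else 3

theorem mem_col_cases (e : Fin m) : e ∈ L.col 0 ∨ e ∈ L.col 1 ∨ e ∈ L.col 2 := by
  have : ∀ c : Fin 3, c = 0 ∨ c = 1 ∨ c = 2 := by decide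
  exact this (L.part e)

/-- The edges of a part that are not chosen stay acyclic when edges are added whose ends are
covered by the chosen edges, provided that the latter two form a forest. -/
theorem IsTransversal.isAcyclic_union (hc : IsCore L al) (h : IsTransversal L al al M) {c : Fin 3}
    {S : Set (Fin m)} (hS : ∀ e ∈ S, L.part e ≠ c)
    (hcov : ∀ e ∈ S, ∀ v, L.Inc e v → ∃ f ∈ M ∩ L.col c, L.Inc f v)
    (hac : (L.gr (M ∩ L.col c ∪ S)).IsAcyclic) : (L.gr (L.col c \ M ∪ S)).IsAcyclic := by
  classical
  rw [gr_union_toFinset] at hac ⊢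
  refine IsAcyclic.sup_transfer (M := L.gr (M ∩ L.col c))
    (hc.isAcyclic_of_transversal fun e he _ => h.exists_conn e he)
    {v | ∃ f ∈ M ∩ L.col c, L.Inc f v} ?_ _ _ _ (fun e _ => hc.simple.ne e)
    (fun e he => hcov e (Set.mem_toFinset.1 he) _ (inc_src e))
    (fun e he => hcov e (Set.mem_toFinset.1 he) _ (inc_dst e)) ?_
    (fun e _ f _ hef => hc.simple.inj hef) hac
  -- Two covered vertices in one component of the part lie on the same chosen edge: a component has
  -- at most one core cycle, and a cycle has exactly one chosen edge.
  · rintro u ⟨f, hf, hfu⟩ v ⟨g, hg, hgv⟩ hr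
    have hfp : L.part f = c := hf.2
    have hgp : L.part g = c := hg.2
    have : L.Conn al f g := by
      refine hc.conn_of_reachable (h.mem hf.1) (h.mem hg.1) (hgp.trans hfp.symm) hfu hgv ?_
      rw [hfp]
      exact hr.mono (gr_mono Set.sdiff_subset)
    have := h.uniq f hf.1 g hg.1 this
    subst this
    have hadj := ((gr_adj_src_dst hc.simple).2 hf).reachable
    rcases inc_iff.1 hfu with rfl | rfl <;> rcases inc_iff.1 hgv with rfl | rfl
    exacts [Reachable.refl _, hadj, hadj.symm, Reachable.refl _]
  · intro e he hadj
    exact hS e (Set.mem_toFinset.1 he) ((gr_adj_src_dst hc.simple).1 hadj).2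

/-! ### The four output forests and the degree bound -/

namespace Split

variable (hc : IsCore L al) (h : Split L al al M LA LB FX T oA o4) {out : Fin m → ℕ}
  (ho : IsOutput L M LA LB FX out)
include hc h ho

theorem isAcyclic_zero : (L.gr {e | out e = 0}).IsAcyclic := by
  refine (h.trans.isAcyclic_union hc (c := 0) (fun e he => ?_) h.covA h.endsA.acyclic).anti
    (gr_mono fun e he => ?_)
  · have : L.part e = 2 := (h.LA_sub he).2
    rw [this]; decide
  · change out e = 0 at he
    by_cases heM : e ∈ M
    · rcases mem_col_cases (L := L) e with hp | hp | hp
      · rw [ho.zero e ⟨heM, hp⟩] at he; omega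
      · rw [ho.one e ⟨heM, hp⟩] at he; split_ifs at he
      · rw [ho.two e ⟨heM, hp⟩] at he
        split_ifs at he with h1
        exact Or.inr h1
    · rw [ho.keep e heM] at he
      exact Or.inl ⟨Fin.ext he, heM⟩

theorem isAcyclic_one : (L.gr {e | out e = 1}).IsAcyclic := by
  refine (h.trans.isAcyclic_union hc (c := 1) (fun e he => ?_) h.covB h.acycB).anti
    (gr_mono fun e he => ?_)
  · have : L.part e = 2 := (h.LB_sub he).2
    rw [this]; decide
  · change out e = 1 at he
    by_cases heM : e ∈ M
    · rcases mem_col_cases (L := L) e with hp | hp | hp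
      · rw [ho.zero e ⟨heM, hp⟩] at he; omega
      · rw [ho.one e ⟨heM, hp⟩] at he; split_ifs at he <;> omega
      · rw [ho.two e ⟨heM, hp⟩] at he
        split_ifs at he with h1 h2
        · exact Or.inr h2
        · omega
    · rw [ho.keep e heM] at he
      exact Or.inl ⟨Fin.ext he, heM⟩

theorem isAcyclic_two : (L.gr {e | out e = 2}).IsAcyclic := by
  refine (h.trans.isAcyclic_union hc (c := 2) (fun e he => ?_) h.covC h.acycC).anti
    (gr_mono fun e he => ?_)
  · have : L.part e = 1 := (h.FX_sub he).2
    rw [this]; decide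
  · change out e = 2 at he
    by_cases heM : e ∈ M
    · rcases mem_col_cases (L := L) e with hp | hp | hp
      · rw [ho.zero e ⟨heM, hp⟩] at he; omega
      · rw [ho.one e ⟨heM, hp⟩] at he
        split_ifs at he with h1
        · exact Or.inr h1
        · omega
      · rw [ho.two e ⟨heM, hp⟩] at he
        split_ifs at he <;> omega
    · rw [ho.keep e heM] at he
      exact Or.inl ⟨Fin.ext he, heM⟩

omit hc h in
theorem mem_of_out_eq_three {e : Fin m} (he : out e = 3) : e ∈ M := by
  by_contra heM
  rw [ho.keep e heM] at he
  have := (L.part e).isLt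
  omega

/-- The edges of parts `0` and `1` and those of `T` that remain in forest `3` lie in the recorded
forest. All others are chosen edges of part `2` with a leaf end, and they are added on top as
pendant edges. -/
theorem isAcyclic_three : (L.gr {e | out e = 3}).IsAcyclic := by
  classical
  set S : Set (Fin m) := {e | e ∈ M ∩ L.col 2 ∧ e ∉ LA ∧ e ∉ LB ∧ e ∉ T} with hS
  have hleaf : ∀ e, ∃ y w, L.ed e = s(y, w) ∧ (e ∈ S → (∀ g ∈ M ∩ L.col 0, ¬ L.Inc g y) ∧
      ∀ g ∈ M ∩ L.col 1, L.Inc g y → g ∈ FX) := by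
    intro e
    by_cases he : e ∈ S
    · obtain ⟨y, hy, h0, h1⟩ := h.leaf e he.1 he.2.1 he.2.2.1 he.2.2.2
      obtain ⟨w, hw⟩ := Sym2.mem_iff_exists.1 hy
      exact ⟨y, w, hw, fun _ => ⟨h0, h1⟩⟩
    · exact ⟨_, _, rfl, fun h => absurd h he⟩
  choose y w hyw hy using hleaf
  have hyi : ∀ e, L.Inc e (y e) := fun e => by rw [Inc, hyw]; simp
  have hwi : ∀ e, L.Inc e (w e) := fun e => by rw [Inc, hyw]; simp
  -- The edges of `FX` must be discarded first, because `leaf` allows them at `y`.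
  have hH : (L.gr (M ∩ L.col 0 ∪ ((M ∩ L.col 1) \ FX) ∪ T)).IsAcyclic :=
    h.ends4.acyclic.anti (gr_mono (Set.union_subset_union_left _
      (Set.union_subset_union_right _ Set.sdiff_subset)))
  have hne : ∀ e ∈ S, ∀ f ∈ M ∩ L.col 2, e ≠ f → ∀ v, L.Inc e v → ¬ L.Inc f v :=
    fun e he f hf hef v hev hfv =>
      hef (h.trans.eq_of_inc he.1.1 hf.1 (he.1.2.trans hf.2.symm) hev hfv)
  have key := hH.sup_pendant S.toFinset y w (fun e _ heq => by
      have h1 := hyw e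
      rw [← heq, ed, Sym2.eq_iff] at h1
      rcases h1 with ⟨h1, h2⟩ | ⟨h1, h2⟩ <;> exact hc.simple.ne e (h1.trans h2.symm))
    (fun e he => by
      rw [Set.mem_toFinset] at he
      rw [not_adj_iff hc.simple]
      rintro g ((hg | hg) | hg) hgy
      · exact (hy e he).1 g hg hgy
      · exact hg.2 ((hy e he).2 g hg.1 hgy)
      · exact hne e he g (h.T_sub hg) (fun heg => he.2.2.2 (heg ▸ hg)) _ (hyi e) hgy)
    (fun e he f hf hef => by
      rw [Set.mem_toFinset] at he hf
      have := hne e he f hf.1 hef _ (hyi e)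
      exact ⟨fun h1 => this (h1 ▸ hyi f), fun h1 => this (h1 ▸ hwi f)⟩)
  have hedge : ∀ e, edge (y e) (w e) = edge (L.src e) (L.dst e) := by
    intro e
    rw [edge, edge, ← hyw e, ed]
  simp only [hedge] at key
  rw [← gr_union_toFinset] at key
  refine key.anti (gr_mono fun e he => ?_)
  have heM := mem_of_out_eq_three ho he
  change out e = 3 at he
  rcases mem_col_cases (L := L) e with hp | hp | hp
  · exact Or.inl (Or.inl (Or.inl ⟨heM, hp⟩))
  · rw [ho.one e ⟨heM, hp⟩] at he
    split_ifs at he with h1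
    · omega
    · exact Or.inl (Or.inl (Or.inr ⟨⟨heM, hp⟩, h1⟩))
  · rw [ho.two e ⟨heM, hp⟩] at he
    split_ifs at he with h1 h2
    · omega
    · by_cases h3 : e ∈ T
      · exact Or.inl (Or.inr h3)
      · exact Or.inr ⟨⟨heM, hp⟩, h1, h2, h3⟩

/-- The part of an edge is injective on the edges of forest `3` at `v`, because the chosen edges of
each part form a matching. -/
theorem degree_three_le [DecidableRel (L.gr {e | out e = 3}).Adj] (v : Fin n) :
    (L.gr {e | out e = 3}).degree v ≤ 3 := by
  classical
  have hex : ∀ u, ∃ c : Fin 3, (L.gr {e | out e = 3}).Adj v u →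
      ∃ e ∈ M, L.ed e = s(v, u) ∧ L.part e = c := by
    intro u
    by_cases hu : (L.gr {e | out e = 3}).Adj v u
    · obtain ⟨e, he, hev⟩ := (gr_adj hc.simple).1 hu
      exact ⟨L.part e, fun _ => ⟨e, mem_of_out_eq_three ho he, hev, rfl⟩⟩
    · exact ⟨0, fun h => absurd h hu⟩
  choose c hcol using hex
  rw [← card_neighborFinset_eq_degree]
  refine (Finset.card_le_card_of_injOn c (t := Finset.univ) (fun _ _ => Finset.mem_univ _)
    ?_).trans (by simp)
  intro u hu u' hu' hcc
  simp only [coe_neighborFinset, mem_neighborSet] at hu hu'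
  obtain ⟨e, he, hev, hec⟩ := hcol u hu
  obtain ⟨e', he', hev', hec'⟩ := hcol u' hu'
  have := h.trans.eq_of_inc he he' (by rw [hec, hec', hcc]) (v := v)
    (by rw [Inc, hev]; simp) (by rw [Inc, hev']; simp)
  subst this
  rw [hev, Sym2.eq_iff] at hev'
  rcases hev' with ⟨-, h1⟩ | ⟨h1, h2⟩
  · exact h1
  · exact h2.trans h1

end Split

end EdgeList

/-! ### Reasoning about programs -/

namespace RAM

@[simp] theorem State.setReg_reg (s : State) (x v y : ℕ) :
    (s.setReg x v).reg y = if y = x then v else s.reg y := by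
  simp [State.setReg, Function.update_apply]

@[simp] theorem State.setReg_arr (s : State) (x v : ℕ) : (s.setReg x v).arr = s.arr := rfl

@[simp] theorem State.setArr_reg (s : State) (a i v : ℕ) : (s.setArr a i v).reg = s.reg := rfl

@[simp] theorem State.setArr_arr (s : State) (a i v b : ℕ) :
    (s.setArr a i v).arr b = if b = a then Function.update (s.arr a) i v else s.arr b := by
  by_cases h : b = a
  · subst h; simp [State.setArr]
  · simp [State.setArr, h]

namespace Program

/-- The weakest precondition of a program without loops. -/
def pre (W : ℕ) : Program → (State → Prop) → State → Prop
  | skip, Q, s => Q s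
  | set x e, Q, s => e.eval s ≤ W ∧ Q (s.setReg x (e.eval s))
  | put a i e, Q, s => i.eval s ≤ W ∧ e.eval s ≤ W ∧ Q (s.setArr a (i.eval s) (e.eval s))
  | seq p q, Q, s => p.pre W (q.pre W Q) s
  | ite b p q, Q, s => (b.eval s → p.pre W Q s) ∧ (¬ b.eval s → q.pre W Q s)
  | .while _ _, _, _ => False

/-- A bound on the running time of a program without loops. -/
def bound : Program → ℕ
  | skip => 1
  | set _ e => e.cost + 1
  | put _ i e => i.cost + e.cost + 1
  | seq p q => p.bound + q.bound
  | ite b p q => b.cost + 1 + (p.bound + q.bound)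
  | .while _ _ => 0

/-- The programs of a list, one after the other. -/
def block : List Program → Program
  | [] => skip
  | p :: ps => seq p (block ps)

/-- `body` for the values `0, …, e - 1` of register `2`. -/
def forLoop (e : Expr) (body : Program) : Program :=
  seq (set 2 (.const 0))
    (.while (.lt (.reg 2) e) (seq body (set 2 (.add (.reg 2) (.const 1)))))

end Program

/-- From state `s` with fuel `φ` the program halts, and the final state and the remaining fuel
satisfy `Q`. -/
def Halts (W : ℕ) (p : Program) (s : State) (φ : ℕ) (Q : ℕ → State → Prop) : Prop :=
  ∃ t s' φ', Exec W p s t s' ∧ t + φ' ≤ φ ∧ Q φ' s'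

theorem Halts.mono {W : ℕ} {p : Program} {s : State} {φ ψ : ℕ} {Q R : ℕ → State → Prop}
    (h : Halts W p s φ Q) (hφ : φ ≤ ψ) (hQ : ∀ φ s, Q φ s → R φ s) : Halts W p s ψ R := by
  obtain ⟨t, s', φ', h1, h2, h3⟩ := h
  exact ⟨t, s', φ', h1, h2.trans hφ, hQ _ _ h3⟩

theorem Halts.relax {W : ℕ} {p : Program} {s : State} {φ : ℕ} {Q R : ℕ → State → Prop}
    (h : Halts W p s φ Q) (hQ : ∀ φ s, Q φ s → ∃ ψ ≤ φ, R ψ s) : Halts W p s φ R := by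
  obtain ⟨t, s', φ', h1, h2, h3⟩ := h
  obtain ⟨ψ, h4, h5⟩ := hQ _ _ h3
  exact ⟨t, s', ψ, h1, by omega, h5⟩

theorem Halts.seq {W : ℕ} {p q : Program} {s : State} {φ : ℕ} {Q : ℕ → State → Prop}
    (h : Halts W p s φ fun ψ s' => Halts W q s' ψ Q) : Halts W (.seq p q) s φ Q := by
  obtain ⟨t, s', φ', h1, h2, t', s'', φ'', h3, h4, h5⟩ := h
  exact ⟨t + t', s'', φ'', .seq h1 h3, by omega, h5⟩

theorem Program.pre.halts {W : ℕ} {p : Program} {s : State} {Q : State → Prop}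
    (h : p.pre W Q s) (φ : ℕ) : Halts W p s (p.bound + φ) fun ψ s' => ψ = φ ∧ Q s' := by
  suffices ∃ t s', Exec W p s t s' ∧ t ≤ p.bound ∧ Q s' by
    obtain ⟨t, s', h1, h2, h3⟩ := this
    exact ⟨t, s', φ, h1, by omega, rfl, h3⟩
  induction p generalizing s Q with
  | skip => exact ⟨_, _, .skip s, le_rfl, h⟩
  | set x e => exact ⟨_, _, .set h.1, le_rfl, h.2⟩
  | put a i e => exact ⟨_, _, .put h.1 h.2.1, le_rfl, h.2.2⟩
  | seq p q ihp ihq =>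
    obtain ⟨t, s', h1, h2, h3⟩ := ihp h
    obtain ⟨t', s'', h4, h5, h6⟩ := ihq h3
    exact ⟨_, _, .seq h1 h4, by simp only [Program.bound]; omega, h6⟩
  | ite b p q ihp ihq =>
    by_cases hb : b.eval s
    · obtain ⟨t, s', h1, h2, h3⟩ := ihp (h.1 hb)
      exact ⟨_, _, .ite_true hb h1, by simp only [Program.bound]; omega, h3⟩
    · obtain ⟨t, s', h1, h2, h3⟩ := ihq (h.2 hb)
      exact ⟨_, _, .ite_false hb h1, by simp only [Program.bound]; omega, h3⟩
  | _ => exact h.elim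

/-- The fuel is both time bound and termination measure: every evaluation of the test consumes a
positive amount. -/
theorem Halts.loop {W : ℕ} {b : Test} {p : Program} (I Q : ℕ → State → Prop)
    (hstep : ∀ φ s, I φ s → b.eval s → ∃ ψ, φ = b.cost + 1 + ψ ∧ Halts W p s ψ I)
    (hend : ∀ φ s, I φ s → ¬ b.eval s → ∃ ψ, φ = b.cost + 1 + ψ ∧ Q ψ s)
    (φ : ℕ) (s : State) (h : I φ s) : Halts W (.while b p) s φ Q := by
  induction φ using Nat.strong_induction_on generalizing s with
  | _ φ ih =>
    by_cases hb : b.eval s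
    · obtain ⟨ψ, rfl, t, s', φ', h1, h2, h3⟩ := hstep φ s h hb
      obtain ⟨t', s'', φ'', h4, h5, h6⟩ := ih φ' (by omega) s' h3
      exact ⟨_, s'', φ'', .while_true hb h1 h4, by omega, h6⟩
    · obtain ⟨ψ, rfl, h1⟩ := hend φ s h hb
      exact ⟨_, s, ψ, .while_false hb, by omega, h1⟩

/-- The invariant carries the fuel left for inner loops, so that their cost is amortised over all
rounds, while `c` pays for the bounded part of one round. Test and increment cost `e.cost + 7`; the
remaining unit is slack. -/
theorem Halts.forLoop {W N c : ℕ} {e : Expr} {body : Program} (I : ℕ → ℕ → State → Prop)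
    (hN : N ≤ W) (hI : ∀ i φ s, I i φ s → s.reg 2 = i ∧ e.eval s = N)
    (hbody : ∀ i φ s, i < N → I i φ s → Halts W body s (c + φ) fun ψ s' =>
      s'.reg 2 = i ∧ I (i + 1) ψ (s'.setReg 2 (i + 1)))
    {φ : ℕ} {s : State} (h : I 0 φ (s.setReg 2 0)) :
    Halts W (.forLoop e body) s (φ + (N + 1) * (c + e.cost + 8)) (I N) := by
  have hk : ∀ k : ℕ, (k + 1) * (c + e.cost + 8) = k * (c + e.cost + 8) + (c + e.cost + 8) :=
    fun k => by ring
  refine Halts.seq ⟨2, s.setReg 2 0, φ + N * (c + e.cost + 8) + (e.cost + 3),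
    .set (by simp [Expr.eval]), by rw [hk]; omega, ?_⟩
  refine Halts.loop (fun ψ s => ∃ i φ, i ≤ N ∧ I i φ s ∧
    ψ = φ + (N - i) * (c + e.cost + 8) + (e.cost + 3)) _ ?_ ?_ _ _ ⟨0, φ, by omega, h, by simp⟩
  · rintro ψ s ⟨i, φ, hi, hs, rfl⟩ hb
    obtain ⟨h2, he⟩ := hI i φ s hs
    simp only [Test.eval, Expr.eval, h2, he] at hb
    obtain ⟨k, rfl⟩ : ∃ k, N = i + k + 1 := ⟨N - i - 1, by omega⟩
    have e1 : i + k + 1 - i = k + 1 := by omega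
    refine ⟨c + φ + k * (c + e.cost + 8) + (e.cost + 8), by
      simp only [Test.cost, Expr.cost]; rw [e1, hk]; omega, Halts.seq ?_⟩
    obtain ⟨t, s', φ', h3, h4, h5, h6⟩ := hbody i φ s hb hs
    refine ⟨t, s', φ' + k * (c + e.cost + 8) + (e.cost + 8), h3, by omega, ?_⟩
    have hev : (Expr.add (.reg 2) (.const 1)).eval s' = i + 1 := by simp [Expr.eval, h5]
    refine ⟨_, _, φ' + k * (c + e.cost + 8) + (e.cost + 3), .set (by rw [hev]; omega), ?_,
      i + 1, φ', by omega, ?_, ?_⟩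
    · simp only [Expr.cost]; omega
    · rw [hev]; exact h6
    · have e2 : i + k + 1 - (i + 1) = k := by omega
      rw [e2]
  · rintro ψ s ⟨i, φ, hi, hs, rfl⟩ hb
    obtain ⟨h2, he⟩ := hI i φ s hs
    simp only [Test.eval, Expr.eval, h2, he] at hb
    obtain rfl : i = N := by omega
    exact ⟨φ, by simp [Test.cost, Expr.cost]; omega, hs⟩

theorem Program.pre_mono {W : ℕ} {p : Program} {s : State} {Q R : State → Prop}
    (h : p.pre W Q s) (hQ : ∀ s, Q s → R s) : p.pre W R s := by
  induction p generalizing s Q R with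
  | skip => exact hQ _ h
  | set x e => exact ⟨h.1, hQ _ h.2⟩
  | put a i e => exact ⟨h.1, h.2.1, hQ _ h.2.2⟩
  | seq p q ihp ihq => exact ihp h fun s hs => ihq hs hQ
  | ite b p q ihp ihq => exact ⟨fun hb => ihp (h.1 hb) hQ, fun hb => ihq (h.2 hb) hQ⟩
  | _ => exact h.elim

end RAM

/-! ### Stripping leaves and following cycles -/

namespace EdgeList

variable {n m : ℕ} (L : EdgeList n m 3)

/-- The number of the copy of vertex `v` in part `c`. -/
def node (v : Fin n) (c : Fin 3) : ℕ := v + n * c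

/-- The copies of the ends of an edge in its part. -/
def nsrc (e : Fin m) : ℕ := node (L.src e) (L.part e)

def ndst (e : Fin m) : ℕ := node (L.dst e) (L.part e)

def NInc (e : Fin m) (k : ℕ) : Prop := k = L.nsrc e ∨ k = L.ndst e

instance (e : Fin m) (k : ℕ) : Decidable (L.NInc e k) := by unfold NInc; infer_instance

/-- The edges of `al` at node `k`. -/
def star (al : Finset (Fin m)) (k : ℕ) : Finset (Fin m) := al.filter fun e => L.NInc e k

variable {L}

theorem mem_star {al : Finset (Fin m)} {k : ℕ} {e : Fin m} :
    e ∈ L.star al k ↔ e ∈ al ∧ L.NInc e k := by simp [star]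

theorem node_inj {v w : Fin n} {c d : Fin 3} : node v c = node w d ↔ v = w ∧ c = d := by
  constructor
  · intro h
    simp only [node] at h
    have hv := v.isLt
    have hw := w.isLt
    have h1 : (v + n * c : ℕ) % n = v := by rw [Nat.add_mul_mod_self_left, Nat.mod_eq_of_lt hv]
    have h2 : (w + n * d : ℕ) % n = w := by rw [Nat.add_mul_mod_self_left, Nat.mod_eq_of_lt hw]
    have h3 : v = w := Fin.ext (by rw [← h1, ← h2, h])
    subst h3
    refine ⟨rfl, Fin.ext (Nat.eq_of_mul_eq_mul_left (by omega : 0 < n) (by omega))⟩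
  · rintro ⟨rfl, rfl⟩; rfl

theorem nInc_node {e : Fin m} {v : Fin n} {c : Fin 3} :
    L.NInc e (node v c) ↔ L.Inc e v ∧ L.part e = c := by
  simp only [NInc, nsrc, ndst, node_inj, inc_iff]
  constructor
  · rintro (⟨h1, h2⟩ | ⟨h1, h2⟩)
    exacts [⟨Or.inl h1, h2.symm⟩, ⟨Or.inr h1, h2.symm⟩]
  · rintro ⟨h1 | h1, h2⟩
    exacts [Or.inl ⟨h1, h2.symm⟩, Or.inr ⟨h1, h2.symm⟩]

theorem node_lt (v : Fin n) (c : Fin 3) : node v c < n + n + n := by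
  have := v.isLt
  have hc : (c : ℕ) ≤ 2 := by omega
  have := Nat.mul_le_mul_left n hc
  simp only [node]; omega

theorem NInc.exists_node {e : Fin m} {k : ℕ} (h : L.NInc e k) :
    ∃ v, k = node v (L.part e) ∧ L.Inc e v := by
  rcases h with rfl | rfl
  exacts [⟨_, rfl, inc_src e⟩, ⟨_, rfl, inc_dst e⟩]

theorem NInc.lt {e : Fin m} {k : ℕ} (h : L.NInc e k) : k < n + n + n := by
  obtain ⟨v, rfl, -⟩ := h.exists_node
  exact node_lt _ _

theorem nsrc_lt (e : Fin m) : L.nsrc e < n + n + n := node_lt _ _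

theorem ndst_lt (e : Fin m) : L.ndst e < n + n + n := node_lt _ _

theorem IsSimple.nsrc_ne (hL : L.IsSimple) (e : Fin m) : L.nsrc e ≠ L.ndst e := fun h =>
  hL.ne e (node_inj.1 h).1

/-- The end of `e` opposite to `k`. -/
theorem IsSimple.nInc_opposite (hL : L.IsSimple) {e : Fin m} {k : ℕ} (h : L.NInc e k) :
    L.NInc e (L.nsrc e + L.ndst e - k) ∧ L.nsrc e + L.ndst e - k ≠ k ∧
    ∀ j, L.NInc e j ↔ j = k ∨ j = L.nsrc e + L.ndst e - k := by
  have := hL.nsrc_ne e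
  simp only [NInc] at *
  exact ⟨by omega, by omega, fun j => by omega⟩

theorem star_insert (al : Finset (Fin m)) (e : Fin m) (k : ℕ) :
    L.star (insert e al) k = if L.NInc e k then insert e (L.star al k) else L.star al k := by
  simp [star, Finset.filter_insert]

theorem star_erase (al : Finset (Fin m)) (e : Fin m) (k : ℕ) :
    L.star (al.erase e) k = (L.star al k).erase e := by
  simp [star, Finset.filter_erase]

/-- Every set of edges without leaves is contained in `al`. -/
def ContainsLeafless (L : EdgeList n m 3) (al : Finset (Fin m)) : Prop :=
  ∀ S : Finset (Fin m), (∀ k, (L.star S k).card ≠ 1) → S ⊆ al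

/-- A leafless set containing `e` would need a second edge at `k`, which `al` does not have. -/
theorem ContainsLeafless.erase {al : Finset (Fin m)} (h : ContainsLeafless L al) {e : Fin m}
    {k : ℕ} (hk : L.star al k = {e}) : ContainsLeafless L (al.erase e) := by
  intro S hS f hf
  refine Finset.mem_erase.2 ⟨?_, h S hS hf⟩
  rintro rfl
  refine hS k (Finset.card_eq_one.2 ⟨f, ?_⟩)
  refine Finset.Subset.antisymm ?_ ?_
  · rw [← hk]
    exact Finset.filter_subset_filter _ (h S hS)
  · rw [Finset.singleton_subset_iff, mem_star]
    have : f ∈ L.star al k := by rw [hk]; simp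
    exact ⟨hf, (mem_star.1 this).2⟩

/-- Leafless subgraphs of pseudoforests have degrees zero and two, which gives `two`. The edge set
of a cycle is leafless, so it is contained in `al`. -/
theorem ContainsLeafless.isCore {al : Finset (Fin m)} (h : ContainsLeafless L al)
    (hL : L.IsSimple) (hP : ∀ c, IsPseudoforest (L.gr (L.col c)))
    (hal : ∀ k, (L.star al k).card ≠ 1) : IsCore L al where
  simple := hL
  pseudoforest := hP
  two := by
    classical
    intro e he v hv
    set c := L.part e with hc
    have hps : IsPseudoforest (L.gr (↑al ∩ L.col c)) := (hP c).anti (gr_mono Set.inter_subset_right)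
    have hemem : e ∈ L.star al (node v c) := mem_star.2 ⟨he, nInc_node.2 ⟨hv, rfl⟩⟩
    -- Since the graph is simple, counting listed edges at a node is counting neighbours within the
    -- part.
    have hnb : ∀ u, ((L.gr (↑al ∩ L.col c)).neighborFinset u).card =
        (L.star al (node u c)).card := by
      intro u
      symm
      have hex : ∀ f ∈ L.star al (node u c), ∃ w, L.ed f = s(u, w) := fun f hf =>
        Sym2.mem_iff_exists.1 (nInc_node.1 (mem_star.1 hf).2).1
      choose w hw using hex
      refine Finset.card_bij w ?_ ?_ ?_
      · intro f hf
        rw [mem_neighborFinset]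
        exact (gr_adj hL).2 ⟨f, ⟨(mem_star.1 hf).1, (nInc_node.1 (mem_star.1 hf).2).2⟩, hw f hf⟩
      · intro f hf g hg hfg
        exact hL.inj (by rw [hw f hf, hw g hg, hfg])
      · intro x hx
        rw [mem_neighborFinset] at hx
        obtain ⟨f, hf, hfx⟩ := (gr_adj hL).1 hx
        have hfm : f ∈ L.star al (node u c) :=
          mem_star.2 ⟨hf.1, nInc_node.2 ⟨by rw [Inc, hfx]; simp, hf.2⟩⟩
        refine ⟨f, hfm, ?_⟩
        have := (hw f hfm).symm.trans hfx
        rw [Sym2.eq_iff] at this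
        rcases this with ⟨-, h1⟩ | ⟨h1, h2⟩
        · exact h1
        · exact h2.trans h1
    have h2 : (L.star al (node v c)).card ≤ 2 := by
      rw [← hnb, card_neighborFinset_eq_degree]
      refine hps.degree_le_two (fun u hu => ?_) v
      rw [← card_neighborFinset_eq_degree, hnb] at hu
      exact hal _ hu
    have h1 := hal (node v c)
    have h0 : 0 < (L.star al (node v c)).card := Finset.card_pos.2 ⟨e, hemem⟩
    obtain ⟨f, hf⟩ := Finset.card_eq_one.1
      (show ((L.star al (node v c)).erase e).card = 1 by
        rw [Finset.card_erase_of_mem hemem]; omega)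
    have hmem : ∀ g, g ∈ al → L.part g = c → L.Inc g v → g ≠ e → g = f := by
      intro g hg hgc hgv hge
      have : g ∈ (L.star al (node v c)).erase e :=
        Finset.mem_erase.2 ⟨hge, mem_star.2 ⟨hg, nInc_node.2 ⟨hgv, hgc⟩⟩⟩
      rw [hf] at this
      exact Finset.mem_singleton.1 this
    have hfm : f ∈ (L.star al (node v c)).erase e := by rw [hf]; simp
    rw [Finset.mem_erase, mem_star, nInc_node] at hfm
    refine ⟨f, hfm.2.1, hfm.1, hfm.2.2.2, hfm.2.2.1, fun g hg hgc hgv => ?_⟩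
    by_cases hge : g = e
    · exact Or.inl hge
    · exact Or.inr (hmem g hg hgc hgv hge)
  cycle := by
    classical
    intro c u p hp e he
    refine h (Finset.univ.filter fun f => L.ed f ∈ p.edges) (fun k hk => ?_) (by simpa using he)
    obtain ⟨f, hf⟩ := Finset.card_eq_one.1 hk
    have hfm : f ∈ L.star (Finset.univ.filter fun f => L.ed f ∈ p.edges) k := by rw [hf]; simp
    rw [mem_star, Finset.mem_filter] at hfm
    obtain ⟨⟨-, hfp⟩, hfk⟩ := hfm
    obtain ⟨v, rfl, hv⟩ := hfk.exists_node
    obtain ⟨g, hgf, hgp, hgv⟩ := exists_ne_mem_edges hL hp hfp hv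
    have hpart : ∀ f, L.ed f ∈ p.edges → L.part f = c := fun f hf =>
      (ed_mem_edgeSet_gr hL).1 (p.edges_subset_edgeSet hf)
    have : g ∈ L.star (Finset.univ.filter fun f => L.ed f ∈ p.edges) (node v (L.part f)) :=
      mem_star.2 ⟨by simpa using hgp, nInc_node.2 ⟨hgv, by rw [hpart g hgp, hpart f hfp]⟩⟩
    rw [hf] at this
    exact hgf (Finset.mem_singleton.1 this)

/-! ### Degrees and index sums at the nodes -/

/-- The sum of two residues modulo `m`. -/
def addMod (m a b : ℕ) : ℕ := if a + b < m then a + b else a + b - m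

/-- The value `b = m` must be allowed: an edge `e` is subtracted by adding `m - e`, which is `m` for
edge `0`. -/
theorem addMod_eq {m a b : ℕ} (ha : a < m) (hb : b ≤ m) : addMod m a b = (a + b) % m := by
  unfold addMod
  split_ifs with h
  · rw [Nat.mod_eq_of_lt h]
  · rw [Nat.mod_eq_sub_mod (by omega), Nat.mod_eq_of_lt (by omega)]

theorem addMod_add {e X : ℕ} (he : e < m) : addMod m (X % m) e = (e + X) % m := by
  rw [addMod_eq (Nat.mod_lt _ (by omega)) he.le, Nat.mod_add_mod, add_comm]

theorem addMod_sub {e X : ℕ} (he : e < m) : addMod m ((e + X) % m) (m - e) = X % m := by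
  rw [addMod_eq (Nat.mod_lt _ (by omega)) (by omega), Nat.mod_add_mod,
    show e + X + (m - e) = X + m by omega, Nat.add_mod_right]

/-- `d k` is the number and `σ k` the sum modulo `m` of the edges of `al` at node `k`. -/
structure Counts (L : EdgeList n m 3) (al : Finset (Fin m)) (d σ : ℕ → ℕ) : Prop where
  deg : ∀ k, d k = (L.star al k).card
  sum : ∀ k, σ k = (∑ e ∈ L.star al k, (e : ℕ)) % m

namespace Counts

theorem empty : Counts L ∅ (fun _ => 0) (fun _ => 0) :=
  ⟨fun k => by simp [star], fun k => by simp [star]⟩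

variable {al : Finset (Fin m)} {d σ : ℕ → ℕ} (h : Counts L al d σ)
include h

theorem sum_lt (e : Fin m) (k : ℕ) : σ k < m := by
  rw [h.sum]
  exact Nat.mod_lt _ (by have := e.isLt; omega)

theorem deg_le (k : ℕ) : d k ≤ m := by
  rw [h.deg]
  exact (Finset.card_le_univ _).trans (by simp)

theorem insert {e : Fin m} (he : e ∉ al) {d' σ' : ℕ → ℕ}
    (hd : ∀ k, d' k = if L.NInc e k then d k + 1 else d k)
    (hσ : ∀ k, σ' k = if L.NInc e k then addMod m (σ k) e else σ k) :
    Counts L (insert e al) d' σ' := by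
  have hes : ∀ k, e ∉ L.star al k := fun k hk => he (mem_star.1 hk).1
  constructor
  · intro k
    rw [hd, h.deg, star_insert]
    split_ifs
    · rw [Finset.card_insert_of_notMem (hes k)]
    · rfl
  · intro k
    rw [hσ, h.sum, star_insert]
    split_ifs
    · rw [Finset.sum_insert (hes k), addMod_add e.isLt]
    · rfl

theorem erase {e : Fin m} (he : e ∈ al) {d' σ' : ℕ → ℕ}
    (hd : ∀ k, d' k = if L.NInc e k then d k - 1 else d k)
    (hσ : ∀ k, σ' k = if L.NInc e k then addMod m (σ k) (m - e) else σ k) :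
    Counts L (al.erase e) d' σ' := by
  constructor
  · intro k
    rw [hd, h.deg, star_erase]
    split_ifs with hk
    · rw [Finset.card_erase_of_mem (mem_star.2 ⟨he, hk⟩)]
    · rw [Finset.erase_eq_of_notMem fun h => hk (mem_star.1 h).2]
  · intro k
    rw [hσ, h.sum, star_erase]
    split_ifs with hk
    · rw [← Finset.add_sum_erase _ _ (mem_star.2 ⟨he, hk⟩), addMod_sub e.isLt]
    · rw [Finset.erase_eq_of_notMem fun h => hk (mem_star.1 h).2]

/-- A sum with one term is the index itself, so the edge at a leaf is read off directly. -/
theorem star_eq_singleton {k : ℕ} (hk : d k = 1) :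
    ∃ e : Fin m, L.star al k = {e} ∧ σ k = e := by
  rw [h.deg, Finset.card_eq_one] at hk
  obtain ⟨e, he⟩ := hk
  exact ⟨e, he, by rw [h.sum, he, Finset.sum_singleton, Nat.mod_eq_of_lt e.isLt]⟩

/-- The other edge at a node of the core. -/
theorem other (hc : IsCore L al) {e : Fin m} (he : e ∈ al) {k : ℕ} (hk : L.NInc e k) :
    ∃ f : Fin m, addMod m (σ k) (m - e) = f ∧ f ≠ e ∧ L.star al k = {e, f} := by
  obtain ⟨v, rfl, hv⟩ := hk.exists_node
  obtain ⟨f, hf, hfe, hfp, hfv, hu⟩ := hc.two e he v hv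
  have hs : L.star al (node v (L.part e)) = {e, f} := by
    ext g
    rw [mem_star, nInc_node, Finset.mem_insert, Finset.mem_singleton]
    constructor
    · rintro ⟨h1, h2, h3⟩
      exact hu g h1 h3 h2
    · rintro (rfl | rfl)
      · exact ⟨he, hv, rfl⟩
      · exact ⟨hf, hfv, hfp⟩
  refine ⟨f, ?_, hfe, hs⟩
  rw [h.sum, hs, Finset.sum_pair hfe.symm, addMod_sub e.isLt, Nat.mod_eq_of_lt f.isLt]

end Counts

/-! ### Following a cycle until it closes -/

/-- The edges met while following a cycle: from node `k₀` to node `k`, where `e` is next. -/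
structure Trail (L : EdgeList n m 3) (al D : Finset (Fin m)) (e₀ : Fin m) (k₀ : ℕ) (e : Fin m)
    (k : ℕ) : Prop where
  conn : ∀ f ∈ D, L.Conn al e₀ f
  conn_next : L.Conn al e₀ e
  inc : L.NInc e k
  closed : e ∈ D → L.star al k ⊆ D
  even : ∀ j, ((L.star D j).card + (if j = k₀ then 1 else 0) + if j = k then 1 else 0) % 2 = 0

namespace Trail

variable {al D : Finset (Fin m)} {e₀ e : Fin m} {k₀ k : ℕ}

theorem start (e : Fin m) : Trail L al ∅ e (L.nsrc e) e (L.nsrc e) where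
  conn := by simp
  conn_next := .refl e
  inc := Or.inl rfl
  closed := by simp
  even := by intro j; simp only [star, Finset.filter_empty, Finset.card_empty]; split_ifs <;> rfl

theorem touch (he : e ∈ al) {f : Fin m} (hf : f ∈ al) {k : ℕ} (hek : L.NInc e k)
    (hfk : L.NInc f k) : L.Touch al e f := by
  obtain ⟨v, rfl, hv⟩ := hek.exists_node
  rw [nInc_node] at hfk
  exact ⟨he, hf, hfk.2.symm, v, hv, hfk.1⟩

/-- Passing along `e` changes the parity at its two ends, which are the old and the new current
node, so the correction moves from one to the other. -/
theorem step (hL : L.IsSimple) (h : Trail L al D e₀ k₀ e k) (he₀ : e₀ ∈ al) (heD : e ∉ D)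
    {f : Fin m} (hf : L.star al (L.nsrc e + L.ndst e - k) = {e, f}) :
    Trail L al (insert e D) e₀ k₀ f (L.nsrc e + L.ndst e - k) := by
  obtain ⟨h1, h2, h3⟩ := hL.nInc_opposite h.inc
  have hfm : f ∈ L.star al (L.nsrc e + L.ndst e - k) := by rw [hf]; simp
  have hea : e ∈ al := Conn.mem h.conn_next he₀
  constructor
  · intro g hg
    rcases Finset.mem_insert.1 hg with rfl | hg
    exacts [h.conn_next, h.conn g hg]
  · exact h.conn_next.trans (touch hea (mem_star.1 hfm).1 h1 (mem_star.1 hfm).2).conn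
  · exact (mem_star.1 hfm).2
  · intro hfD
    rw [hf, Finset.insert_subset_iff, Finset.singleton_subset_iff]
    exact ⟨Finset.mem_insert_self _ _, hfD⟩
  · intro j
    have := h.even j
    have he' : e ∉ L.star D j := fun h => heD (mem_star.1 h).1
    rw [star_insert]
    by_cases hj : L.NInc e j
    · rw [if_pos hj, Finset.card_insert_of_notMem he']
      rcases (h3 j).1 hj with rfl | rfl
      · rw [if_neg h2.symm]; rw [if_pos rfl] at this; omega
      · rw [if_pos rfl]; rw [if_neg h2] at this; omega
    · rw [if_neg hj]
      rw [h3, not_or] at hj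
      rw [if_neg hj.2]; rw [if_neg hj.1] at this; omega

/-- Both core edges at `k` have been met, so the parity condition forces `k = k₀` and then every
node has an even number of met edges. A node of the core has only two edges of its part, so one met
edge brings in the other, and the met edges are closed under `Touch`. -/
theorem finish (hc : IsCore L al) (h : Trail L al D e₀ k₀ e k) (he₀ : e₀ ∈ al) (heD : e ∈ D) :
    ∀ f, f ∈ D ↔ L.Conn al e₀ f := by
  have hDa : D ⊆ al := fun f hf => Conn.mem (h.conn f hf) he₀
  have hpair : ∀ f ∈ al, ∀ j, L.NInc f j → ∃ g, g ≠ f ∧ L.star al j = {f, g} := by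
    intro f hf j hj
    have hcounts : Counts L al (fun k => (L.star al k).card)
      fun k => (∑ e ∈ L.star al k, (e : ℕ)) % m := ⟨fun _ => rfl, fun _ => rfl⟩
    obtain ⟨g, -, h1, h2⟩ := hcounts.other hc hf hj
    exact ⟨g, h1, h2⟩
  have hsub : ∀ j, L.star D j ⊆ L.star al j := fun j => Finset.filter_subset_filter _ hDa
  have heven : ∀ j, (L.star D j).card % 2 = 0 := by
    obtain ⟨g, hg, hs⟩ := hpair e (hDa heD) k h.inc
    have : L.star D k = {e, g} := by
      rw [← hs]
      refine (hsub k).antisymm fun x hx => mem_star.2 ⟨h.closed heD hx, (mem_star.1 hx).2⟩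
    have hk := h.even k
    rw [this, Finset.card_pair hg.symm, if_pos rfl] at hk
    have hkk : k = k₀ := by
      by_contra hne
      rw [if_neg hne] at hk
      omega
    intro j
    have := h.even j
    rw [hkk] at this
    split_ifs at this <;> omega
  intro f
  refine ⟨h.conn f, fun hf => ?_⟩
  have he := (h.conn e heD).symm.trans hf
  clear hf
  induction he with
  | refl => exact heD
  | @tail f g _ ht ih =>
    obtain ⟨h1, h2, h3, v, h4, h5⟩ := ht
    have hfk : L.NInc f (node v (L.part f)) := nInc_node.2 ⟨h4, rfl⟩
    have hgk : L.NInc g (node v (L.part f)) := nInc_node.2 ⟨h5, h3.symm⟩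
    obtain ⟨x, hx, hs⟩ := hpair f h1 _ hfk
    have h0 : 0 < (L.star D (node v (L.part f))).card :=
      Finset.card_pos.2 ⟨f, mem_star.2 ⟨ih, hfk⟩⟩
    have h2' := heven (node v (L.part f))
    have heq : L.star D (node v (L.part f)) = L.star al (node v (L.part f)) :=
      Finset.eq_of_subset_of_card_le (hsub _) (by rw [hs, Finset.card_pair hx.symm]; omega)
    have : g ∈ L.star al (node v (L.part f)) := mem_star.2 ⟨h2, hgk⟩
    rw [← heq] at this
    exact (mem_star.1 this).1

end Trail

end EdgeList

/-! ### The initial stages of the program -/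

namespace RAM

theorem State.setReg_setReg (s : State) (x v w : ℕ) : (s.setReg x v).setReg x w = s.setReg x w := by
  simp [State.setReg]

theorem State.setArr_setArr (s : State) (a i v w : ℕ) :
    (s.setArr a i v).setArr a i w = s.setArr a i w := by
  simp [State.setArr]

/-- The states differ only in the registers of `R` and the arrays of `A`. -/
structure AgreeOff (R A : List ℕ) (s₀ s : State) : Prop where
  reg : ∀ x, x ∉ R → s.reg x = s₀.reg x
  arr : ∀ a, a ∉ A → s.arr a = s₀.arr a

namespace AgreeOff

variable {R A : List ℕ} {s₀ s s' : State}

theorem refl (s : State) : AgreeOff R A s s := ⟨fun _ _ => rfl, fun _ _ => rfl⟩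

theorem trans (h : AgreeOff R A s₀ s) (h' : AgreeOff R A s s') : AgreeOff R A s₀ s' :=
  ⟨fun x hx => (h'.reg x hx).trans (h.reg x hx), fun a ha => (h'.arr a ha).trans (h.arr a ha)⟩

theorem setReg (h : AgreeOff R A s₀ s) {x : ℕ} (hx : x ∈ R) (v : ℕ) :
    AgreeOff R A s₀ (s.setReg x v) := by
  refine ⟨fun y hy => ?_, h.arr⟩
  rw [State.setReg_reg, if_neg (by rintro rfl; exact hy hx), h.reg y hy]

theorem setArr (h : AgreeOff R A s₀ s) {a : ℕ} (ha : a ∈ A) (i v : ℕ) :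
    AgreeOff R A s₀ (s.setArr a i v) := by
  refine ⟨h.reg, fun b hb => ?_⟩
  rw [State.setArr_arr, if_neg (by rintro rfl; exact hb ha), h.arr b hb]

theorem mono (h : AgreeOff R A s₀ s) {R' A' : List ℕ} (hR : R ⊆ R') (hA : A ⊆ A') :
    AgreeOff R' A' s₀ s :=
  ⟨fun x hx => h.reg x fun h => hx (hR h), fun a ha => h.arr a fun h => ha (hA h)⟩

end AgreeOff

end RAM

open RAM

namespace EdgeList

/-- Arrays `12` and `13` become the identity. -/
def initEnds : Program :=
  .forLoop (.reg 0) (.seq (.put 12 (.reg 2) (.reg 2)) (.put 13 (.reg 2) (.reg 2)))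

/-- Adds register `b` modulo `m` to the entry of array `7` with index in register `a`. -/
def addSum (a b : ℕ) : Program :=
  .seq (.put 7 (.reg a) (.add (.get 7 (.reg a)) (.reg b)))
    (.ite (.lt (.get 7 (.reg a)) (.reg 1)) .skip
      (.put 7 (.reg a) (.sub (.get 7 (.reg a)) (.reg 1))))

/-- Puts the product of `n` and the part of the edge in register `2` into register `3`. -/
def nodeOffset : Program := .block
  [.set 3 (.const 0),
   .ite (.eq (.get 2 (.reg 2)) (.const 1)) (.set 3 (.reg 0)) .skip,
   .ite (.eq (.get 2 (.reg 2)) (.const 2)) (.set 3 (.add (.reg 0) (.reg 0))) .skip]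

/-- Copies the parts, computes the nodes of the edges, and counts and sums the edges at nodes. -/
def buildBody : Program := .block
  [.put 3 (.reg 2) (.get 2 (.reg 2)),
   nodeOffset,
   .set 4 (.add (.get 0 (.reg 2)) (.reg 3)),
   .set 5 (.add (.get 1 (.reg 2)) (.reg 3)),
   .put 4 (.reg 2) (.reg 4),
   .put 5 (.reg 2) (.reg 5),
   .put 6 (.reg 4) (.add (.get 6 (.reg 4)) (.const 1)),
   .put 6 (.reg 5) (.add (.get 6 (.reg 5)) (.const 1)),
   addSum 4 2,
   addSum 5 2]

def build : Program := .forLoop (.reg 1) buildBody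

/-- Removes the only edge at the node in register `3` and moves on to its other end. -/
def stripBody : Program := .block
  [.set 5 (.get 7 (.reg 3)),
   .put 8 (.reg 5) (.const 1),
   .set 4 (.sub (.add (.get 4 (.reg 5)) (.get 5 (.reg 5))) (.reg 3)),
   .set 6 (.sub (.reg 1) (.reg 5)),
   .put 6 (.reg 3) (.sub (.get 6 (.reg 3)) (.const 1)),
   .put 6 (.reg 4) (.sub (.get 6 (.reg 4)) (.const 1)),
   addSum 3 6,
   addSum 4 6,
   .set 3 (.reg 4)]

/-- Removing the edge at a leaf can create a new leaf only at its other end, which the inner loop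
visits next. One pass over the nodes therefore suffices, without a queue. -/
def strip : Program :=
  .forLoop (.add (.add (.reg 0) (.reg 0)) (.reg 0))
    (.seq (.set 3 (.reg 2)) (.while (.eq (.get 6 (.reg 3)) (.const 1)) stripBody))

/-- Replaces the edge in register `5` by the other edge at the node in register `6`. -/
def nextEdge : Program :=
  .seq (.set 5 (.add (.get 7 (.reg 6)) (.sub (.reg 1) (.reg 5))))
    (.ite (.lt (.reg 5) (.reg 1)) .skip (.set 5 (.sub (.reg 5) (.reg 1))))

def markBody : Program := .block
  [.put 9 (.reg 5) (.const 1),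
   .set 6 (.sub (.add (.get 4 (.reg 5)) (.get 5 (.reg 5))) (.reg 6)),
   nextEdge]

/-- Marks the cycle of the edge in register `2` as done. -/
def mark : Program := .block
  [.set 5 (.reg 2), .set 6 (.get 4 (.reg 2)),
   .while (.eq (.get 9 (.reg 5)) (.const 0)) markBody]

variable {n m W : ℕ} {L : EdgeList n m 3} {s : State}

theorem addSum_pre {a b : ℕ} {Q : State → Prop} (hm : s.reg 1 = m) (ha : s.reg a ≤ W)
    (hlt : s.arr 7 (s.reg a) < m) (hb : s.reg b ≤ m) (hW : m + m ≤ W)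
    (hQ : Q (s.setArr 7 (s.reg a) (addMod m (s.arr 7 (s.reg a)) (s.reg b)))) :
    (addSum a b).pre W Q s := by
  simp only [addSum, Program.pre, Expr.eval, Test.eval, State.setArr_reg, State.setArr_arr,
    if_true, Function.update_self, State.setArr_setArr, hm]
  unfold addMod at hQ
  refine ⟨ha, by omega, fun h => ?_, fun h => ⟨ha, by omega, ?_⟩⟩
  · rwa [if_pos h] at hQ
  · rwa [if_neg h] at hQ

theorem nextEdge_pre {Q : State → Prop} (hm : s.reg 1 = m)
    (hlt : s.arr 7 (s.reg 6) < m) (hW : m + m ≤ W)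
    (hQ : Q (s.setReg 5 (addMod m (s.arr 7 (s.reg 6)) (m - s.reg 5)))) :
    nextEdge.pre W Q s := by
  simp only [nextEdge, Program.pre, Expr.eval, Test.eval, State.setReg_reg,
    if_true, State.setReg_setReg, hm]
  unfold addMod at hQ
  refine ⟨by omega, fun h => ?_, fun h => ⟨by simp; omega, ?_⟩⟩
  · simp at h; rwa [if_pos h] at hQ
  · simp at h ⊢; rwa [if_neg (by omega)] at hQ

/-- The registers and arrays that hold the input. -/
structure HasInput (L : EdgeList n m 3) (s : State) : Prop where
  reg_zero : s.reg 0 = n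
  reg_one : s.reg 1 = m
  src : ∀ e : Fin m, s.arr 0 e = L.src e
  dst : ∀ e : Fin m, s.arr 1 e = L.dst e
  part : ∀ e : Fin m, s.arr 2 e = L.part e

/-- The arrays that hold the nodes of the edges. -/
structure HasNodes (L : EdgeList n m 3) (s : State) : Prop where
  src : ∀ e : Fin m, s.arr 4 e = L.nsrc e
  dst : ∀ e : Fin m, s.arr 5 e = L.ndst e

theorem HasInput.congr {R A : List ℕ} {s s' : State} (h : HasInput L s) (hs : AgreeOff R A s s')
    (hR : 0 ∉ R ∧ 1 ∉ R) (hA : 0 ∉ A ∧ 1 ∉ A ∧ 2 ∉ A) : HasInput L s' where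
  reg_zero := (hs.reg 0 hR.1).trans h.reg_zero
  reg_one := (hs.reg 1 hR.2).trans h.reg_one
  src := by rw [hs.arr 0 hA.1]; exact h.src
  dst := by rw [hs.arr 1 hA.2.1]; exact h.dst
  part := by rw [hs.arr 2 hA.2.2]; exact h.part

theorem HasNodes.congr {R A : List ℕ} {s s' : State} (h : HasNodes L s) (hs : AgreeOff R A s s')
    (hA : 4 ∉ A ∧ 5 ∉ A) : HasNodes L s' where
  src := by rw [hs.arr 4 hA.1]; exact h.src
  dst := by rw [hs.arr 5 hA.2]; exact h.dst

theorem initEnds_halts (hW : n ≤ W) (hn : s.reg 0 = n) (φ : ℕ) :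
    Halts W initEnds s (φ + (n + 1) * 15) fun ψ s' => ψ = φ ∧ AgreeOff [2] [12, 13] s s' ∧
      ∀ v : Fin n, s'.arr 12 v = v ∧ s'.arr 13 v = v := by
  refine (Halts.forLoop (c := 6) (N := n) (e := .reg 0) (φ := φ) (fun i ψ s' =>
    ψ = φ ∧ s'.reg 2 = i ∧
    AgreeOff [2] [12, 13] s s' ∧ ∀ v < i, s'.arr 12 v = v ∧ s'.arr 13 v = v) hW ?_ ?_ ?_).mono
    (by simp [Expr.cost]) ?_
  · rintro i ψ s' ⟨-, h2, h3, -⟩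
    exact ⟨h2, (h3.reg 0 (by simp)).trans hn⟩
  · rintro i ψ s' hi ⟨rfl, h2, h3, h4⟩
    refine (Program.pre.halts (Q := fun s' => s'.reg 2 = i ∧ AgreeOff [2] [12, 13] s s' ∧
      ∀ v < i + 1, s'.arr 12 v = v ∧ s'.arr 13 v = v) ?_ ψ).mono le_rfl ?_
    · simp only [Program.pre, Expr.eval, State.setArr_reg, h2]
      refine ⟨by omega, by omega, by omega, by omega, trivial,
        (h3.setArr (by simp) _ _).setArr (by simp) _ _, fun v hv => ?_⟩
      simp only [State.setArr_arr]
      by_cases hvi : v = i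
      · subst hvi; simp
      · simpa [hvi] using h4 v (by omega)
    · rintro φ' s'' ⟨rfl, h5, h6, h7⟩
      exact ⟨h5, rfl, by simp, h6.setReg (by simp) _, by simpa using h7⟩
  · exact ⟨rfl, by simp, (AgreeOff.refl s).setReg (by simp) _, by simp⟩
  · rintro ψ s' ⟨h1, -, h3, h4⟩
    exact ⟨h1, h3, fun v => h4 v v.isLt⟩

theorem nodeOffset_pre {e : Fin m} {Q : State → Prop} (h2 : s.reg 2 = e)
    (hp : s.arr 2 e = L.part e) (hn : s.reg 0 = n) (hW : 2 * n ≤ W)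
    (hQ : Q (s.setReg 3 (n * L.part e))) : nodeOffset.pre W Q s := by
  simp +decide only [nodeOffset, Program.block, Program.pre, Expr.eval, Test.eval, State.setReg_reg,
    State.setReg_arr, State.setReg_setReg, h2, hp, hn, reduceIte]
  have : ∀ c : Fin 3, c = 0 ∨ c = 1 ∨ c = 2 := by decide
  rcases this (L.part e) with hc | hc | hc <;> rw [hc] at hQ ⊢
  · simpa using hQ
  · simp only [Fin.val_one, mul_one] at hQ
    simpa using ⟨by omega, hQ⟩
  · simp only [Fin.val_two, mul_two] at hQ
    simpa using ⟨by omega, hQ⟩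

theorem build_halts (hL : L.IsSimple) (hs : HasInput L s) (h6 : s.arr 6 = fun _ => 0)
    (h7 : s.arr 7 = fun _ => 0) (hW : 3 * n + 2 * m ≤ W) (φ : ℕ) :
    Halts W build s (φ + (m + 1) * 100) fun ψ s' => ψ = φ ∧
      AgreeOff [2, 3, 4, 5] [3, 4, 5, 6, 7] s s' ∧ (∀ e : Fin m, s'.arr 3 e = L.part e) ∧
      HasNodes L s' ∧ Counts L Finset.univ (s'.arr 6) (s'.arr 7) := by
  refine (Halts.forLoop (c := 91) (N := m) (e := .reg 1) (φ := φ) (fun i ψ s' => ψ = φ ∧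
    s'.reg 2 = i ∧ AgreeOff [2, 3, 4, 5] [3, 4, 5, 6, 7] s s' ∧
    (∀ e : Fin m, e.val < i → s'.arr 3 e = L.part e ∧ s'.arr 4 e = L.nsrc e ∧
      s'.arr 5 e = L.ndst e) ∧
    Counts L (Finset.univ.filter fun e => e.val < i) (s'.arr 6) (s'.arr 7)) (by omega)
    ?_ ?_ ?_).mono (by simp [Expr.cost]) ?_
  · rintro i ψ s' ⟨-, h2, h3, -⟩
    exact ⟨h2, (h3.reg 1 (by simp)).trans hs.reg_one⟩
  · rintro i ψ s' hi ⟨rfl, h2, h3, h4, h5⟩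
    obtain ⟨e, rfl⟩ : ∃ e : Fin m, i = e := ⟨⟨i, hi⟩, rfl⟩
    have hs' := hs.congr h3 (by simp) (by simp)
    have hlt : ∀ {k}, s'.arr 7 k < m := fun {k} => h5.sum_lt e k
    have hb1 : L.nsrc e < n + n + n := nsrc_lt e
    have hb2 : L.ndst e < n + n + n := ndst_lt e
    -- The two ends are different nodes, so the updates at one leave the entries at the other
    -- unchanged.
    have hne := hL.nsrc_ne e
    have hd := h5.deg_le
    refine (Program.pre.halts (Q := fun s' => s'.reg 2 = e ∧
      AgreeOff [2, 3, 4, 5] [3, 4, 5, 6, 7] s s' ∧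
      (∀ f : Fin m, f.val < e + 1 → s'.arr 3 f = L.part f ∧ s'.arr 4 f = L.nsrc f ∧
        s'.arr 5 f = L.ndst f) ∧
      Counts L (Finset.univ.filter fun f => f.val < e.val + 1) (s'.arr 6) (s'.arr 7)) ?_ ψ).mono
      (by simp [buildBody, nodeOffset, addSum, Program.block, Program.bound, Expr.cost,
        Test.cost]) ?_
    · simp only [buildBody, Program.block, Program.pre, Expr.eval, h2, hs'.part]
      refine ⟨by omega, by omega, nodeOffset_pre (L := L) (e := e) (by simp [h2])
        (by simp [hs'.part])
        (by simp [hs'.reg_zero]) (by omega) ?_⟩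
      have e1 : (L.src e : ℕ) + n * L.part e = L.nsrc e := rfl
      have e2 : (L.dst e : ℕ) + n * L.part e = L.ndst e := rfl
      simp +decide only [State.setReg_reg, State.setReg_arr, State.setArr_reg, State.setArr_arr,
        h2, hs'.src, hs'.dst, reduceIte, e1, e2]
      refine ⟨by omega, by omega, by omega, by omega, by omega, by omega, by omega,
        (Nat.succ_le_succ (hd _)).trans (by omega), by omega,
        by rw [Function.update_of_ne hne.symm]; exact (Nat.succ_le_succ (hd _)).trans (by omega),
        addSum_pre (m := m) ?_ ?_ ?_ ?_ (by omega) (addSum_pre (m := m) ?_ ?_ ?_ ?_ (by omega) ?_)⟩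
      all_goals simp +decide only [State.setReg_reg, State.setReg_arr, State.setArr_reg,
        State.setArr_arr, h2, hs'.reg_one, hlt, reduceIte, Function.update_of_ne hne.symm]
      iterate 4 omega
      refine ⟨trivial, ?_, fun f hf => ?_, ?_⟩
      · repeat first
          | exact h3
          | refine AgreeOff.setArr ?_ (by decide) _ _
          | refine AgreeOff.setReg ?_ (by decide) _
      · by_cases hfe : f = e
        · subst hfe; simp
        · have hne' : (f : ℕ) ≠ e := fun h => hfe (Fin.ext h)
          rw [Function.update_of_ne hne', Function.update_of_ne hne', Function.update_of_ne hne']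
          exact h4 f (by omega)
      · have : (Finset.univ.filter fun f : Fin m => f.val < e.val + 1) =
            insert e (Finset.univ.filter fun f : Fin m => f.val < e.val) := by
          ext f
          simp only [Finset.mem_filter, Finset.mem_univ, true_and, Finset.mem_insert, Fin.ext_iff]
          omega
        rw [this]
        refine h5.insert (by simp) (fun k => ?_) (fun k => ?_)
        all_goals
          by_cases hk1 : k = L.nsrc e
          · subst hk1; simp [NInc, hne]
          · by_cases hk2 : k = L.ndst e
            · subst hk2; simp [NInc]
            · simp [NInc, hk1, hk2]
    · rintro φ' s'' ⟨rfl, h5, h6, h7, h8⟩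
      exact ⟨h5, rfl, by simp, h6.setReg (by simp) _, by simpa using h7, by simpa using h8⟩
  · refine ⟨rfl, by simp, (AgreeOff.refl s).setReg (by simp) _, by simp, ?_⟩
    simpa [h6, h7] using Counts.empty
  · rintro ψ s' ⟨h1, -, h3, h4, h5⟩
    exact ⟨h1, h3, fun e => (h4 e e.isLt).1, ⟨fun e => (h4 e e.isLt).2.1,
      fun e => (h4 e e.isLt).2.2⟩, by simpa using h5⟩

/-- Every surviving edge holds 100 units of fuel, which its removal spends. In the inner loop, the
current node is the only one already visited that may be a leaf. -/
theorem strip_halts (hL : L.IsSimple) (hs : HasInput L s) (hnodes : HasNodes L s)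
    (hcounts : Counts L Finset.univ (s.arr 6) (s.arr 7)) (h8 : s.arr 8 = fun _ => 0)
    (hW : 3 * n + 2 * m ≤ W) (φ : ℕ) :
    Halts W strip s (φ + m * 100 + (3 * n + 1) * 20) fun ψ s' => ψ = φ ∧
      AgreeOff [2, 3, 4, 5, 6] [6, 7, 8] s s' ∧ ∃ al : Finset (Fin m),
      (∀ e : Fin m, s'.arr 8 e = 0 ↔ e ∈ al) ∧ Counts L al (s'.arr 6) (s'.arr 7) ∧
      ContainsLeafless L al ∧ ∀ k, (L.star al k).card ≠ 1 := by
  refine (Halts.forLoop (c := 7) (N := 3 * n) (e := .add (.add (.reg 0) (.reg 0)) (.reg 0))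
    (φ := φ + m * 100)
    (fun i ψ s' => s'.reg 2 = i ∧ AgreeOff [2, 3, 4, 5, 6] [6, 7, 8] s s' ∧
      ∃ al : Finset (Fin m), ψ = φ + al.card * 100 ∧
      (∀ e : Fin m, s'.arr 8 e = 0 ↔ e ∈ al) ∧ Counts L al (s'.arr 6) (s'.arr 7) ∧
      ContainsLeafless L al ∧ ∀ k < i, (L.star al k).card ≠ 1) (by omega) ?_ ?_ ?_).mono
    (by simp [Expr.cost]) (fun _ _ h => h) |>.relax ?_
  · rintro i ψ s' ⟨h2, h3, -⟩
    refine ⟨h2, ?_⟩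
    simp only [Expr.eval, h3.reg 0 (by decide), hs.reg_zero]
    omega
  · rintro i ψ s' hi ⟨h2, h3, al, rfl, h4, h5, h6, h7⟩
    refine Halts.seq ⟨2, s'.setReg 3 i, φ + al.card * 100 + 5, ?_, by omega, ?_⟩
    · have := Exec.set (W := W) (s := s') (x := 3) (e := .reg 2) (by simp [Expr.eval, h2]; omega)
      simpa [Expr.eval, h2, Expr.cost] using this
    refine Halts.loop (fun ψ s' => s'.reg 2 = i ∧ AgreeOff [2, 3, 4, 5, 6] [6, 7, 8] s s' ∧
      ∃ al : Finset (Fin m), ψ = φ + al.card * 100 + 5 ∧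
      (∀ e : Fin m, s'.arr 8 e = 0 ↔ e ∈ al) ∧ Counts L al (s'.arr 6) (s'.arr 7) ∧
      ContainsLeafless L al ∧ ∀ k < i + 1, k ≠ s'.reg 3 → (L.star al k).card ≠ 1) _ ?_ ?_ _ _ ?_
    · clear! al s'
      rintro ψ s' ⟨h2, h3, al, rfl, h4, h5, h6, h7⟩ hb
      simp only [Test.eval, Expr.eval] at hb
      obtain ⟨e, he, hσ⟩ := h5.star_eq_singleton hb
      have hea : e ∈ al ∧ L.NInc e (s'.reg 3) := mem_star.1 (by rw [he]; simp)
      have hcard : al.card = (al.erase e).card + 1 := (Finset.card_erase_add_one hea.1).symm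
      have hs' := hs.congr h3 (by simp) (by simp)
      have hn' := hnodes.congr h3 (by simp)
      set u := s'.reg 3 with hu
      set w := L.nsrc e + L.ndst e - u with hw
      obtain ⟨k1, k2, k3⟩ := hL.nInc_opposite hea.2
      rw [← hw] at k1 k2 k3
      have hlt : ∀ {k}, s'.arr 7 k < m := fun {k} => h5.sum_lt e k
      have hd := h5.deg_le
      have hu' := hea.2.lt
      have hw' := k1.lt
      refine ⟨φ + (al.erase e).card * 100 + 100, by
        simp only [Test.cost, Expr.cost]; omega, ?_⟩
      refine (Program.pre.halts (Q := fun s' => s'.reg 2 = i ∧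
        AgreeOff [2, 3, 4, 5, 6] [6, 7, 8] s s' ∧ (∀ f : Fin m, s'.arr 8 f = 0 ↔ f ∈ al.erase e) ∧
        Counts L (al.erase e) (s'.arr 6) (s'.arr 7) ∧ s'.reg 3 = w)
        ?_ (φ + (al.erase e).card * 100 + 5)).mono
        (by simp [stripBody, addSum, Program.block, Program.bound, Expr.cost, Test.cost]; omega) ?_
      · simp +decide only [stripBody, Program.block, Program.pre, Expr.eval, State.setReg_reg,
          State.setReg_arr, State.setArr_reg, State.setArr_arr, reduceIte, ← hu, hσ, hn'.src,
          hn'.dst, ← hw, hs'.reg_one, Function.update_of_ne k2]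
        have := hd u
        have := hd w
        have := e.isLt
        refine ⟨by omega, by omega, by omega, by omega, by omega, by omega, by omega, by omega,
          by omega, addSum_pre (m := m) ?_ ?_ ?_ ?_ (by omega)
          (addSum_pre (m := m) ?_ ?_ ?_ ?_ (by omega) ?_)⟩
        all_goals simp +decide only [State.setReg_reg, State.setReg_arr, State.setArr_reg,
          State.setArr_arr, h2, hs'.reg_one, hlt, reduceIte, Function.update_of_ne k2, ← hu]
        iterate 4 omega
        refine ⟨by omega, trivial, ?_, fun f => ?_, ?_, trivial⟩
        · repeat first
            | exact h3
            | refine AgreeOff.setArr ?_ (by decide) _ _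
            | refine AgreeOff.setReg ?_ (by decide) _
        · by_cases hfe : f = e
          · subst hfe; simp
          · have hne' : (f : ℕ) ≠ e := fun h => hfe (Fin.ext h)
            rw [Function.update_of_ne hne', h4 f]
            simp [hfe]
        · refine h5.erase hea.1 (fun k => ?_) (fun k => ?_)
          all_goals
            rw [if_congr (k3 k) rfl rfl]
            by_cases hk1 : k = u
            · subst hk1; simp [k2.symm]
            · by_cases hk2 : k = w
              · subst hk2; simp
              · simp [hk1, hk2]
      · rintro _ s'' ⟨rfl, h8, h9, h10, h11, h12⟩
        refine ⟨h8, h9, _, rfl, h10, h11, h6.erase he, fun k hk hkw => ?_⟩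
        rw [h12] at hkw
        rw [star_erase]
        -- The node `u` has become empty, the new current node `w` is exempt, and no other node
        -- loses an edge.
        by_cases hku : k = u
        · rw [hku, he]; simp
        · have hek : e ∉ L.star al k := fun h => by
            rcases (k3 k).1 (mem_star.1 h).2 with h | h
            exacts [hku h, hkw h]
          rw [Finset.erase_eq_of_notMem hek]
          exact h7 k hk hku
    · clear! al s'
      rintro ψ s' ⟨h2, h3, al, rfl, h4, h5, h6, h7⟩ hb
      simp only [Test.eval, Expr.eval] at hb
      refine ⟨φ + al.card * 100, by simp only [Test.cost, Expr.cost]; omega, h2, by simp,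
        h3.setReg (by decide) _, al, rfl, h4, h5, h6, fun k hk => ?_⟩
      by_cases hk3 : k = s'.reg 3
      · rwa [hk3, ← h5.deg]
      · exact h7 k hk hk3
    · refine ⟨by simpa using h2, h3.setReg (by decide) _, al, rfl, h4, h5, h6, fun k hk hk3 => ?_⟩
      simp only [State.setReg_reg, reduceIte] at hk3
      exact h7 k (by omega)
  · refine ⟨by simp, (AgreeOff.refl s).setReg (by decide) _, Finset.univ, by simp, by simp [h8],
      by simpa using hcounts, fun S _ => Finset.subset_univ S, by simp⟩
  · rintro ψ s' ⟨h2, h3, al, rfl, h4, h5, h6, h7⟩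
    refine ⟨φ, by omega, rfl, h3, al, h4, h5, h6, fun k hk => ?_⟩
    -- Numbers from `3 * n` on are not nodes of edges, so the pass has covered all nodes.
    have : 0 < (L.star al k).card := by omega
    obtain ⟨e, he⟩ := Finset.card_pos.1 this
    exact h7 k (by have := (mem_star.1 he).2.lt; omega) hk

end EdgeList

/-! ### Marking a cycle as done -/

namespace EdgeList

variable {n m W : ℕ} {L : EdgeList n m 3} {s : State}

/-- The part of the memory that is fixed once the leaves have been stripped. -/
structure HasCore (L : EdgeList n m 3) (al : Finset (Fin m)) (s : State) : Prop where
  core : IsCore L al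
  input : HasInput L s
  nodes : HasNodes L s
  counts : Counts L al (s.arr 6) (s.arr 7)
  dead : ∀ e : Fin m, s.arr 8 e = 0 ↔ e ∈ al

theorem HasCore.congr {al : Finset (Fin m)} {R A : List ℕ} {s s' : State} (h : HasCore L al s)
    (hs : AgreeOff R A s s') (hR : 0 ∉ R ∧ 1 ∉ R)
    (hA : (0 ∉ A ∧ 1 ∉ A ∧ 2 ∉ A) ∧ (4 ∉ A ∧ 5 ∉ A) ∧ 6 ∉ A ∧ 7 ∉ A ∧ 8 ∉ A) :
    HasCore L al s' where
  core := h.core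
  input := h.input.congr hs hR hA.1
  nodes := h.nodes.congr hs hA.2.1
  counts := by rw [hs.arr 6 hA.2.2.1, hs.arr 7 hA.2.2.2.1]; exact h.counts
  dead := by rw [hs.arr 8 hA.2.2.2.2]; exact h.dead

theorem nextEdge_pre_of_core {al : Finset (Fin m)} (h : HasCore L al s) (hW : m + m ≤ W)
    {e : Fin m} (he : e ∈ al) (h5 : s.reg 5 = e) (h6 : L.NInc e (s.reg 6)) {Q : State → Prop}
    (hQ : ∀ f : Fin m, f ≠ e → L.star al (s.reg 6) = {e, f} → Q (s.setReg 5 f)) :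
    nextEdge.pre W Q s := by
  obtain ⟨f, h1, h2, h3⟩ := h.counts.other h.core he h6
  refine nextEdge_pre h.input.reg_one (h.counts.sum_lt e _) hW ?_
  rw [h5, h1]
  exact hQ f h2 h3

/-- Every unmarked edge holds 60 units of fuel, released when it is marked. By `hed` no edge of the
cycle is marked beforehand, so the first marked edge met was marked by this loop and the cycle has
closed. -/
theorem mark_halts {al : Finset (Fin m)} (h : HasCore L al s) (hW : 3 * n + 2 * m + 1 ≤ W)
    {done : Set (Fin m)} (hdone : ∀ f : Fin m, s.arr 9 f = 0 ↔ f ∉ done) {e : Fin m}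
    (he : e ∈ al) (hed : ∀ f, L.Conn al e f → f ∉ done) (h2 : s.reg 2 = e) (φ : ℕ) :
    Halts W mark s (φ + (doneᶜ).ncard * 60 + 11) fun ψ s' =>
      ψ = φ + ((done ∪ {f | L.Conn al e f})ᶜ).ncard * 60 ∧ AgreeOff [5, 6] [9] s s' ∧
      ∀ f : Fin m, s'.arr 9 f = 0 ↔ f ∉ done ∪ {f | L.Conn al e f} := by
  have he' := e.isLt
  have hns := nsrc_lt (L := L) e
  refine Halts.seq ⟨2, s.setReg 5 e, φ + (doneᶜ).ncard * 60 + 9, ?_, by omega, ?_⟩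
  · have := Exec.set (W := W) (s := s) (x := 5) (e := .reg 2) (by simp [Expr.eval, h2]; omega)
    simpa [Expr.eval, h2, Expr.cost] using this
  refine Halts.seq ⟨3, (s.setReg 5 e).setReg 6 (L.nsrc e), φ + (doneᶜ).ncard * 60 + 6,
    ?_, by omega, ?_⟩
  · have := Exec.set (W := W) (s := s.setReg 5 e) (x := 6) (e := .get 4 (.reg 2))
      (by simp [Expr.eval, h2, h.nodes.src]; omega)
    simpa [Expr.eval, h2, Expr.cost, h.nodes.src] using this
  refine Halts.seq ?_
  refine Halts.loop (fun ψ s' => AgreeOff [5, 6] [9] s s' ∧ ∃ (D : Finset (Fin m)) (f : Fin m),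
    ψ = φ + ((done ∪ D)ᶜ).ncard * 60 + 6 ∧ (∀ f : Fin m, s'.arr 9 f = 0 ↔ f ∉ done ∪ D) ∧
    s'.reg 5 = f ∧ Trail L al D e (L.nsrc e) f (s'.reg 6)) _ ?_ ?_ _ _ ?_
  · rintro ψ s' ⟨h3, D, f, rfl, h4, h5, h6⟩ hb
    simp only [Test.eval, Expr.eval, h5, h4, Set.mem_union, not_or, Finset.mem_coe] at hb
    have hfa : f ∈ al := Conn.mem h6.conn_next he
    have hs' := h.congr h3 (by decide) (by decide)
    have hcard : ((done ∪ D)ᶜ).ncard = ((done ∪ ↑(insert f D))ᶜ).ncard + 1 := by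
      have : (done ∪ ↑(insert f D))ᶜ = (done ∪ (D : Set (Fin m)))ᶜ \ {f} := by
        ext g
        simp only [Set.mem_compl_iff, Set.mem_union, Finset.coe_insert, Set.mem_insert_iff,
          Finset.mem_coe, Set.mem_sdiff, Set.mem_singleton_iff]
        tauto
      rw [this, Set.ncard_sdiff_singleton_add_one]
      simpa using hb
    obtain ⟨k1, k2, k3⟩ := h.core.simple.nInc_opposite h6.inc
    have k1' := k1.lt
    refine ⟨φ + ((done ∪ ↑(insert f D))ᶜ).ncard * 60 + 61, by
      simp only [Test.cost, Expr.cost]; omega, ?_⟩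
    have := f.isLt
    refine (Program.pre.halts (Q := fun s' => AgreeOff [5, 6] [9] s s' ∧ ∃ g : Fin m,
      (∀ f' : Fin m, s'.arr 9 f' = 0 ↔ f' ∉ done ∪ ↑(insert f D)) ∧ s'.reg 5 = g ∧
      Trail L al (insert f D) e (L.nsrc e) g (s'.reg 6)) ?_
      (φ + ((done ∪ ↑(insert f D))ᶜ).ncard * 60 + 6)).mono
      (by simp [markBody, nextEdge, Program.block, Program.bound, Expr.cost, Test.cost]; omega) ?_
    · simp +decide only [markBody, Program.block, Program.pre, Expr.eval, State.setArr_reg,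
        State.setArr_arr, reduceIte, h5, hs'.nodes.src, hs'.nodes.dst]
      have h7 : AgreeOff [5, 6] [9] s ((s'.setArr 9 f 1).setReg 6
        (L.nsrc f + L.ndst f - s'.reg 6)) := (h3.setArr (by decide) _ _).setReg (by decide) _
      refine ⟨by omega, by omega, by omega, nextEdge_pre_of_core
        (h.congr h7 (by decide) (by decide)) (by omega) hfa (by simp [h5]) (by simpa using k1) ?_⟩
      intro g hg hst
      simp only [State.setReg_reg, reduceIte] at hst
      refine ⟨h7.setReg (by decide) _, g, fun f' => ?_, by simp, ?_⟩
      · by_cases hff : f' = f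
        · subst hff; simp
        · have hne' : (f' : ℕ) ≠ f := fun h => hff (Fin.ext h)
          simp only [State.setReg_arr, State.setArr_arr, reduceIte]
          rw [Function.update_of_ne hne', h4]
          simp [hff]
      · simpa using h6.step h.core.simple he hb.2 hst
    · rintro _ s'' ⟨rfl, h7, g, h8, h9, h10⟩
      exact ⟨h7, insert f D, g, rfl, h8, h9, h10⟩
  · rintro ψ s' ⟨h3, D, f, rfl, h4, h5, h6⟩ hb
    simp only [Test.eval, Expr.eval, h5, h4, not_not] at hb
    have hfD : f ∈ D := by
      rcases hb with hb | hb
      · exact absurd hb (hed f h6.conn_next)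
      · exact hb
    have hD : (D : Set (Fin m)) = {f | L.Conn al e f} := by
      ext g
      exact h6.finish h.core he hfD g
    refine ⟨φ + ((done ∪ D)ᶜ).ncard * 60 + 1, by simp only [Test.cost, Expr.cost]; omega, ?_⟩
    rw [hD] at h4 ⊢
    exact ⟨1, s', _, .skip _, by omega, rfl, h3, h4⟩
  · refine ⟨((AgreeOff.refl s).setReg (by decide) _).setReg (by decide) _, ∅, e, by simp,
      by simpa using hdone, by simp, ?_⟩
    simpa using Trail.start e

end EdgeList

/-! ### Choosing an edge of a cycle -/

namespace EdgeList

/-- The current distribution of the chosen edges. -/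
structure Distribution (n m : ℕ) where
  M : Set (Fin m)
  LA : Set (Fin m)
  LB : Set (Fin m)
  FX : Set (Fin m)
  T : Set (Fin m)
  oA : Fin n → Fin n
  o4 : Fin n → Fin n

variable {n m W : ℕ} {L : EdgeList n m 3} {s : State} {al : Finset (Fin m)} {done : Set (Fin m)}
  {D : Distribution n m}

/-- `a` records for each vertex an edge of `S` at it, if there is one. -/
def Covers (L : EdgeList n m 3) (S : Set (Fin m)) (a : ℕ → ℕ) : Prop :=
  ∀ v : Fin n, (a v = 0 ∧ ∀ e ∈ S, ¬ L.Inc e v) ∨ ∃ e ∈ S, L.Inc e v ∧ a v = e + 1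

theorem Covers.insert {S : Set (Fin m)} {a : ℕ → ℕ} (h : Covers L S a) {f : Fin m} {x y : Fin n}
    (hf : L.ed f = s(x, y)) :
    Covers L (insert f S) (Function.update (Function.update a y (f + 1)) x (f + 1)) := by
  intro v
  by_cases hv : v = x ∨ v = y
  · refine Or.inr ⟨f, Or.inl rfl, by rw [Inc, hf]; simpa using hv, ?_⟩
    rcases hv with rfl | rfl
    · simp
    · simp [Function.update_apply]
  · rw [not_or] at hv
    have h1 : (v : ℕ) ≠ x := fun h => hv.1 (Fin.ext h)
    have h2 : (v : ℕ) ≠ y := fun h => hv.2 (Fin.ext h)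
    rw [Function.update_of_ne h1, Function.update_of_ne h2]
    rcases h v with ⟨h3, h4⟩ | ⟨e, h3, h4, h5⟩
    · refine Or.inl ⟨h3, ?_⟩
      rintro e (rfl | he) hev
      · rcases Inc.eq_or hf hev with h | h
        exacts [hv.1 h, hv.2 h]
      · exact h4 e he hev
    · exact Or.inr ⟨e, Or.inr h3, h4, h5⟩

theorem Covers.eq_zero {S : Set (Fin m)} {a : ℕ → ℕ} (h : Covers L S a) {v : Fin n}
    (hv : a v = 0) : ∀ e ∈ S, ¬ L.Inc e v := by
  rcases h v with h | ⟨e, -, -, h⟩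
  · exact h.2
  · omega

theorem Covers.ne_zero {S : Set (Fin m)} {a : ℕ → ℕ} (h : Covers L S a) {v : Fin n}
    (hv : a v ≠ 0) : ∃ e ∈ S, L.Inc e v ∧ a v = e + 1 := by
  rcases h v with h | h
  · exact absurd h.1 hv
  · exact h

/-- The memory holds the given distribution. -/
structure HasSplit (L : EdgeList n m 3) (al : Finset (Fin m)) (done : Set (Fin m))
    (D : Distribution n m) (s : State) : Prop where
  split : Split L al done D.M D.LA D.LB D.FX D.T D.oA D.o4
  covA : Covers L (D.M ∩ L.col 0) (s.arr 10)
  covB : Covers L (D.M ∩ L.col 1) (s.arr 11)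
  linkB : ∀ v : Fin n, s.arr 14 v = 0 ↔ ∀ e ∈ D.LB, ¬ L.Inc e v
  ends4 : ∀ v : Fin n, s.arr 12 v = D.o4 v
  endsA : ∀ v : Fin n, s.arr 13 v = D.oA v
  out : IsOutput L D.M D.LA D.LB D.FX fun e => s.arr 3 e

theorem HasSplit.congr {R A : List ℕ} {s s' : State} (h : HasSplit L al done D s)
    (hs : AgreeOff R A s s')
    (hA : 10 ∉ A ∧ 11 ∉ A ∧ 14 ∉ A ∧ 12 ∉ A ∧ 13 ∉ A ∧ 3 ∉ A) : HasSplit L al done D s' where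
  split := h.split
  covA := by rw [hs.arr 10 hA.1]; exact h.covA
  covB := by rw [hs.arr 11 hA.2.1]; exact h.covB
  linkB := by rw [hs.arr 14 hA.2.2.1]; exact h.linkB
  ends4 := by rw [hs.arr 12 hA.2.2.2.1]; exact h.ends4
  endsA := by rw [hs.arr 13 hA.2.2.2.2.1]; exact h.endsA
  out := by rw [hs.arr 3 hA.2.2.2.2.2]; exact h.out

open Classical in
theorem IsOutput.insert {M LA LB FX LA' LB' : Set (Fin m)} {out out' : Fin m → ℕ}
    (h : IsOutput L M LA LB FX out) {f : Fin m} (hout : ∀ e, e ≠ f → out' e = out e)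
    (hLA : ∀ e, e ≠ f → (e ∈ LA' ↔ e ∈ LA)) (hLB : ∀ e, e ≠ f → (e ∈ LB' ↔ e ∈ LB))
    (h0 : L.part f = 0 → out' f = 3) (h1 : L.part f = 1 → f ∉ FX ∧ out' f = 3)
    (h2 : L.part f = 2 → out' f = if f ∈ LA' then 0 else if f ∈ LB' then 1 else 3) :
    IsOutput L (insert f M) LA' LB' FX out' where
  keep e he := by
    rw [Set.mem_insert_iff, not_or] at he
    rw [hout e he.1, h.keep e he.2]
  zero := by
    rintro e ⟨rfl | he, hp⟩
    · exact h0 hp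
    · by_cases hef : e = f
      · exact hef ▸ h0 (hef ▸ hp)
      · rw [hout e hef, h.zero e ⟨he, hp⟩]
  one := by
    have key : L.part f = 1 → out' f = if f ∈ FX then 2 else 3 := fun hp => by
      rw [if_neg (h1 hp).1, (h1 hp).2]
    rintro e ⟨rfl | he, hp⟩
    · exact key hp
    · by_cases hef : e = f
      · subst hef; exact key hp
      · rw [hout e hef, h.one e ⟨he, hp⟩]
  two := by
    rintro e ⟨rfl | he, hp⟩
    · exact h2 hp
    · by_cases hef : e = f
      · subst hef; exact h2 hp
      · rw [hout e hef, h.two e ⟨he, hp⟩]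
        simp only [hLA e hef, hLB e hef]

/-- Needed for the one situation in which the output of an edge chosen earlier is revised: an edge
of part `1` moves from forest `3` to forest `2`. -/
theorem IsOutput.fix {M LA LB FX : Set (Fin m)} {out out' : Fin m → ℕ}
    (h : IsOutput L M LA LB FX out) {g : Fin m} (hg : g ∈ M ∩ L.col 1)
    (hout : ∀ e, e ≠ g → out' e = out e) (hg2 : out' g = 2) :
    IsOutput L M LA LB (Insert.insert g FX) out' := by
  have hpg : L.part g = 1 := hg.2
  constructor
  · intro e he
    rw [hout e (by rintro rfl; exact he hg.1), h.keep e he]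
  · intro e he
    have : L.part e = 0 := he.2
    rw [hout e (by rintro rfl; rw [hpg] at this; exact absurd this (by decide)), h.zero e he]
  · intro e he
    by_cases heg : e = g
    · subst heg
      rw [if_pos (Set.mem_insert _ _), hg2]
    · rw [hout e heg, h.one e he]
      by_cases hF : e ∈ FX <;> simp [hF, heg]
  · intro e he
    have : L.part e = 2 := he.2
    rw [hout e (by rintro rfl; rw [hpg] at this; exact absurd this (by decide)), h.two e he]

/-- Loads edge `e` of register `2`: its target `y`, its source, `e`, and the node of `y`. -/
def loadEdge : Program := .block
  [.set 3 (.get 1 (.reg 2)), .set 4 (.get 0 (.reg 2)), .set 5 (.reg 2), .set 6 (.get 5 (.reg 2))]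

/-- The same with source and target exchanged. -/
def loadEdgeRev : Program := .block
  [.set 3 (.get 0 (.reg 2)), .set 4 (.get 1 (.reg 2)), .set 5 (.reg 2), .set 6 (.get 4 (.reg 2))]

/-- If the loaded edge joins the ends of a path recorded in array `a`, loads the next edge. -/
def swing (a : ℕ) : Program :=
  .ite (.eq (.get a (.reg 3)) (.reg 4))
    (.seq nextEdge (.set 4 (.sub (.add (.get 0 (.reg 5)) (.get 1 (.reg 5))) (.reg 3)))) .skip

/-- Joins the paths that end in the ends of the loaded edge. -/
def merge (a : ℕ) : Program := .block
  [.set 7 (.get a (.reg 4)), .set 8 (.get a (.reg 3)), .put a (.reg 7) (.reg 8),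
   .put a (.reg 8) (.reg 7)]

/-- The registers hold the edge `f` from `w` to `y`, a core edge on the cycle of `e`. -/
structure Loaded (L : EdgeList n m 3) (al : Finset (Fin m)) (e : Fin m) (y w : Fin n) (f : Fin m)
    (s : State) : Prop where
  reg_y : s.reg 3 = y
  reg_w : s.reg 4 = w
  reg_f : s.reg 5 = f
  reg_k : s.reg 6 = node y (L.part e)
  conn : L.Conn al e f
  ed : L.ed f = s(w, y)

theorem loadEdge_pre (h : HasCore L al s) (hW : 3 * n + 2 * m + 1 ≤ W) {e : Fin m}
    (h2 : s.reg 2 = e) {Q : State → Prop}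
    (hQ : ∀ s', AgreeOff [3, 4, 5, 6] [] s s' → Loaded L al e (L.dst e) (L.src e) e s' → Q s') :
    loadEdge.pre W Q s := by
  have := (L.src e).isLt
  have := (L.dst e).isLt
  have := e.isLt
  have := ndst_lt (L := L) e
  simp +decide only [loadEdge, Program.block, Program.pre, Expr.eval, State.setReg_reg,
    State.setReg_arr, reduceIte, h2, h.input.src, h.input.dst, h.nodes.dst]
  refine ⟨by omega, by omega, by omega, by omega, hQ _ ?_ ?_⟩
  · repeat first
      | exact AgreeOff.refl s
      | refine AgreeOff.setReg ?_ (by decide) _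
  · exact ⟨by simp, by simp, by simp, by simp [ndst], .refl e, rfl⟩

theorem loadEdgeRev_pre (h : HasCore L al s) (hW : 3 * n + 2 * m + 1 ≤ W) {e : Fin m}
    (h2 : s.reg 2 = e) {Q : State → Prop}
    (hQ : ∀ s', AgreeOff [3, 4, 5, 6] [] s s' → Loaded L al e (L.src e) (L.dst e) e s' → Q s') :
    loadEdgeRev.pre W Q s := by
  have := (L.src e).isLt
  have := (L.dst e).isLt
  have := e.isLt
  have := nsrc_lt (L := L) e
  simp +decide only [loadEdgeRev, Program.block, Program.pre, Expr.eval, State.setReg_reg,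
    State.setReg_arr, reduceIte, h2, h.input.src, h.input.dst, h.nodes.src]
  refine ⟨by omega, by omega, by omega, by omega, hQ _ ?_ ?_⟩
  · repeat first
      | exact AgreeOff.refl s
      | refine AgreeOff.setReg ?_ (by decide) _
  · exact ⟨by simp, by simp, by simp, by simp [nsrc], .refl e, Sym2.eq_swap⟩

theorem Inc.exists_opposite {f : Fin m} {y : Fin n} (h : L.Inc f y) :
    ∃ w : Fin n, (L.src f : ℕ) + L.dst f - y = w ∧ L.ed f = s(w, y) := by
  rcases inc_iff.1 h with rfl | rfl
  · exact ⟨L.dst f, by omega, Sym2.eq_swap⟩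
  · exact ⟨L.src f, by omega, rfl⟩

/-- If `e` leads from `y` to `o y`, the other edge of the cycle at `y` leads elsewhere, since the
graph is simple. So the edge held at the end always passes the path test. -/
theorem swing_pre (h : HasCore L al s) (hW : 3 * n + 2 * m + 1 ≤ W) {e : Fin m} (he : e ∈ al)
    {y w : Fin n} (hl : Loaded L al e y w e s) {a : ℕ} {o : Fin n → Fin n}
    (ho : ∀ v : Fin n, s.arr a v = o v) {Q : State → Prop}
    (hQ : ∀ s' w' f, AgreeOff [4, 5] [] s s' → Loaded L al e y w' f s' → o y ≠ w' → Q s') :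
    (swing a).pre W Q s := by
  simp only [swing, Program.pre, Expr.eval, Test.eval, hl.reg_y, hl.reg_w, ho]
  constructor
  · intro hyw
    have hyw' : o y = w := Fin.ext hyw
    have hinc : L.Inc e y := by rw [Inc, hl.ed]; simp
    have hk : L.NInc e (s.reg 6) := by rw [hl.reg_k]; exact nInc_node.2 ⟨hinc, rfl⟩
    refine nextEdge_pre_of_core h (by omega) he hl.reg_f hk fun f hfe hst => ?_
    have hf : f ∈ L.star al (s.reg 6) := by rw [hst]; simp
    rw [mem_star] at hf
    have hfy : L.Inc f y := by
      have := hf.2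
      rw [hl.reg_k, nInc_node] at this
      exact this.1
    obtain ⟨w', hw', hed⟩ := hfy.exists_opposite
    have := w'.isLt
    simp +decide only [State.setReg_reg, State.setReg_arr, reduceIte, h.input.src, h.input.dst,
      hl.reg_y, hw']
    refine ⟨by omega, hQ _ w' f (((AgreeOff.refl s).setReg (by decide) _).setReg (by decide) _)
      ⟨by simp [hl.reg_y], by simp, by simp, by simp [hl.reg_k],
        (Trail.touch he hf.1 hk hf.2).conn, hed⟩ ?_⟩
    rw [hyw']
    rintro rfl
    exact hfe (h.core.simple.inj (hed.trans hl.ed.symm))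
  · intro hyw
    exact hQ s w e (AgreeOff.refl s) hl fun h => hyw (by rw [h])

theorem merge_pre (hW : n ≤ W) {e f : Fin m} {y w : Fin n} (hl : Loaded L al e y w f s) {a : ℕ}
    {o : Fin n → Fin n} (ho : ∀ v : Fin n, s.arr a v = o v) {Q : State → Prop}
    (hQ : ∀ s', AgreeOff [7, 8] [a] s s' → (∀ v : Fin n, s'.arr a v = mergeEnds o w y v) → Q s') :
    (merge a).pre W Q s := by
  have := (o w).isLt
  have := (o y).isLt
  simp +decide only [merge, Program.block, Program.pre, Expr.eval, State.setReg_reg,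
    State.setReg_arr, State.setArr_reg, reduceIte, hl.reg_y, hl.reg_w, ho]
  refine ⟨by omega, by omega, by omega, by omega, by omega, by omega, hQ _ ?_ fun v => ?_⟩
  · repeat first
      | exact AgreeOff.refl s
      | refine AgreeOff.setReg ?_ (by decide) _
      | refine AgreeOff.setArr ?_ (by simp) _ _
  · simp only [State.setArr_arr, State.setReg_arr, reduceIte, mergeEnds, Function.update_apply,
      Fin.val_inj, ho]
    split_ifs <;> rfl

end EdgeList

/-! ### The choice on a cycle of each kind -/

namespace EdgeList

/-- The choice on a cycle of part `0`. -/
def chooseA : Program := .block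
  [loadEdge, .put 10 (.reg 3) (.add (.reg 5) (.const 1)),
   .put 10 (.reg 4) (.add (.reg 5) (.const 1)), .put 3 (.reg 5) (.const 3), merge 12, merge 13]

/-- The choice on a cycle of part `1`. -/
def chooseB : Program := .block
  [loadEdge, swing 12, .put 11 (.reg 3) (.add (.reg 5) (.const 1)),
   .put 11 (.reg 4) (.add (.reg 5) (.const 1)), .put 3 (.reg 5) (.const 3), merge 12]

/-- Loads the edge such that `y` is not covered by the edges chosen from part `0`, if possible. -/
def loadUncovered : Program := .block
  [loadEdge, .ite (.eq (.get 10 (.reg 3)) (.const 0)) .skip loadEdgeRev]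

/-- Links or fixes a cycle both of whose loaded vertices are covered by part `1`. -/
def linkB : Program := .block
  [.set 7 (.sub (.get 11 (.reg 3)) (.const 1)),
   .set 8 (.sub (.add (.get 0 (.reg 7)) (.get 1 (.reg 7))) (.reg 3)),
   .ite (.eq (.get 14 (.reg 8)) (.const 0))
    (.block [.put 14 (.reg 3) (.const 1), .put 14 (.reg 4) (.const 1),
      .put 3 (.reg 5) (.const 1)])
    (.block [.put 3 (.reg 7) (.const 2), .put 3 (.reg 5) (.const 3)])]

/-- The choice on a cycle of part `2` with a vertex `y` that part `0` does not cover. -/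
def chooseUncovered : Program :=
  .ite (.eq (.get 11 (.reg 3)) (.const 0)) (.put 3 (.reg 5) (.const 3))
    (.seq (.ite (.eq (.get 11 (.reg 4)) (.const 0)) (swing 12) .skip)
      (.ite (.eq (.get 11 (.reg 4)) (.const 0)) (.seq (.put 3 (.reg 5) (.const 3)) (merge 12))
        linkB))

/-- The choice on a cycle of part `2` that is covered by part `0`. -/
def chooseCovered : Program := .block
  [loadEdge, swing 13, .put 3 (.reg 5) (.const 0), merge 13]

variable {n m W : ℕ} {L : EdgeList n m 3} {s : State} {al : Finset (Fin m)} {done : Set (Fin m)}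
  {D : Distribution n m}

/-- The effect of a choice on the cycle of edge `e`. -/
def Chosen (L : EdgeList n m 3) (al : Finset (Fin m)) (done : Set (Fin m)) (D : Distribution n m)
    (e : Fin m) (s s' : State) : Prop :=
  AgreeOff [3, 4, 5, 6, 7, 8] [3, 10, 11, 12, 13, 14] s s' ∧
  ∃ (f : Fin m) (D' : Distribution n m), L.Conn al e f ∧ D'.M = insert f D.M ∧
    HasSplit L al (done ∪ {g | L.Conn al e g}) D' s'

theorem Loaded.congr {e f : Fin m} {y w : Fin n} {R A : List ℕ} {s s' : State}
    (h : Loaded L al e y w f s) (hs : AgreeOff R A s s') (hR : 3 ∉ R ∧ 4 ∉ R ∧ 5 ∉ R ∧ 6 ∉ R) :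
    Loaded L al e y w f s' where
  reg_y := (hs.reg 3 hR.1).trans h.reg_y
  reg_w := (hs.reg 4 hR.2.1).trans h.reg_w
  reg_f := (hs.reg 5 hR.2.2.1).trans h.reg_f
  reg_k := (hs.reg 6 hR.2.2.2).trans h.reg_k
  conn := h.conn
  ed := h.ed

theorem update_fin {f : Fin m} {a : ℕ → ℕ} {v : ℕ} {e : Fin m} (h : e ≠ f) :
    Function.update a f v e = a e := Function.update_of_ne (fun h' => h (Fin.ext h')) _ _

theorem chooseA_pre (hc : HasCore L al s) (h : HasSplit L al done D s)
    (hW : 3 * n + 2 * m + 3 ≤ W) {e : Fin m} (h2 : s.reg 2 = e) (he : e ∈ al) (hed : e ∉ done)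
    (hp : L.part e = 0) (hM1 : D.M ∩ L.col 1 = ∅) (hM2 : D.M ∩ L.col 2 = ∅) :
    chooseA.pre W (Chosen L al done D e s) s := by
  have := e.isLt
  have := (L.src e).isLt
  have := (L.dst e).isLt
  simp only [chooseA, Program.block, Program.pre]
  refine loadEdge_pre hc (by omega) h2 fun s₁ a₁ l₁ => ?_
  simp only [Expr.eval, State.setArr_reg, l₁.reg_y, l₁.reg_w, l₁.reg_f]
  refine ⟨by omega, by omega, by omega, by omega, by omega, by omega, ?_⟩
  set s₂ := ((s₁.setArr 10 (L.dst e) (e + 1)).setArr 10 (L.src e) (e + 1)).setArr 3 e 3 with hs₂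
  have l₂ : Loaded L al e (L.dst e) (L.src e) e s₂ := ⟨l₁.1, l₁.2, l₁.3, l₁.4, l₁.5, l₁.6⟩
  refine merge_pre (by omega) l₂ (o := D.o4)
    (by simpa [hs₂, a₁.arr 12 (by decide)] using h.ends4) fun s₃ a₃ m₃ => ?_
  refine merge_pre (by omega) (l₂.congr a₃ (by decide)) (o := D.oA)
    (by rw [a₃.arr 13 (by decide)]; simpa [hs₂, a₁.arr 13 (by decide)] using h.endsA)
    fun s₄ a₄ m₄ => ?_
  have ag : AgreeOff [3, 4, 5, 6, 7, 8] [3, 10, 11, 12, 13, 14] s s₂ :=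
    (((a₁.mono (by decide) (by decide)).setArr (by decide) _ _).setArr (by decide) _ _).setArr
      (by decide) _ _
  refine ⟨(ag.trans (a₃.mono (by decide) (by decide))).trans (a₄.mono (by decide) (by decide)),
    e, ⟨insert e D.M, D.LA, D.LB, D.FX, D.T, mergeEnds D.oA (L.src e) (L.dst e),
      mergeEnds D.o4 (L.src e) (L.dst e)⟩, .refl e, rfl, ?_⟩
  have hFX : e ∉ D.FX := fun h' => by
    have : L.part e = 1 := (h.split.FX_sub h').2
    rw [hp] at this; exact absurd this (by decide)
  constructor
  · exact h.split.step_zero hc.core he hed hp hM1 hM2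
  · rw [a₄.arr 10 (by decide), a₃.arr 10 (by decide)]
    simp only [hs₂, State.setArr_arr]
    simp +decide only [reduceIte, a₁.arr 10 (by decide)]
    rw [insert_inter_col_self hp]
    exact h.covA.insert rfl
  · rw [a₄.arr 11 (by decide), a₃.arr 11 (by decide)]
    change Covers L (insert e D.M ∩ L.col 1) _
    rw [insert_inter_col_of_ne (by simp [hp])]
    simpa [hs₂, a₁.arr 11 (by decide)] using h.covB
  · rw [a₄.arr 14 (by decide), a₃.arr 14 (by decide)]
    simpa [hs₂, a₁.arr 14 (by decide)] using h.linkB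
  · rw [a₄.arr 12 (by decide)]; exact m₃
  · exact m₄
  · rw [a₄.arr 3 (by decide), a₃.arr 3 (by decide)]
    have h3 : s₂.arr 3 = Function.update (s.arr 3) e 3 := by simp [hs₂, a₁.arr 3 (by decide)]
    rw [h3]
    refine h.out.insert (fun f hf => update_fin hf) (fun _ _ => Iff.rfl) (fun _ _ => Iff.rfl)
      ?_ ?_ ?_
    · simp
    · simp [hp]
    · simp [hp]

theorem chooseB_pre (hc : HasCore L al s) (h : HasSplit L al done D s)
    (hW : 3 * n + 2 * m + 3 ≤ W) {e : Fin m} (h2 : s.reg 2 = e) (he : e ∈ al) (hed : e ∉ done)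
    (hp : L.part e = 1) (hM2 : D.M ∩ L.col 2 = ∅) :
    chooseB.pre W (Chosen L al done D e s) s := by
  simp only [chooseB, Program.block, Program.pre]
  refine loadEdge_pre hc (by omega) h2 fun s₁ a₁ l₁ => ?_
  refine swing_pre (hc.congr a₁ (by decide) (by decide)) (by omega) he l₁ (o := D.o4)
    (by rw [a₁.arr 12 (by decide)]; exact h.ends4) fun s₂ w f a₂ l₂ hne => ?_
  have a₂' : AgreeOff [3, 4, 5, 6] [] s s₂ := a₁.trans (a₂.mono (by decide) (by decide))
  clear a₁ l₁ a₂
  have := f.isLt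
  have := w.isLt
  have := (L.dst e).isLt
  have hpf : L.part f = 1 := l₂.conn.part_eq.trans hp
  simp only [Expr.eval, State.setArr_reg, l₂.reg_y, l₂.reg_w, l₂.reg_f]
  refine ⟨by omega, by omega, by omega, by omega, by omega, by omega, ?_⟩
  set s₃ := ((s₂.setArr 11 (L.dst e) (f + 1)).setArr 11 w (f + 1)).setArr 3 f 3 with hs₃
  have l₃ : Loaded L al e (L.dst e) w f s₃ := ⟨l₂.1, l₂.2, l₂.3, l₂.4, l₂.5, l₂.6⟩
  refine merge_pre (by omega) l₃ (o := D.o4)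
    (by simpa [hs₃, a₂'.arr 12 (by decide)] using h.ends4) fun s₄ a₄ m₄ => ?_
  have ag : AgreeOff [3, 4, 5, 6, 7, 8] [3, 10, 11, 12, 13, 14] s s₃ :=
    (((a₂'.mono (by decide) (by decide)).setArr (by decide) _ _).setArr (by decide) _ _).setArr
      (by decide) _ _
  refine ⟨ag.trans (a₄.mono (by decide) (by decide)),
    f, ⟨insert f D.M, D.LA, D.LB, D.FX, D.T, D.oA, mergeEnds D.o4 w (L.dst e)⟩, l₂.conn, rfl, ?_⟩
  have hFX : f ∉ D.FX := fun h' => h.split.trans.notMem hed l₂.conn (h.split.FX_sub h').1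
  constructor
  · exact h.split.step_one hc.core he hed hp hM2 l₂.conn l₂.ed hne
  · rw [a₄.arr 10 (by decide)]
    change Covers L (insert f D.M ∩ L.col 0) _
    rw [insert_inter_col_of_ne (by simp [hpf])]
    simpa [hs₃, a₂'.arr 10 (by decide)] using h.covA
  · rw [a₄.arr 11 (by decide)]
    simp only [hs₃, State.setArr_arr]
    simp +decide only [reduceIte, a₂'.arr 11 (by decide)]
    rw [insert_inter_col_self hpf]
    exact h.covB.insert l₂.ed
  · rw [a₄.arr 14 (by decide)]
    simpa [hs₃, a₂'.arr 14 (by decide)] using h.linkB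
  · exact m₄
  · rw [a₄.arr 13 (by decide)]
    simpa [hs₃, a₂'.arr 13 (by decide)] using h.endsA
  · rw [a₄.arr 3 (by decide)]
    have h3 : s₃.arr 3 = Function.update (s.arr 3) f 3 := by simp [hs₃, a₂'.arr 3 (by decide)]
    rw [h3]
    refine h.out.insert (fun f hf => update_fin hf) (fun _ _ => Iff.rfl) (fun _ _ => Iff.rfl)
      ?_ ?_ ?_
    · simp
    · simp [hFX]
    · simp [hpf]

theorem chooseCovered_pre (hc : HasCore L al s) (h : HasSplit L al done D s)
    (hW : 3 * n + 2 * m + 3 ≤ W) {e : Fin m} (h2 : s.reg 2 = e) (he : e ∈ al) (hed : e ∉ done)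
    (hp : L.part e = 2)
    (hcov : ∀ f, L.Conn al e f → ∀ v, L.Inc f v → ∃ g ∈ D.M ∩ L.col 0, L.Inc g v) :
    chooseCovered.pre W (Chosen L al done D e s) s := by
  simp only [chooseCovered, Program.block, Program.pre]
  refine loadEdge_pre hc (by omega) h2 fun s₁ a₁ l₁ => ?_
  refine swing_pre (hc.congr a₁ (by decide) (by decide)) (by omega) he l₁ (o := D.oA)
    (by rw [a₁.arr 13 (by decide)]; exact h.endsA) fun s₂ w f a₂ l₂ hne => ?_
  have a₂' : AgreeOff [3, 4, 5, 6] [] s s₂ := a₁.trans (a₂.mono (by decide) (by decide))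
  clear a₁ l₁ a₂
  have := f.isLt
  have hpf : L.part f = 2 := l₂.conn.part_eq.trans hp
  simp only [Expr.eval, l₂.reg_f]
  refine ⟨by omega, by omega, ?_⟩
  set s₃ := s₂.setArr 3 f 0 with hs₃
  have l₃ : Loaded L al e (L.dst e) w f s₃ := ⟨l₂.1, l₂.2, l₂.3, l₂.4, l₂.5, l₂.6⟩
  refine merge_pre (by omega) l₃ (o := D.oA)
    (by simpa [hs₃, a₂'.arr 13 (by decide)] using h.endsA) fun s₄ a₄ m₄ => ?_
  have ag : AgreeOff [3, 4, 5, 6, 7, 8] [3, 10, 11, 12, 13, 14] s s₃ :=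
    (a₂'.mono (by decide) (by decide)).setArr (by decide) _ _
  refine ⟨ag.trans (a₄.mono (by decide) (by decide)),
    f, ⟨insert f D.M, insert f D.LA, D.LB, D.FX, D.T, mergeEnds D.oA w (L.dst e), D.o4⟩,
    l₂.conn, rfl, ?_⟩
  constructor
  · exact h.split.step_linkA hc.core he hed hp l₂.conn (hcov f l₂.conn) l₂.ed hne
  · rw [a₄.arr 10 (by decide)]
    change Covers L (insert f D.M ∩ L.col 0) _
    rw [insert_inter_col_of_ne (by simp [hpf])]
    simpa [hs₃, a₂'.arr 10 (by decide)] using h.covA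
  · rw [a₄.arr 11 (by decide)]
    change Covers L (insert f D.M ∩ L.col 1) _
    rw [insert_inter_col_of_ne (by simp [hpf])]
    simpa [hs₃, a₂'.arr 11 (by decide)] using h.covB
  · rw [a₄.arr 14 (by decide)]
    simpa [hs₃, a₂'.arr 14 (by decide)] using h.linkB
  · rw [a₄.arr 12 (by decide)]
    simpa [hs₃, a₂'.arr 12 (by decide)] using h.ends4
  · exact m₄
  · rw [a₄.arr 3 (by decide)]
    have h3 : s₃.arr 3 = Function.update (s.arr 3) f 0 := by simp [hs₃, a₂'.arr 3 (by decide)]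
    rw [h3]
    refine h.out.insert (fun f hf => update_fin hf) (fun e he => by simp [he])
      (fun _ _ => Iff.rfl) ?_ ?_ ?_
    · simp [hpf]
    · simp [hpf]
    · simp

/-- The part of `HasSplit` that does not change when an edge `f` of part `2` is chosen. -/
theorem HasSplit.covers_insert (h : HasSplit L al done D s) {f : Fin m} (hpf : L.part f = 2)
    {s' : State} (h10 : s'.arr 10 = s.arr 10) (h11 : s'.arr 11 = s.arr 11) :
    Covers L (insert f D.M ∩ L.col 0) (s'.arr 10) ∧
      Covers L (insert f D.M ∩ L.col 1) (s'.arr 11) := by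
  rw [insert_inter_col_of_ne (by simp [hpf]), insert_inter_col_of_ne (by simp [hpf]), h10, h11]
  exact ⟨h.covA, h.covB⟩

/-- Array `11` gives the chosen edge `g` of part `1` at `y`, and array `14` tells whether its other
end `y'` already has an edge diverted to forest `1`. The answer decides between `Split.step_linkB`
and `Split.step_fix`. -/
theorem linkB_pre (hc : HasCore L al s) (h : HasSplit L al done D s)
    (hW : 3 * n + 2 * m + 3 ≤ W) {e f : Fin m} (he : e ∈ al) (hed : e ∉ done)
    (hp : L.part e = 2) {y w : Fin n} (hl : Loaded L al e y w f s) (h10 : s.arr 10 y = 0)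
    (hy : s.arr 11 y ≠ 0) (hw : s.arr 11 w ≠ 0) :
    linkB.pre W (Chosen L al done D e s) s := by
  have hpf : L.part f = 2 := hl.conn.part_eq.trans hp
  have hfM : f ∉ D.M := h.split.trans.notMem hed hl.conn
  obtain ⟨g, hg, hgy, hgv⟩ := h.covB.ne_zero hy
  obtain ⟨k, hk, hkw, -⟩ := h.covB.ne_zero hw
  obtain ⟨y', hy', hged⟩ := hgy.exists_opposite
  have hfg : f ≠ g := by rintro rfl; exact hfM hg.1
  have := f.isLt
  have := g.isLt
  have := y.isLt
  have := w.isLt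
  have := y'.isLt
  -- Covering arrays store the index plus one, so that zero means uncovered.
  have e1 : (g : ℕ) + 1 - 1 = g := rfl
  simp +decide only [linkB, Program.block, Program.pre, Expr.eval, Test.eval, hl.reg_y, hgv, e1,
    State.setReg_reg, State.setReg_arr, reduceIte, hc.input.src, hc.input.dst, hy',
    State.setArr_reg, hl.reg_f, hl.reg_w]
  refine ⟨by omega, by omega, fun h14 => ⟨by omega, by omega, by omega, by omega, by omega,
    by omega, ?_⟩, fun h14 => ⟨by omega, by omega, by omega, by omega, ?_⟩⟩
  · refine ⟨?_, f, ⟨insert f D.M, D.LA, insert f D.LB, D.FX, D.T, D.oA, D.o4⟩, hl.conn, rfl, ?_⟩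
    · repeat first
        | exact AgreeOff.refl s
        | refine AgreeOff.setReg ?_ (by decide) _
        | refine AgreeOff.setArr ?_ (by decide) _ _
    obtain ⟨c1, c2⟩ := h.covers_insert hpf
      (s' := ((((s.setReg 7 g).setReg 8 y').setArr 14 y 1).setArr 14 w 1).setArr 3 f 1)
      (by simp) (by simp)
    refine ⟨?_, c1, c2, fun v => ?_, by simpa using h.ends4, by simpa using h.endsA, ?_⟩
    · exact h.split.step_linkB hc.core he hed hp hl.conn (hl.ed.trans Sym2.eq_swap) hg
        (hged.trans Sym2.eq_swap) ((h.linkB y').1 h14) ⟨k, hk, hkw⟩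
    · simp +decide only [State.setArr_arr, State.setReg_arr, reduceIte, Function.update_apply,
        Fin.val_inj]
      by_cases hv : v = w ∨ v = y
      · have : L.Inc f v := by rw [Inc, hl.ed]; simpa using hv
        constructor
        · intro h0
          rcases hv with rfl | rfl <;> simp at h0
        · exact fun h0 => absurd this (h0 f (Or.inl rfl))
      · have hfv : ¬ L.Inc f v := fun h0 => hv (Inc.eq_or hl.ed h0)
        rw [not_or] at hv
        rw [if_neg hv.1, if_neg hv.2, h.linkB v]
        simp [hfv]
    · simp +decide only [State.setArr_arr, State.setReg_arr, reduceIte]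
      refine h.out.insert (fun f hf => update_fin hf) (fun _ _ => Iff.rfl)
        (fun e he => by simp [he]) ?_ ?_ ?_
      · simp [hpf]
      · simp [hpf]
      · have : f ∉ D.LA := fun h' => hfM (h.split.LA_sub h').1
        simp [this]
  · refine ⟨?_, f, ⟨insert f D.M, D.LA, D.LB, insert g D.FX, D.T, D.oA, D.o4⟩, hl.conn, rfl, ?_⟩
    · repeat first
        | exact AgreeOff.refl s
        | refine AgreeOff.setReg ?_ (by decide) _
        | refine AgreeOff.setArr ?_ (by decide) _ _
    obtain ⟨c1, c2⟩ := h.covers_insert hpf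
      (s' := (((s.setReg 7 g).setReg 8 y').setArr 3 g 2).setArr 3 f 3) (by simp) (by simp)
    refine ⟨?_, c1, c2, by simpa using h.linkB, by simpa using h.ends4, by simpa using h.endsA, ?_⟩
    · rw [h.linkB y'] at h14
      push Not at h14
      obtain ⟨x, hx, hxy⟩ := h14
      exact h.split.step_fix hc.core he hed hp hl.conn (by rw [Inc, hl.ed]; simp)
        (h.covA.eq_zero h10) hg (hged.trans Sym2.eq_swap) (h.split.LB_sub hx) hxy
    · simp +decide only [State.setArr_arr, State.setReg_arr, reduceIte]
      refine (h.out.fix hg (out' := fun e => Function.update (s.arr 3) g 2 e)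
        (fun f hf => update_fin hf) (by simp)).insert (fun f hf => update_fin hf)
        (fun _ _ => Iff.rfl) (fun _ _ => Iff.rfl) ?_ ?_ ?_
      · simp [hpf]
      · simp [hpf]
      · have h1 : f ∉ D.LA := fun h' => hfM (h.split.LA_sub h').1
        have h2 : f ∉ D.LB := fun h' => hfM (h.split.LB_sub h').1
        simp [h1, h2]

theorem Chosen.of_agreeOff {e : Fin m} {s s₁ s₂ : State} (h : Chosen L al done D e s₁ s₂)
    (hs : AgreeOff [3, 4, 5, 6] [] s s₁) : Chosen L al done D e s s₂ :=
  ⟨(hs.mono (by decide) (by decide)).trans h.1, h.2⟩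

theorem chooseUncovered_pre (hc : HasCore L al s) (h : HasSplit L al done D s)
    (hW : 3 * n + 2 * m + 3 ≤ W) {e : Fin m} (he : e ∈ al) (hed : e ∉ done)
    (hp : L.part e = 2) {y w : Fin n} (hl : Loaded L al e y w e s) (h10 : s.arr 10 y = 0) :
    chooseUncovered.pre W (Chosen L al done D e s) s := by
  have hM : ∀ f, L.Conn al e f → f ∉ D.M := fun f hf => h.split.trans.notMem hed hf
  have hnot : ∀ f, L.Conn al e f → f ∉ D.LA ∧ f ∉ D.LB := fun f hf =>
    ⟨fun h' => hM f hf (h.split.LA_sub h').1, fun h' => hM f hf (h.split.LB_sub h').1⟩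
  have := e.isLt
  simp only [chooseUncovered, Program.pre, Expr.eval, Test.eval, hl.reg_y, hl.reg_w, hl.reg_f]
  refine ⟨fun hy => ⟨by omega, by omega, (AgreeOff.refl s).setArr (by decide) _ _, e,
    ⟨insert e D.M, D.LA, D.LB, D.FX, D.T, D.oA, D.o4⟩, .refl e, rfl, ?_⟩, fun hy => ?_⟩
  · obtain ⟨c1, c2⟩ := h.covers_insert hp (s' := s.setArr 3 e 3) (by simp) (by simp)
    refine ⟨?_, c1, c2, by simpa using h.linkB, by simpa using h.ends4, by simpa using h.endsA, ?_⟩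
    · exact h.split.step_leaf hc.core he hed hp (.refl e) (by rw [Inc, hl.ed]; simp)
        (h.covA.eq_zero h10) (h.covB.eq_zero hy)
    · simp only [State.setArr_arr, reduceIte]
      refine h.out.insert (fun f hf => update_fin hf) (fun _ _ => Iff.rfl) (fun _ _ => Iff.rfl)
        ?_ ?_ ?_
      · simp
      · simp [hp]
      · simp [hnot e (.refl e)]
  -- Stated for any loaded edge at `y`: the swing may replace `e` by the other cycle edge, whose far
  -- end can be covered by part `1` even though `w` is not. This is why the program tests array `11`
  -- a second time. The path condition is needed only when the far end is uncovered.
  have key : ∀ s₁ w' f, AgreeOff [4, 5] [] s s₁ → Loaded L al e y w' f s₁ →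
      (s.arr 11 w' = 0 → D.o4 y ≠ w') →
      (Program.ite (.eq (.get 11 (.reg 4)) (.const 0))
        (.seq (.put 3 (.reg 5) (.const 3)) (merge 12)) linkB).pre W
        (Chosen L al done D e s) s₁ := by
    intro s₁ w' f a₁ l₁ hne
    have hpf : L.part f = 2 := l₁.conn.part_eq.trans hp
    have := f.isLt
    have a₁' : AgreeOff [3, 4, 5, 6] [] s s₁ := a₁.mono (by decide) (by decide)
    simp only [Program.pre, Expr.eval, Test.eval, l₁.reg_w, l₁.reg_f]
    rw [a₁.arr 11 (by decide)]
    refine ⟨fun hw => ⟨by omega, by omega, ?_⟩, fun hw => ?_⟩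
    · set s₂ := s₁.setArr 3 f 3 with hs₂
      have l₂ : Loaded L al e y w' f s₂ := ⟨l₁.1, l₁.2, l₁.3, l₁.4, l₁.5, l₁.6⟩
      refine merge_pre (by omega) l₂ (o := D.o4)
        (by simpa [hs₂, a₁.arr 12 (by decide)] using h.ends4) fun s₃ a₃ m₃ => ?_
      have ag : AgreeOff [3, 4, 5, 6, 7, 8] [3, 10, 11, 12, 13, 14] s s₂ :=
        (a₁.mono (by decide) (by decide)).setArr (by decide) _ _
      refine ⟨ag.trans (a₃.mono (by decide) (by decide)), f,
        ⟨insert f D.M, D.LA, D.LB, D.FX, insert f D.T, D.oA, mergeEnds D.o4 w' y⟩,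
        l₁.conn, rfl, ?_⟩
      obtain ⟨c1, c2⟩ := h.covers_insert hpf (s' := s₃)
        (by rw [a₃.arr 10 (by decide)]; simp [hs₂, a₁.arr 10 (by decide)])
        (by rw [a₃.arr 11 (by decide)]; simp [hs₂, a₁.arr 11 (by decide)])
      refine ⟨?_, c1, c2, ?_, m₃, ?_, ?_⟩
      · exact h.split.step_four hc.core he hed hp l₁.conn l₁.ed (Or.inr (h.covB.eq_zero hw))
          (Or.inl (h.covA.eq_zero h10)) (hne hw)
      · rw [a₃.arr 14 (by decide)]
        simpa [hs₂, a₁.arr 14 (by decide)] using h.linkB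
      · rw [a₃.arr 13 (by decide)]
        simpa [hs₂, a₁.arr 13 (by decide)] using h.endsA
      · rw [a₃.arr 3 (by decide)]
        have h3 : s₂.arr 3 = Function.update (s.arr 3) f 3 := by
          simp [hs₂, a₁.arr 3 (by decide)]
        rw [h3]
        refine h.out.insert (fun f hf => update_fin hf) (fun _ _ => Iff.rfl)
          (fun _ _ => Iff.rfl) ?_ ?_ ?_
        · simp
        · simp [hpf]
        · simp [hnot f l₁.conn]
    · refine Program.pre_mono (linkB_pre (hc.congr a₁ (by decide) (by decide))
        (h.congr a₁ (by decide)) hW he hed hp l₁ ?_ ?_ ?_) fun s' hs' => hs'.of_agreeOff a₁'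
      · rwa [a₁.arr 10 (by decide)]
      · rwa [a₁.arr 11 (by decide)]
      · rwa [a₁.arr 11 (by decide)]
  refine ⟨fun hw => ?_, fun hw => by
    simpa only [Program.pre, Expr.eval, Test.eval, hl.reg_w, hl.reg_f] using
      key s w e (AgreeOff.refl s) hl fun h => absurd h hw⟩
  exact swing_pre hc (by omega) he hl h.ends4 fun s₁ w' f a₁ l₁ hne =>
    key s₁ w' f a₁ l₁ fun _ => hne

end EdgeList

/-! ### The phases of the program -/

namespace EdgeList

/-- Runs `body` for every core edge of part `c` whose cycle is not done. -/
def phase (c : ℕ) (body : Program) : Program :=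
  .forLoop (.reg 1)
    (.ite (.and (.and (.eq (.get 8 (.reg 2)) (.const 0)) (.eq (.get 9 (.reg 2)) (.const 0)))
      (.eq (.get 2 (.reg 2)) (.const c))) body .skip)

def phaseA : Program := phase 0 (.seq chooseA mark)

def phaseB : Program := phase 1 (.seq chooseB mark)

def phaseUncovered : Program := phase 2 (.seq loadUncovered
  (.ite (.eq (.get 10 (.reg 3)) (.const 0)) (.seq chooseUncovered mark) .skip))

def phaseCovered : Program := phase 2 (.seq chooseCovered mark)

variable {n m W : ℕ} {L : EdgeList n m 3} {s : State} {al : Finset (Fin m)} {done : Set (Fin m)}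
  {D : Distribution n m}

/-- The invariant of the phases. -/
structure Inv (L : EdgeList n m 3) (al : Finset (Fin m)) (done : Set (Fin m))
    (D : Distribution n m) (s : State) : Prop where
  core : HasCore L al s
  marks : ∀ f : Fin m, s.arr 9 f = 0 ↔ f ∉ done
  split : HasSplit L al done D s

theorem Inv.congr {R : List ℕ} {s s' : State} (h : Inv L al done D s) (hs : AgreeOff R [] s s')
    (hR : 0 ∉ R ∧ 1 ∉ R) : Inv L al done D s' where
  core := h.core.congr hs hR (by decide)
  marks := by rw [hs.arr 9 (by decide)]; exact h.marks
  split := h.split.congr hs (by decide)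

/-- Here `J` is kept throughout the phase, while `G` is what the visit to an edge achieves for it
and later rounds preserve. The summand with `doneᶜ` is the fuel held for marking. -/
theorem phase_halts {c : Fin 3} {b : ℕ} {body : Program}
    {J : Set (Fin m) → Distribution n m → Prop}
    {G : Fin m → Set (Fin m) → Distribution n m → Prop} (hW : m ≤ W)
    (hskip : ∀ done D e, J done D → (e ∈ al → e ∉ done → L.part e ≠ c) → G e done D)
    (hbody : ∀ (s : State) done D (e : Fin m) φ, s.reg 2 = e → Inv L al done D s → J done D →
      e ∈ al →
      e ∉ done → L.part e = c → Halts W body s (φ + (doneᶜ).ncard * 60 + b) fun ψ s' =>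
        s'.reg 2 = e ∧ ∃ done' D', ψ = φ + (done'ᶜ).ncard * 60 ∧ Inv L al done' D' s' ∧
        J done' D' ∧ G e done' D' ∧ ∀ f, G f done D → G f done' D')
    (hs : Inv L al done D s) (hJ : J done D) (φ : ℕ) :
    Halts W (phase c body) s (φ + (doneᶜ).ncard * 60 + (m + 1) * (b + 30)) fun ψ s' =>
      ∃ done' D', ψ = φ + (done'ᶜ).ncard * 60 ∧ Inv L al done' D' s' ∧ J done' D' ∧
      ∀ e, G e done' D' := by
  refine (Halts.forLoop (c := b + 16) (N := m) (e := .reg 1) (φ := φ + (doneᶜ).ncard * 60)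
    (fun i ψ s => s.reg 2 = i ∧ ∃ done D, ψ = φ + (doneᶜ).ncard * 60 ∧ Inv L al done D s ∧
      J done D ∧ ∀ e : Fin m, e.val < i → G e done D) hW ?_ ?_ ?_).mono
    (Nat.add_le_add_left (Nat.mul_le_mul_left _ (by simp only [Expr.cost]; omega)) _) ?_
  · rintro i ψ s ⟨h2, done, D, -, h3, -⟩
    exact ⟨h2, h3.core.input.reg_one⟩
  · clear hs hJ
    rintro i ψ s hi ⟨h2, done, D, rfl, h3, h4, h5⟩
    obtain ⟨e, rfl⟩ : ∃ e : Fin m, i = e := ⟨⟨i, hi⟩, rfl⟩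
    set B : Test := .and (.and (.eq (.get 8 (.reg 2)) (.const 0))
      (.eq (.get 9 (.reg 2)) (.const 0)))
      (.eq (.get 2 (.reg 2)) (.const c)) with hB
    have hcost : B.cost = 14 := rfl
    have hev : B.eval s ↔ (e ∈ al ∧ e ∉ done) ∧ L.part e = c := by
      simp only [hB, Test.eval, Expr.eval, h2, h3.core.dead, h3.marks, h3.core.input.part,
        Fin.val_inj]
    by_cases hb : B.eval s
    · obtain ⟨⟨h6, h7⟩, h8⟩ := hev.1 hb
      obtain ⟨t, s', φ', x1, x2, x3, done', D', rfl, x4, x5, x6, x7⟩ :=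
        hbody s done D e φ h2 h3 h4 h6 h7 h8
      refine ⟨_, s', _, .ite_true hb x1, ?_, x3, by simp, done', D', rfl,
        x4.congr ((AgreeOff.refl _).setReg (R := [2]) (by simp) _) (by simp), x5, fun f hf => ?_⟩
      · rw [hcost]; omega
      · by_cases hfe : f = e
        · exact hfe ▸ x6
        · exact x7 f (h5 f (by have : f.val ≠ e.val := fun h => hfe (Fin.ext h); omega))
    · refine ⟨_, s, _, .ite_false hb (.skip s), ?_, h2, by simp, done, D, rfl,
        h3.congr ((AgreeOff.refl _).setReg (R := [2]) (by simp) _) (by simp), h4, fun f hf => ?_⟩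
      · rw [hcost]; omega
      · by_cases hfe : f = e
        · rw [hfe]
          refine hskip _ _ _ h4 fun h6 h7 h8 => hb (hev.2 ⟨⟨h6, h7⟩, h8⟩)
        · exact h5 f (by have : f.val ≠ e.val := fun h => hfe (Fin.ext h); omega)
  · exact ⟨by simp, done, D, rfl,
      hs.congr ((AgreeOff.refl _).setReg (R := [2]) (by simp) _) (by simp), hJ, by simp⟩
  · rintro ψ s ⟨-, done, D, h1, h2, h3, h4⟩
    exact ⟨done, D, h1, h2, h3, fun e => h4 e e.isLt⟩

/-- A choice followed by marking its cycle. -/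
theorem choose_mark_halts (h : Inv L al done D s) (hW : 3 * n + 2 * m + 3 ≤ W) {e : Fin m}
    (h2 : s.reg 2 = e) (he : e ∈ al) (hed : e ∉ done) {choose : Program}
    (hpre : choose.pre W (Chosen L al done D e s) s) (φ : ℕ) :
    Halts W (.seq choose mark) s (φ + (doneᶜ).ncard * 60 + (choose.bound + 11)) fun ψ s' =>
      s'.reg 2 = e ∧ ∃ f D', ψ = φ + ((done ∪ {f | L.Conn al e f})ᶜ).ncard * 60 ∧
        Inv L al (done ∪ {f | L.Conn al e f}) D' s' ∧ L.Conn al e f ∧ D'.M = insert f D.M := by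
  refine Halts.seq ((hpre.halts (φ + (doneᶜ).ncard * 60 + 11)).mono (by omega) ?_)
  rintro _ s₁ ⟨rfl, a₁, f, D', hf, hM, hsp⟩
  have hr : s₁.reg 2 = e := (a₁.reg 2 (by decide)).trans h2
  refine (mark_halts (h.core.congr a₁ (by decide) (by decide)) (by omega) (done := done)
    (by rw [a₁.arr 9 (by decide)]; exact h.marks) he
    (fun f hf hfd => hed (h.split.split.trans.closed' hfd hf.symm)) hr φ).mono le_rfl ?_
  rintro ψ s₂ ⟨rfl, a₂, hd⟩
  exact ⟨(a₂.reg 2 (by decide)).trans hr, f, D', rfl,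
    ⟨(h.core.congr a₁ (by decide) (by decide)).congr a₂ (by decide) (by decide), hd,
      hsp.congr a₂ (by decide)⟩, hf, hM⟩

/-- The core edges of part `c` are done. -/
def DonePart (L : EdgeList n m 3) (al : Finset (Fin m)) (c : Fin 3) (e : Fin m)
    (done : Set (Fin m)) : Prop := e ∈ al → L.part e = c → e ∈ done

theorem phaseA_halts (hW : 3 * n + 2 * m + 3 ≤ W) (hs : Inv L al done D s)
    (h1 : D.M ∩ L.col 1 = ∅) (h2 : D.M ∩ L.col 2 = ∅) (φ : ℕ) :
    Halts W phaseA s (φ + (doneᶜ).ncard * 60 + (m + 1) * 200) fun ψ s' =>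
      ∃ done' D', ψ = φ + (done'ᶜ).ncard * 60 ∧ Inv L al done' D' s' ∧ D'.M ∩ L.col 2 = ∅ ∧
      ∀ e, DonePart L al 0 e done' := by
  refine (phase_halts (c := 0) (b := 170) (J := fun _ D => D.M ∩ L.col 1 = ∅ ∧ D.M ∩ L.col 2 = ∅)
    (G := fun e done _ => DonePart L al 0 e done) (by omega) ?_ ?_ hs ⟨h1, h2⟩ φ).mono le_rfl ?_
  · intro done D e _ h he hp
    by_contra hed
    exact h he hed hp
  · intro s done D e φ h2 hs hJ he hed hp
    refine (choose_mark_halts hs hW h2 he hed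
      (chooseA_pre hs.core hs.split hW h2 he hed hp hJ.1 hJ.2) φ).mono ?_ ?_
    · simp [chooseA, loadEdge, merge, Program.block, Program.bound, Expr.cost]
    · rintro ψ s' ⟨x1, f, D', rfl, x2, x3, x4⟩
      have hpf := x3.part_eq.trans hp
      refine ⟨x1, _, D', rfl, x2, ⟨?_, ?_⟩, fun _ _ => Or.inr (.refl e),
        fun g hg h1 h2 => Or.inl (hg h1 h2)⟩
      · rw [x4, insert_inter_col_of_ne (by simp [hpf])]; exact hJ.1
      · rw [x4, insert_inter_col_of_ne (by simp [hpf])]; exact hJ.2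
  · rintro ψ s' ⟨done', D', h3, h4, h5, h6⟩
    exact ⟨done', D', h3, h4, h5.2, h6⟩

theorem phaseB_halts (hW : 3 * n + 2 * m + 3 ≤ W) (hs : Inv L al done D s)
    (h2 : D.M ∩ L.col 2 = ∅) (h0 : ∀ e, DonePart L al 0 e done) (φ : ℕ) :
    Halts W phaseB s (φ + (doneᶜ).ncard * 60 + (m + 1) * 200) fun ψ s' =>
      ∃ done' D', ψ = φ + (done'ᶜ).ncard * 60 ∧ Inv L al done' D' s' ∧
      (∀ e, DonePart L al 0 e done') ∧ ∀ e, DonePart L al 1 e done' := by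
  refine (phase_halts (c := 1) (b := 170)
    (J := fun done D => D.M ∩ L.col 2 = ∅ ∧ ∀ e, DonePart L al 0 e done)
    (G := fun e done _ => DonePart L al 1 e done) (by omega) ?_ ?_ hs ⟨h2, h0⟩ φ).mono le_rfl ?_
  · intro done D e _ h he hp
    by_contra hed
    exact h he hed hp
  · intro s done D e φ h2 hs hJ he hed hp
    refine (choose_mark_halts hs hW h2 he hed
      (chooseB_pre hs.core hs.split hW h2 he hed hp hJ.1) φ).mono ?_ ?_
    · simp [chooseB, loadEdge, swing, nextEdge, merge, Program.block, Program.bound, Expr.cost,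
        Test.cost]
    · rintro ψ s' ⟨x1, f, D', rfl, x2, x3, x4⟩
      have hpf := x3.part_eq.trans hp
      refine ⟨x1, _, D', rfl, x2, ⟨?_, fun g h1 h2 => Or.inl (hJ.2 g h1 h2)⟩,
        fun _ _ => Or.inr (.refl e), fun g hg h1 h2 => Or.inl (hg h1 h2)⟩
      rw [x4, insert_inter_col_of_ne (by simp [hpf])]; exact hJ.1
  · rintro ψ s' ⟨done', D', h3, h4, h5, h6⟩
    exact ⟨done', D', h3, h4, h5.2, h6⟩

/-- Both ends of `e` are covered by edges chosen from part `0`. -/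
def CoveredA (L : EdgeList n m 3) (D : Distribution n m) (e : Fin m) : Prop :=
  ∀ v, L.Inc e v → ∃ g ∈ D.M ∩ L.col 0, L.Inc g v

theorem CoveredA.mono {D' : Distribution n m} {e f : Fin m} (h : CoveredA L D e)
    (hM : D'.M = insert f D.M) : CoveredA L D' e := by
  intro v hv
  obtain ⟨g, hg, hgv⟩ := h v hv
  exact ⟨g, ⟨hM ▸ Or.inr hg.1, hg.2⟩, hgv⟩

/-- The source is tried only after the target proved to be covered, so a covered `y` means that both
ends are covered. -/
theorem loadUncovered_pre (hs : Inv L al done D s) (hW : 3 * n + 2 * m + 3 ≤ W) {e : Fin m}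
    (h2 : s.reg 2 = e) {Q : State → Prop}
    (hQ : ∀ s' y w, AgreeOff [3, 4, 5, 6] [] s s' → Loaded L al e y w e s' →
      (s.arr 10 y ≠ 0 → CoveredA L D e) → Q s') : loadUncovered.pre W Q s := by
  simp only [loadUncovered, Program.block, Program.pre]
  refine loadEdge_pre hs.core (by omega) h2 fun s₁ a₁ l₁ => ?_
  simp only [Test.eval, Expr.eval, l₁.reg_y]
  rw [a₁.arr 10 (by decide)]
  refine ⟨fun h => hQ s₁ _ _ a₁ l₁ fun h' => absurd h h', fun h => ?_⟩
  refine loadEdgeRev_pre (hs.core.congr a₁ (by decide) (by decide)) (by omega)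
    ((a₁.reg 2 (by decide)).trans h2) fun s₂ a₂ l₂ => hQ s₂ _ _ (a₁.trans a₂) l₂ fun h' v hv => ?_
  obtain ⟨f, hf, hfv, -⟩ := hs.split.covA.ne_zero h
  obtain ⟨g, hg, hgv, -⟩ := hs.split.covA.ne_zero h'
  rcases inc_iff.1 hv with rfl | rfl
  exacts [⟨g, hg, hgv⟩, ⟨f, hf, hfv⟩]

/-- A cycle is skipped only by edges with both ends covered by part `0`. If a cycle stays undone,
this holds for all its edges, hence for all its vertices; coverage persists because chosen edges are
never dropped from `M`. -/
theorem phaseUncovered_halts (hW : 3 * n + 2 * m + 3 ≤ W) (hs : Inv L al done D s)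
    (h0 : ∀ e, DonePart L al 0 e done) (h1 : ∀ e, DonePart L al 1 e done) (φ : ℕ) :
    Halts W phaseUncovered s (φ + (doneᶜ).ncard * 60 + (m + 1) * 300) fun ψ s' =>
      ∃ done' D', ψ = φ + (done'ᶜ).ncard * 60 ∧ Inv L al done' D' s' ∧
      (∀ e, DonePart L al 0 e done') ∧ (∀ e, DonePart L al 1 e done') ∧
      ∀ e ∈ al, L.part e = 2 → e ∉ done' → CoveredA L D' e := by
  refine (phase_halts (c := 2) (b := 270)
    (J := fun done D => (∀ e, DonePart L al 0 e done) ∧ ∀ e, DonePart L al 1 e done)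
    (G := fun e done D => e ∈ al → L.part e = 2 → e ∉ done → CoveredA L D e)
    (by omega) ?_ ?_ hs ⟨h0, h1⟩ φ).mono le_rfl ?_
  · intro done D e _ h he hp hed
    exact absurd hp (h he hed)
  · intro s done D e φ h2 hs hJ he hed hp
    refine Halts.seq ((Program.pre.halts (Q := fun s' => ∃ y w, AgreeOff [3, 4, 5, 6] [] s s' ∧
      Loaded L al e y w e s' ∧ (s.arr 10 y ≠ 0 → CoveredA L D e)) (loadUncovered_pre hs hW h2
        fun s' y w h1 h2 h3 => ⟨y, w, h1, h2, h3⟩) (φ + (doneᶜ).ncard * 60 + 230)).mono ?_ ?_)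
    · simp [loadUncovered, loadEdge, loadEdgeRev, Program.block, Program.bound, Expr.cost,
        Test.cost]
      omega
    rintro _ s₁ ⟨rfl, y, w, a₁, l₁, hcov⟩
    have hr : s₁.reg 2 = e := (a₁.reg 2 (by decide)).trans h2
    have hs₁ := hs.congr a₁ (by decide)
    have hev : (Test.eq (.get 10 (.reg 3)) (.const 0)).eval s₁ ↔ s.arr 10 y = 0 := by
      simp only [Test.eval, Expr.eval, l₁.reg_y, a₁.arr 10 (by decide)]
    have hcost : (Test.eq (.get 10 (.reg 3)) (.const 0)).cost = 4 := rfl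
    by_cases hb : s.arr 10 y = 0
    · have hb' := hev.2 hb
      have hm := choose_mark_halts hs₁ hW hr he hed (chooseUncovered_pre hs₁.core hs₁.split hW he
        hed hp l₁ (by rw [a₁.arr 10 (by decide)]; exact hb)) φ
      obtain ⟨t, s', φ', x1, x2, x3, f, D', rfl, x5, x6, x7⟩ := hm
      refine ⟨_, s', _, .ite_true hb' x1, ?_, x3, _, D', rfl, x5,
        ⟨fun g h1 h2 => Or.inl (hJ.1 g h1 h2), fun g h1 h2 => Or.inl (hJ.2 g h1 h2)⟩,
        fun _ _ h => absurd (Or.inr (.refl e)) h,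
        fun g hg h1 h2 h3 => (hg h1 h2 fun h => h3 (Or.inl h)).mono x7⟩
      have : chooseUncovered.bound ≤ 210 := by
        simp [chooseUncovered, linkB, swing, nextEdge, merge, Program.block, Program.bound,
          Expr.cost, Test.cost]
      rw [hcost]; omega
    · refine ⟨_, s₁, _, .ite_false (fun h => hb (hev.1 h)) (.skip _), ?_, hr, done, D, rfl, hs₁, hJ,
        fun _ _ _ => hcov hb, fun g hg => hg⟩
      rw [hcost]; omega
  · rintro ψ s' ⟨done', D', h3, h4, h5, h6⟩
    exact ⟨done', D', h3, h4, h5.1, h5.2, h6⟩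

theorem phaseCovered_halts (hW : 3 * n + 2 * m + 3 ≤ W) (hs : Inv L al done D s)
    (h0 : ∀ e, DonePart L al 0 e done) (h1 : ∀ e, DonePart L al 1 e done)
    (h2 : ∀ e ∈ al, L.part e = 2 → e ∉ done → CoveredA L D e) (φ : ℕ) :
    Halts W phaseCovered s (φ + (doneᶜ).ncard * 60 + (m + 1) * 200) fun _ s' =>
      ∃ D', Inv L al al D' s' := by
  refine (phase_halts (c := 2) (b := 170)
    (J := fun done D => (∀ e, DonePart L al 0 e done) ∧ (∀ e, DonePart L al 1 e done) ∧
      ∀ e ∈ al, L.part e = 2 → e ∉ done → CoveredA L D e)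
    (G := fun e done D => DonePart L al 2 e done)
    (by omega) ?_ ?_ hs ⟨h0, h1, h2⟩ φ).mono le_rfl ?_
  · intro done D e _ h he hp
    by_contra hed
    exact h he hed hp
  · intro s done D e φ h2 hs hJ he hed hp
    refine (choose_mark_halts hs hW h2 he hed
      -- The set `done` is a union of whole cycles, so every edge of this cycle is undone and
      -- therefore covered.
      (chooseCovered_pre hs.core hs.split hW h2 he hed hp fun f hf =>
        hJ.2.2 f (Conn.mem hf he) (hf.part_eq.trans hp) fun hfd =>
          hed (hs.split.split.trans.closed' hfd hf.symm)) φ).mono ?_ ?_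
    · simp [chooseCovered, loadEdge, swing, nextEdge, merge, Program.block, Program.bound,
        Expr.cost, Test.cost]
    · rintro ψ s' ⟨x1, f, D', rfl, x2, x3, x4⟩
      exact ⟨x1, _, D', rfl, x2, ⟨fun g h1 h2 => Or.inl (hJ.1 g h1 h2),
        fun g h1 h2 => Or.inl (hJ.2.1 g h1 h2),
        fun g h1 h2 h3 => (hJ.2.2 g h1 h2 fun h => h3 (Or.inl h)).mono x4⟩,
        fun _ _ => Or.inr (.refl e), fun g hg h1 h2 => Or.inl (hg h1 h2)⟩
  · rintro ψ s' ⟨done', D', -, h4, h5, h6⟩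
    have : done' = al := by
      refine h4.split.split.trans.sub.antisymm fun e he => ?_
      rcases mem_col_cases (L := L) e with hp | hp | hp
      exacts [h5.1 e he hp, h5.2.1 e he hp, h6 e he hp]
    exact ⟨D', this ▸ h4⟩

end EdgeList

/-! ### The whole program -/

namespace EdgeList

/-- The program that converts three pseudoforests into four forests. -/
def forestProgram : Program :=
  .seq initEnds (.seq build (.seq strip (.seq phaseA (.seq phaseB
    (.seq phaseUncovered phaseCovered)))))

variable {n m W : ℕ} {L : EdgeList n m 3}

theorem hasInput_inputState (L : EdgeList n m 3) : HasInput L (inputState L) where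
  reg_zero := rfl
  reg_one := rfl
  src e := by simp [inputState, arrayOf]
  dst e := by simp [inputState, arrayOf]
  part e := by simp [inputState, arrayOf]

theorem forestProgram_halts (hL : L.IsSimple) (hP : ∀ c, IsPseudoforest (L.gr (L.col c)))
    (hW : 3 * n + 2 * m + 3 ≤ W) :
    ∃ t s, Exec W forestProgram (inputState L) t s ∧ t ≤ 2000 * (n + m + 1) ∧
      ∃ (al : Finset (Fin m)) (D : Distribution n m), Inv L al al D s := by
  suffices h : Halts W forestProgram (inputState L) (2000 * (n + m + 1)) fun _ s =>
      ∃ (al : Finset (Fin m)) (D : Distribution n m), Inv L al al D s by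
    obtain ⟨t, s, φ, h1, h2, h3⟩ := h
    exact ⟨t, s, h1, by omega, h3⟩
  have hzero : ∀ a, 3 ≤ a → (inputState L).arr a = fun _ => 0 := by
    intro a ha
    simp only [inputState]
    rw [if_neg (by omega), if_neg (by omega), if_neg (by omega)]
  set s₀ := inputState L
  have i₀ : HasInput L s₀ := hasInput_inputState L
  refine Halts.seq ((initEnds_halts (by omega) i₀.reg_zero
    (1200 * (m + 1) + 60 * (n + 1))).mono (by omega) ?_)
  rintro _ s₁ ⟨rfl, a₁, e₁⟩
  have i₁ := i₀.congr a₁ (by decide) (by decide)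
  have z₁ : ∀ a, 3 ≤ a → a ∉ [12, 13] → s₁.arr a = fun _ => 0 := fun a ha h =>
    (a₁.arr a h).trans (hzero a ha)
  refine Halts.seq ((build_halts hL i₁ (z₁ 6 (by decide) (by decide)) (z₁ 7 (by decide) (by decide))
    (by omega) (1100 * (m + 1) + 60 * (n + 1))).mono (by omega) ?_)
  rintro _ s₂ ⟨rfl, a₂, o₂, n₂, c₂⟩
  have i₂ := i₁.congr a₂ (by decide) (by decide)
  have h8 : s₂.arr 8 = fun _ => 0 := (a₂.arr 8 (by decide)).trans (z₁ 8 (by decide) (by decide))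
  refine Halts.seq ((strip_halts hL i₂ n₂ c₂ h8 (by omega) (1000 * (m + 1))).mono (by omega) ?_)
  rintro _ s₃ ⟨rfl, a₃, al, d₃, c₃, hlf, hdeg⟩
  have z₃ : ∀ a, 8 < a → a ∉ [12, 13] → s₃.arr a = fun _ => 0 := fun a ha h =>
    (a₃.arr a (by simp; omega)).trans ((a₂.arr a (by simp; omega)).trans (z₁ a (by omega) h))
  have inv : Inv L al ∅ ⟨∅, ∅, ∅, ∅, ∅, id, id⟩ s₃ := by
    refine ⟨⟨hlf.isCore hL hP hdeg, i₂.congr a₃ (by decide) (by decide),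
      n₂.congr a₃ (by decide), c₃, d₃⟩, by simp [z₃ 9 (by decide) (by decide)], .empty, ?_, ?_, ?_,
      ?_, ?_, ?_⟩
    · exact fun v => Or.inl ⟨by rw [z₃ 10 (by decide) (by decide)], by simp⟩
    · exact fun v => Or.inl ⟨by rw [z₃ 11 (by decide) (by decide)], by simp⟩
    · simp [z₃ 14 (by decide) (by decide)]
    · rw [a₃.arr 12 (by decide), a₂.arr 12 (by decide)]
      exact fun v => (e₁ v).1
    · rw [a₃.arr 13 (by decide), a₂.arr 13 (by decide)]
      exact fun v => (e₁ v).2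
    · rw [a₃.arr 3 (by decide)]
      exact ⟨fun e _ => o₂ e, by simp, by simp, by simp⟩
  -- Initially no edge is marked. The marking fuel of 60 per edge is set aside here once and serves
  -- all four phases.
  have hm : ((∅ : Set (Fin m))ᶜ).ncard = m := by simp
  refine Halts.seq ((phaseA_halts hW inv (by simp) (by simp) (700 * (m + 1))).mono
    (by rw [hm]; omega) ?_)
  rintro _ s₄ ⟨done₄, D₄, rfl, inv₄, x₄, y₄⟩
  refine Halts.seq ((phaseB_halts hW inv₄ x₄ y₄ (500 * (m + 1))).mono (by omega) ?_)
  rintro _ s₅ ⟨done₅, D₅, rfl, inv₅, x₅, y₅⟩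
  refine Halts.seq ((phaseUncovered_halts hW inv₅ x₅ y₅ (200 * (m + 1))).mono (by omega) ?_)
  rintro _ s₆ ⟨done₆, D₆, rfl, inv₆, x₆, y₆, w₆⟩
  refine (phaseCovered_halts hW inv₆ x₆ y₆ w₆ 0).mono (by omega) ?_
  rintro _ s₇ ⟨D₇, inv₇⟩
  exact ⟨al, D₇, inv₇⟩

theorem Represents.isSimple {P : Fin 3 → SimpleGraph (Fin n)} (h : L.Represents P) :
    L.IsSimple where
  inj := h.nodup
  ne e he := by
    have : s(L.src e, L.dst e) ∈ (P (L.part e)).edgeSet := by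
      rw [h.edges]; exact ⟨e, rfl, rfl⟩
    exact (P (L.part e)).ne_of_adj this he

theorem Represents.gr_col {P : Fin 3 → SimpleGraph (Fin n)} (h : L.Represents P) (c : Fin 3) :
    L.gr (L.col c) = P c := by
  rw [← edgeSet_inj, h.edges]
  ext x
  rw [mem_edgeSet_gr h.isSimple]
  exact exists_congr fun e => and_congr Iff.rfl eq_comm

theorem IsOutput.lt {M LA LB FX : Set (Fin m)} {out : Fin m → ℕ} (h : IsOutput L M LA LB FX out)
    (e : Fin m) : out e < 4 := by
  by_cases he : e ∈ M
  · rcases mem_col_cases (L := L) e with hp | hp | hp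
    · rw [h.zero e ⟨he, hp⟩]; omega
    · rw [h.one e ⟨he, hp⟩]; split_ifs <;> omega
    · rw [h.two e ⟨he, hp⟩]; split_ifs <;> omega
  · rw [h.keep e he]; omega

end EdgeList

open EdgeList in
/-- There are one program and one constant `K` such that, for every finite simple graph `G` and
every pseudoforest partition `(P 0, P 1, P 2)` of it, given as an edge list, the program halts
within `K * (n + m + 1)` steps (with words of size `log₂ (n + m + 1) + O(1)` bits) and leaves in
array `3` the part numbers of a forest partition `(F 0, F 1, F 2, F 3)` of `G` in which `F 3` has
maximum degree at most three. -/
theorem mainTheorem5 :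
    ∃ (prog : RAM.Program) (K : ℕ),
      ∀ (n m : ℕ) (G : SimpleGraph (Fin n)) (P : Fin 3 → SimpleGraph (Fin n))
        (L : EdgeList n m 3),
        IsPseudoforestPartition G P → L.Represents P →
        ∃ (t : ℕ) (s : RAM.State),
          RAM.Exec (K * (n + m + 1)) prog (RAM.inputState L) t s ∧
          t ≤ K * (n + m + 1) ∧
          ∃ (F : Fin 4 → SimpleGraph (Fin n)) (out : Fin m → Fin 4),
            (∀ i : Fin m, s.arr 3 i = out i) ∧
            EdgeList.Represents ⟨L.src, L.dst, out⟩ F ∧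
            IsForestPartition G F ∧
            ∀ [DecidableRel (F 3).Adj], (F 3).maxDegree ≤ 3 := by
  -- The constant covers the summed budgets of all stages, and it also makes words large enough for
  -- every stored number, for which `3 * n + 2 * m + 3` suffices.
  refine ⟨forestProgram, 2000, fun n m G P L hG hL => ?_⟩
  have hs := hL.isSimple
  obtain ⟨t, s, hex, ht, al, D, hinv⟩ := forestProgram_halts hs
    (fun c => by rw [hL.gr_col]; exact hG.2 c) (W := 2000 * (n + m + 1)) (by omega)
  have hc := hinv.core.core
  have hsp := hinv.split.split
  have ho := hinv.split.out
  set out : Fin m → Fin 4 := fun e => ⟨s.arr 3 e, ho.lt e⟩ with hout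
  have hF : ∀ i : Fin 4, {e | out e = i} = {e : Fin m | s.arr 3 e = i} := fun i => by
    ext e; simp [hout, Fin.ext_iff]
  refine ⟨t, s, hex, ht, fun i => L.gr {e | out e = i}, out, fun _ => rfl, ⟨hL.nodup, fun i => ?_⟩,
    ⟨⟨fun i j hij => ?_, ?_⟩, fun i => ?_⟩, ?_⟩
  · ext x
    rw [mem_edgeSet_gr hs]
    exact exists_congr fun e => and_congr Iff.rfl eq_comm
  · rw [Set.disjoint_left]
    intro x hx hy
    obtain ⟨e, he, rfl⟩ := (mem_edgeSet_gr hs).1 hx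
    obtain ⟨f, hf, hfe⟩ := (mem_edgeSet_gr hs).1 hy
    obtain rfl := hs.inj hfe
    exact hij (he.symm.trans hf)
  · rw [← hG.1.union]
    ext x
    simp only [Set.mem_iUnion, mem_edgeSet_gr hs, hL.edges]
    constructor
    · rintro ⟨-, e, -, rfl⟩
      exact ⟨_, e, rfl, rfl⟩
    · rintro ⟨-, e, -, rfl⟩
      exact ⟨_, e, rfl, rfl⟩
  · change (L.gr {e | out e = i}).IsAcyclic
    rw [hF]
    fin_cases i
    · exact hsp.isAcyclic_zero hc ho
    · exact hsp.isAcyclic_one hc ho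
    · exact hsp.isAcyclic_two hc ho
    · exact hsp.isAcyclic_three hc ho
  · intro _
    refine maxDegree_le_of_forall_degree_le _ _ fun v => ?_
    classical
    have h3 := hsp.degree_three_le hc ho v
    convert h3 using 2
    exact congrArg L.gr (hF 3)
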